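/- **Definitions.** Let $n\ge 1$ and $\mathbb D_\tau=\{z\in\mathbb C:|z|<\tau\}$. For a holomorphic germ $f\in\mathbb C\{z_1,\dots,z_n\}$ and a set $V\subset\mathbb C^n$, say that $f$ *continues off $V$* if there is $\tau>0$ such that $f$ is holomorphic on $\mathbb D_\tau^n$ and admits analytic continuation along every $C^1$ path $\gamma:[0,1]\to\mathbb C^n\setminus V$ with $\gamma(0)\in\mathbb D_\tau^n$. The set $\widehat{\mathcal Q}^{\mathcal A}_n$ of algebro-resurgent germs consists of the $f\in\mathbb C\{z_1,\dots,z_n\}$ which continue off some proper algebraic subvariety $V\subsetneq\mathbb C^n$. A nonzero polynomial is called *simple* with respect to one of its variables if, as a polynomial in this variable over the ring of polynomials in the other variables, it has pairwise distinct roots in an algebraic closure of the fraction field of that ring (in particular if it does not involve the variable). For germs $\hat f(\xi,q,p),\hat g(\xi,q,p)\in\mathbb C\{\xi,q,p\}$ put $$F(\xi_1,\xi_2,\xi_3,q,p)=\frac1{2\pi}\int_0^{2\pi}\hat f(\xi_1,q,p+\sqrt{\xi_3}\,e^{-i\theta})\,\hat g(\xi_2,q+\sqrt{\xi_3}\,e^{i\theta},p)\,d\theta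 .$$ For a germ $F\in\mathbb C\{z_1,\dots,z_n\}$ and indices $i,j\in\{1,\dots,n\}$ put $$(\odot_{ij}F)(\xi,z_1,\dots,z_n)=\frac1{2\pi}\int_0^{2\pi}F\big(z+\sqrt\xi\,e^{-i\theta}e_i+\sqrt\xi\,e^{i\theta}e_j\big)\,d\theta ,$$ where $z=(z_1,\dots,z_n)$ and $e_1,\dots,e_n$ is the standard basis of $\mathbb C^n$. **Statement.** 1. If $\hat f,\hat g\in\widehat{\mathcal Q}^{\mathcal A}_3$, then $F\in\widehat{\mathcal Q}^{\mathcal A}_5$. 2. Explicitly, let $P_1,\dots,P_R\in\mathbb C[\xi,q,p]$ be $p$-simple and $Q_1,\dots,Q_S\in\mathbb C[\xi,q,p]$ be $q$-simple ($R,S\ge1$). Let $M_J$ be the degree of $P_J$ in $p$ and $N_K$ the degree of $Q_K$ in $q$. Let $V^{JK}$ be the complement in $\mathbb C^5$ of the set of all $(\xi_1,\xi_2,\xi_3,q,p)$ such that the polynomial $P_J(\xi_1,q,p+z)$ in $z$ has exactly $M_J$ distinct nonzero roots and is not identically zero, the polynomial $Q_K(\xi_2,q+z,p)$ in $z$ has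 exactly $N_K$ distinct nonzero roots and is not identically zero, $\xi_3\neq0$, and $\xi_3\ne\omega\Omega$ for all roots $\omega$ of the first and $\Omega$ of the second polynomial. Then each $V^{JK}$ and $\bigcap_{J,K}V^{JK}$ are proper algebraic subvarieties of $\mathbb C^5$, and if $\hat f$ continues off $\bigcap_J\{P_J=0\}$ and $\hat g$ continues off $\bigcap_K\{Q_K=0\}$, then $F$ continues off $\bigcap_{J,K}V^{JK}$. 3. If $F\in\widehat{\mathcal Q}^{\mathcal A}_n$ and $i,j\in\{1,\dots,n\}$, then $\odot_{ij}F\in\widehat{\mathcal Q}^{\mathcal A}_{n+1}$. 4. Explicitly, let $P\in\mathbb C[z_1,\dots,z_n]$ be nonzero and $i,j\in\{1,\dots,n\}$. Let $N$ be the smallest integer $\ge 0$ for which $Q(u)=u^N P\big(z+u\,e_i+\tfrac{\xi}{u}\,e_j\big)$ is a polynomial in $u,\xi,z_1,\dots,z_n$, and let $M$ be the degree of $Q$ in $u$; thus $N=\deg_{z_j}P$ and $M=\deg_{z_i}P+\deg_{z_j}P$. Let $V$ be the complement in $\mathbb C^{n+1}$ of the set of all $(\xi,z_1,\dots,z_n)$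 for which $Q$, as a polynomial in $u$, is not identically zero and has exactly $M$ distinct nonzero roots. If $F$ continues off $\{P=0\}$, then $\odot_{ij}F$ continues off $V$. If moreover $P$ is squarefree, $V$ is a proper algebraic subvariety of $\mathbb C^{n+1}$. -/

import Mathlib

open Set Filter Topology

/-- A germ at `γ 0`, represented by a function `f`, admits analytic continuation along the path
`γ : [0,1] → ℂⁿ`: there are holomorphic germs `φ t` at the points `γ t`, starting with the germ
of `f` at `γ 0`, such that germs at nearby times are restrictions of one another. -/
def HasContinuationAlong {n : ℕ} (f : (Fin n → ℂ) → ℂ) (γ : ℝ → Fin n → ℂ) : Prop :=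
  ∃ φ : ℝ → (Fin n → ℂ) → ℂ,
    φ 0 =ᶠ[𝓝 (γ 0)] f ∧
    (∀ t ∈ Icc (0 : ℝ) 1, AnalyticAt ℂ (φ t) (γ t)) ∧
    (∀ t ∈ Icc (0 : ℝ) 1, ∀ᶠ s in 𝓝[Icc (0 : ℝ) 1] t, φ s =ᶠ[𝓝 (γ s)] φ t)

/-- The germ at the origin represented by `f` is holomorphic and admits analytic continuation along
every `C¹` path that avoids `V` and starts close enough to the origin, that is, in a polydisc
(a ball for the sup norm of `Fin n → ℂ`) on which `f` is holomorphic. -/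
def ContinuableAvoiding {n : ℕ} (f : (Fin n → ℂ) → ℂ) (V : Set (Fin n → ℂ)) : Prop :=
  ∃ τ : ℝ, 0 < τ ∧ AnalyticOnNhd ℂ f (Metric.ball 0 τ) ∧
    ∀ γ : ℝ → Fin n → ℂ, ContDiffOn ℝ 1 γ (Icc 0 1) → γ 0 ∈ Metric.ball (0 : Fin n → ℂ) τ →
      (∀ t ∈ Icc (0 : ℝ) 1, γ t ∉ V) → HasContinuationAlong f γ

/-- `V` is a proper algebraic subvariety of `ℂⁿ`: the common zero set of some polynomials, and not
the whole space. -/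
def IsProperAlgebraicSubvariety {n : ℕ} (V : Set (Fin n → ℂ)) : Prop :=
  (∃ I : Ideal (MvPolynomial (Fin n) ℂ), V = MvPolynomial.zeroLocus ℂ I) ∧ V ≠ univ

/-- The germ at the origin of `ℂⁿ` represented by `f` is algebro-resurgent. -/
def IsAlgebroResurgent {n : ℕ} (f : (Fin n → ℂ) → ℂ) : Prop :=
  ∃ V : Set (Fin n → ℂ), IsProperAlgebraicSubvariety V ∧ ContinuableAvoiding f V

/-- The zero set of a polynomial. -/
def zeroSet {n : ℕ} (P : MvPolynomial (Fin n) ℂ) : Set (Fin n → ℂ) :=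
  {x | MvPolynomial.eval x P = 0}

/-- `P` is nonzero and simple with respect to its `k`-th variable: seen as a polynomial in `X k`
over the ring of polynomials in the other variables, it has pairwise distinct roots in an algebraic
closure of the fraction field of that ring. (The swap moves the variable `X k` to the place `0`,
which `finSuccEquiv` singles out.) -/
def IsSimpleIn {n : ℕ} (k : Fin (n + 1)) (P : MvPolynomial (Fin (n + 1)) ℂ) : Prop :=
  P ≠ 0 ∧
    ((MvPolynomial.finSuccEquiv ℂ n (MvPolynomial.rename (Equiv.swap 0 k) P)).aroots
      (AlgebraicClosure (FractionRing (MvPolynomial (Fin n) ℂ)))).Nodup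

/-- The `θ`-averaged product
`F(ξ₁,ξ₂,ξ₃,q,p) = (2π)⁻¹ ∫₀^{2π} f(ξ₁, q, p + √ξ₃ e^{-iθ}) g(ξ₂, q + √ξ₃ e^{iθ}, p) dθ`;
the coordinates of `x` are `(ξ₁,ξ₂,ξ₃,q,p)`, those of the arguments of `f` and `g` are `(ξ,q,p)`. -/
noncomputable def thetaProduct (f g : (Fin 3 → ℂ) → ℂ) (x : Fin 5 → ℂ) : ℂ :=
  (1 / (2 * Real.pi) : ℂ) * ∫ θ in (0 : ℝ)..(2 * Real.pi),
    f ![x 0, x 3, x 4 + Complex.sqrt (x 2) * Complex.exp (-(Complex.I * θ))] *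
    g ![x 1, x 3 + Complex.sqrt (x 2) * Complex.exp (Complex.I * θ), x 4]

/-- The set of points `(ξ₁,ξ₂,ξ₃,q,p)` to be avoided by the `θ`-averaged product when its factors
avoid `P = 0` and `Q = 0`. Let `M` be the degree of `P(ξ,q,p)` in `p` and `N` the degree of
`Q(ξ,q,p)` in `q`. The complement consists of the points for which `z ↦ P(ξ₁,q,p+z)` has `M`
distinct nonzero roots, `z ↦ Q(ξ₂,q+z,p)` has `N` distinct nonzero roots, `ξ₃ ≠ 0`, and `ξ₃` is not
the product of a root of the first with a root of the second. (For the zero polynomial the set of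
nonzero roots is infinite, so the conditions on the cardinality fail.) -/
def thetaAvoided (P Q : MvPolynomial (Fin 3) ℂ) : Set (Fin 5 → ℂ) :=
  {x | {z : ℂ | z ≠ 0 ∧ MvPolynomial.eval ![x 0, x 3, x 4 + z] P = 0}.encard
          = (P.degreeOf 2 : ℕ∞) ∧
       {z : ℂ | z ≠ 0 ∧ MvPolynomial.eval ![x 1, x 3 + z, x 4] Q = 0}.encard
          = (Q.degreeOf 1 : ℕ∞) ∧
       x 2 ≠ 0 ∧
       ∀ ω Ω : ℂ, MvPolynomial.eval ![x 0, x 3, x 4 + ω] P = 0 →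
          MvPolynomial.eval ![x 1, x 3 + Ω, x 4] Q = 0 → x 2 ≠ ω * Ω}ᶜ

/-- The point `z + a eᵢ + b eⱼ`. -/
def shiftTwo {n : ℕ} (i j : Fin n) (z : Fin n → ℂ) (a b : ℂ) : Fin n → ℂ :=
  z + Pi.single i a + Pi.single j b

/-- The operator `⊙ᵢⱼ`:
`(⊙ᵢⱼ F)(ξ,z) = ∫₀^{2π} F(…, zᵢ + √ξ e^{-iθ}, …, zⱼ + √ξ e^{iθ}, …) dθ/(2π)`;
the coordinates of `w` are `(ξ,z₁,…,zₙ)`. -/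
noncomputable def hadamardOp {n : ℕ} (i j : Fin n) (F : (Fin n → ℂ) → ℂ)
    (w : Fin (n + 1) → ℂ) : ℂ :=
  (1 / (2 * Real.pi) : ℂ) * ∫ θ in (0 : ℝ)..(2 * Real.pi),
    F (shiftTwo i j (Fin.tail w) (Complex.sqrt (w 0) * Complex.exp (-(Complex.I * θ)))
      (Complex.sqrt (w 0) * Complex.exp (Complex.I * θ)))

/-- The set of points `(ξ,z₁,…,zₙ)` to be avoided by `⊙ᵢⱼ F` when `F` avoids `P = 0`. Let
`Q(u) = u ^ N * P(…, zᵢ + u, …, zⱼ + ξ/u, …)`, with `N` the least exponent that makes this a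
polynomial in `u, ξ, z₁, …, zₙ`, and let `M` be its degree in `u`. The complement consists of the
points for which `Q` has `M` distinct nonzero roots `u`. Here `N` is the degree of `P` in `zⱼ` and
`M` is the sum of its degrees in `zᵢ` and `zⱼ` (also for `i = j`), because the extreme powers of `u`
in `P(…, zᵢ + u, …, zⱼ + ξ/u, …)` cannot cancel. -/
def hadamardAvoided {n : ℕ} (i j : Fin n) (P : MvPolynomial (Fin n) ℂ) :
    Set (Fin (n + 1) → ℂ) :=
  {w | {u : ℂ | u ≠ 0 ∧ MvPolynomial.eval (shiftTwo i j (Fin.tail w) u (w 0 / u)) P = 0}.encard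
          = ((P.degreeOf i + P.degreeOf j : ℕ) : ℕ∞)}ᶜ

/-! Substituting `u = √ξ e^{-iθ}` turns either average into `(2πi)⁻¹ ∮ k(x, u, ξ/u) du/u` over a
circle about `0`, where `ξ` is one of the coordinates of `x`. For small `x` every radius in a fixed
open interval is allowed (`thetaAverage_eq_integral`). The integrand can be singular in `u` only at
`0` and where an argument of `F`, `f` or `g` meets the given variety. These points lie among the
roots of `u * Q(u)`, a polynomial in `u` with coefficients polynomial in `x`; for the product, `Q`
combines `P_J(ξ₁,q,p+u)` with `Q_K(ξ₂,q+ξ₃/u,p)`.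

Off the avoided set, one of these polynomials has as many distinct roots as its formal degree
allows. Its roots are then simple, none is lost to infinity, and by the implicit function theorem
they move as disjoint `C¹` functions along a path (`movesSmoothlyNear_of_encard`). Local motions of
the plane following them are patched, by compactness, into an isotopy under which all but finitely
many points avoid the singularities at all times (`exists_isMotion`). A circle missing the
exceptional points is carried along. The integrand continues along the trajectory of each of its
points, and the integral over the moved contour continues the average (`continuesAlong_integral`).
With several polynomials, the one that has enough roots may change with time; only the common roots
must be avoided, so the local motions still patch. All of this is collected in
`continuableAvoiding_thetaAverage`.

Having the full number of distinct roots means nonvanishing of a discriminant, so the avoided sets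
are algebraic (`exists_discriminant`). Simplicity and squarefreeness give properness. For the
product, a generic `(ξ₁,ξ₂,q,p)` gives full root sets and `ξ₃` need only avoid finitely many values.
For `⊙ᵢⱼ`, the substitution `ξ = uv`, `z ↦ z - u eᵢ - v eⱼ` turns `Q` into `u^N P(z)`, so `u * Q` is
squarefree when `P` is; by Gauss's lemma and characteristic zero it is separable in `u`.

The qualitative statements follow by enlarging the variety to the zero set of a squarefree
polynomial. -/

/-! ### Holomorphic primitives in the last variable -/

section Primitive

variable {E : Type*} [NormedAddCommGroup E] [NormedSpace ℂ E]

/-- Scaling of the second factor of a product. -/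
noncomputable def scaleSnd (E : Type*) [NormedAddCommGroup E] [NormedSpace ℂ E] (θ : ℝ) :
    E × ℂ →L[ℂ] E × ℂ :=
  (ContinuousLinearMap.fst ℂ E ℂ).prod ((θ : ℂ) • ContinuousLinearMap.snd ℂ E ℂ)

theorem scaleSnd_apply (θ : ℝ) (y : E × ℂ) : scaleSnd E θ y = (y.1, θ * y.2) := rfl

theorem continuous_scaleSnd : Continuous (scaleSnd E) := by
  have h : scaleSnd E = fun θ : ℝ => (ContinuousLinearMap.inl ℂ E ℂ).comp
      (ContinuousLinearMap.fst ℂ E ℂ) + (θ : ℂ) • (ContinuousLinearMap.inr ℂ E ℂ).comp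
      (ContinuousLinearMap.snd ℂ E ℂ) := by
    funext θ
    ext <;> simp [scaleSnd]
  rw [h]
  fun_prop

theorem norm_scaleSnd_apply_le {θ : ℝ} (h0 : 0 ≤ θ) (h1 : θ ≤ 1) (y : E × ℂ) :
    ‖scaleSnd E θ y‖ ≤ ‖y‖ := by
  rw [scaleSnd_apply, Prod.norm_def, Prod.norm_def]
  refine max_le_max le_rfl ?_
  rw [norm_mul, Complex.norm_real, Real.norm_of_nonneg h0]
  exact mul_le_of_le_one_left (norm_nonneg _) h1

theorem norm_scaleSnd_le {θ : ℝ} (h0 : 0 ≤ θ) (h1 : θ ≤ 1) : ‖scaleSnd E θ‖ ≤ 1 :=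
  ContinuousLinearMap.opNorm_le_bound _ zero_le_one fun y => by
    simpa using norm_scaleSnd_apply_le h0 h1 y

/-- The average over `θ ∈ [0,1]` of the power series composed with `scaleSnd E θ`. -/
noncomputable def averageSeries (p : FormalMultilinearSeries ℂ (E × ℂ) ℂ) :
    FormalMultilinearSeries ℂ (E × ℂ) ℂ := fun n =>
  ∫ θ in (0 : ℝ)..1, (p n).compContinuousLinearMap fun _ => scaleSnd E θ

theorem continuous_comp_scaleSnd (p : FormalMultilinearSeries ℂ (E × ℂ) ℂ) (n : ℕ) :
    Continuous fun θ : ℝ => (p n).compContinuousLinearMap fun _ => scaleSnd E θ := by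
  have h1 := (ContinuousMultilinearMap.compContinuousLinearMapContinuousMultilinear ℂ
    (fun _ : Fin n => E × ℂ) (fun _ : Fin n => E × ℂ) ℂ).cont
  have h2 : Continuous fun θ : ℝ => fun _ : Fin n => scaleSnd E θ :=
    continuous_pi fun _ => continuous_scaleSnd
  have h3 := h1.comp h2
  exact h3.clm_apply (continuous_const (y := p n))

theorem averageSeries_apply (p : FormalMultilinearSeries ℂ (E × ℂ) ℂ) (n : ℕ)
    (v : Fin n → E × ℂ) :
    averageSeries p n v = ∫ θ in (0 : ℝ)..1, p n fun i => scaleSnd E θ (v i) := by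
  have := ContinuousLinearMap.intervalIntegral_comp_comm (a := (0 : ℝ)) (b := 1)
    (μ := MeasureTheory.volume)
    (ContinuousMultilinearMap.apply ℂ (fun _ : Fin n => E × ℂ) ℂ v)
    ((continuous_comp_scaleSnd p n).intervalIntegrable 0 1)
  exact this.symm

theorem norm_averageSeries_le (p : FormalMultilinearSeries ℂ (E × ℂ) ℂ) (n : ℕ) :
    ‖averageSeries p n‖ ≤ ‖p n‖ := by
  have := intervalIntegral.norm_integral_le_of_norm_le_const (a := (0 : ℝ)) (b := 1)
    (f := fun θ : ℝ => (p n).compContinuousLinearMap fun _ => scaleSnd E θ) (C := ‖p n‖) ?_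
  · rw [sub_zero, abs_one, mul_one] at this
    exact this
  · intro θ hθ
    rw [uIoc_of_le zero_le_one] at hθ
    refine (ContinuousMultilinearMap.norm_compContinuousLinearMap_le _ _).trans ?_
    refine mul_le_of_le_one_right (norm_nonneg _) ?_
    exact Finset.prod_le_one (fun _ _ => norm_nonneg _)
      fun _ _ => norm_scaleSnd_le hθ.1.le hθ.2

/-- The expansion is integrated term by term. Scaling by `θ ∈ [0,1]` does not increase norms, so `‖p
n‖ * ‖v‖ ^ n` dominates and no radius of convergence is lost. -/
theorem HasFPowerSeriesOnBall.average {H : E × ℂ → ℂ} {p : FormalMultilinearSeries ℂ (E × ℂ) ℂ}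
    {y₀ : E × ℂ} {r : ENNReal} (hp : HasFPowerSeriesOnBall H p y₀ r) :
    HasFPowerSeriesOnBall
      (fun y => ∫ θ in (0 : ℝ)..1, H (y₀ + scaleSnd E θ (y - y₀))) (averageSeries p) y₀ r where
  r_le := by
    refine hp.r_le.trans (FormalMultilinearSeries.radius_le_of_le ?_)
    exact norm_averageSeries_le p
  r_pos := hp.r_pos
  hasSum := by
    intro v hv
    simp only [add_sub_cancel_left, averageSeries_apply]
    have hv' : ‖v‖ₑ < r := by simpa using hv
    refine intervalIntegral.hasSum_integral_of_dominated_convergence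
      (fun n _ => ‖p n‖ * ‖v‖ ^ n) ?_ ?_ ?_ ?_ ?_
    · intro n
      have := (ContinuousMultilinearMap.apply ℂ (fun _ : Fin n => E × ℂ) ℂ
        (fun _ => v)).continuous.comp (continuous_comp_scaleSnd p n)
      exact this.aestronglyMeasurable
    · intro n
      refine Eventually.of_forall fun θ hθ => ?_
      rw [uIoc_of_le zero_le_one] at hθ
      refine ((p n).le_opNorm _).trans ?_
      refine mul_le_mul_of_nonneg_left ?_ (norm_nonneg _)
      simp only [Finset.prod_const, Finset.card_univ, Fintype.card_fin]
      exact pow_le_pow_left₀ (norm_nonneg _) (norm_scaleSnd_apply_le hθ.1.le hθ.2 v) n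
    · refine Eventually.of_forall fun θ _ => ?_
      have : (‖v‖₊ : ENNReal) < p.radius := lt_of_lt_of_le hv' hp.r_le
      simpa using p.summable_norm_mul_pow this
    · exact intervalIntegrable_const
    · refine Eventually.of_forall fun θ hθ => ?_
      rw [uIoc_of_le zero_le_one] at hθ
      refine hp.hasSum ?_
      have : ‖scaleSnd E θ v‖ₑ ≤ ‖v‖ₑ := by
        rw [enorm_le_iff_norm_le]
        exact norm_scaleSnd_apply_le hθ.1.le hθ.2 v
      simpa using this.trans_lt hv'

/-- A holomorphic function on a product with `ℂ` has locally a holomorphic primitive with respect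
to the last variable. -/
theorem AnalyticAt.exists_primitive_snd {H : E × ℂ → ℂ} {y₀ : E × ℂ} (hH : AnalyticAt ℂ H y₀) :
    ∃ ρ > 0, AnalyticOnNhd ℂ H (Metric.ball y₀ ρ) ∧
      ∃ P : E × ℂ → ℂ, AnalyticOnNhd ℂ P (Metric.ball y₀ ρ) ∧
        ∀ y ∈ Metric.ball y₀ ρ, HasDerivAt (fun u => P (y.1, u)) (H y) y.2 := by
  obtain ⟨p, r, hp⟩ := hH
  obtain ⟨ρ, hρ0, hρr⟩ := ENNReal.lt_iff_exists_real_btwn.1 hp.r_pos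
  have hρpos : 0 < ρ := by simpa using hρr.1
  have hball : Metric.ball y₀ ρ ⊆ Metric.eball y₀ r := by
    intro y hy
    rw [Metric.mem_eball, edist_dist]
    exact (ENNReal.ofReal_lt_ofReal_iff hρpos |>.2 hy).trans hρr.2
  have hHan : AnalyticOnNhd ℂ H (Metric.ball y₀ ρ) := hp.analyticOnNhd.mono hball
  -- The primitive is the integral of `H` along the segment from the central value of `u`. Written
  -- as an average over `[0,1]`, it is visibly holomorphic in all variables together.
  refine ⟨ρ, hρpos, hHan,
    fun y => (y.2 - y₀.2) * ∫ θ in (0 : ℝ)..1, H (y₀ + scaleSnd E θ (y - y₀)), ?_, ?_⟩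
  · intro y hy
    refine AnalyticAt.mul (analyticAt_snd.sub analyticAt_const) ?_
    exact hp.average.analyticOnNhd y (hball hy)
  · rintro ⟨x, u⟩ hy
    obtain ⟨hx, hu⟩ : dist x y₀.1 < ρ ∧ dist u y₀.2 < ρ := by
      simpa [Prod.dist_eq] using hy
    have hdiff : DifferentiableOn ℂ (fun u => H (x, u)) (Metric.ball y₀.2 ρ) := by
      intro u hu
      have : AnalyticAt ℂ H (x, u) := hHan _ (by
        simp only [Metric.mem_ball, Prod.dist_eq, max_lt_iff]; exact ⟨hx, hu⟩)
      have h2 : DifferentiableAt ℂ (fun u => (x, u)) u := by fun_prop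
      exact (this.differentiableAt.comp u h2).differentiableWithinAt
    obtain ⟨g, hg⟩ := hdiff.isExactOn_ball
    -- For fixed `x` the candidate differs by a constant from a one-variable primitive `g` on the
    -- disc, which supplies the derivative.
    have key : ∀ w ∈ Metric.ball y₀.2 ρ,
        (w - y₀.2) * ∫ θ in (0 : ℝ)..1, H (y₀ + scaleSnd E θ ((x, w) - y₀)) = g w - g y₀.2 := by
      intro w hw
      have hmem : ∀ θ ∈ uIcc (0 : ℝ) 1, y₀.2 + θ * (w - y₀.2) ∈ Metric.ball y₀.2 ρ := by
        intro θ hθ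
        rw [uIcc_of_le zero_le_one] at hθ
        rw [mem_ball_iff_norm, add_sub_cancel_left, norm_mul, Complex.norm_real,
          Real.norm_of_nonneg hθ.1]
        rw [mem_ball_iff_norm] at hw
        exact (mul_le_of_le_one_left (norm_nonneg _) hθ.2).trans_lt hw
      have hder : ∀ θ ∈ uIcc (0 : ℝ) 1, HasDerivAt (fun θ : ℝ => g (y₀.2 + θ * (w - y₀.2)))
          ((w - y₀.2) * H (y₀ + scaleSnd E θ ((x, w) - y₀))) θ := by
        intro θ hθ
        have h1 : HasDerivAt (fun θ : ℝ => y₀.2 + θ * (w - y₀.2)) (w - y₀.2) θ := by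
          have := ((Complex.ofRealCLM.hasDerivAt (x := θ)).mul_const (w - y₀.2)).const_add y₀.2
          simpa using this
        have h2 := (hg _ (hmem θ hθ)).comp θ h1
        refine h2.congr_deriv ?_
        rw [mul_comm]
        exact congrArg _ (congrArg H (Prod.ext (by simp [scaleSnd_apply])
          (by simp [scaleSnd_apply])))
      have hcont : ContinuousOn (fun θ : ℝ => (w - y₀.2) * H (y₀ + scaleSnd E θ ((x, w) - y₀)))
          (uIcc 0 1) := by
        refine continuousOn_const.mul ?_
        refine hHan.continuousOn.comp ?_ ?_
        · exact (continuous_const.add (continuous_scaleSnd.clm_apply continuous_const)).continuousOn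
        · intro θ hθ
          have := hmem θ hθ
          simp only [Metric.mem_ball, Prod.dist_eq, max_lt_iff] at this ⊢
          refine ⟨?_, ?_⟩
          · simpa [scaleSnd_apply] using hx
          · simpa only [scaleSnd_apply, Prod.snd_add, Prod.snd_sub] using this
      have := intervalIntegral.integral_eq_sub_of_hasDerivAt hder hcont.intervalIntegrable
      rw [intervalIntegral.integral_const_mul] at this
      simpa using this
    have hev : (fun w => (w - y₀.2) * ∫ θ in (0 : ℝ)..1, H (y₀ + scaleSnd E θ ((x, w) - y₀)))
        =ᶠ[𝓝 u] fun w => g w - g y₀.2 := by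
      filter_upwards [Metric.isOpen_ball.mem_nhds (show u ∈ Metric.ball y₀.2 ρ from hu)] with w hw
      exact key w hw
    exact ((hg u hu).sub_const _).congr_of_eventuallyEq hev

end Primitive

/-! ### Analytic continuation along paths and families of paths -/

section Continuation

variable {Y : Type*} [NormedAddCommGroup Y] [NormedSpace ℂ Y]

/-- The functions `φ t`, for `t ∈ J`, represent holomorphic germs at the points `γ t` of a path,
such that germs at nearby times are restrictions of one another. -/
structure IsContinuationOn (J : Set ℝ) (γ : ℝ → Y) (φ : ℝ → Y → ℂ) : Prop where
  analyticAt : ∀ t ∈ J, AnalyticAt ℂ (φ t) (γ t)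
  coherent : ∀ t ∈ J, ∀ᶠ s in 𝓝[J] t, φ s =ᶠ[𝓝 (γ s)] φ t

/-- Analytic continuation of the germ of `f` at `γ 0` along the path `γ` in a normed space. -/
def ContinuesAlong (f : Y → ℂ) (γ : ℝ → Y) : Prop :=
  ∃ φ : ℝ → Y → ℂ, φ 0 =ᶠ[𝓝 (γ 0)] f ∧ IsContinuationOn (Icc 0 1) γ φ

theorem hasContinuationAlong_iff {n : ℕ} {f : (Fin n → ℂ) → ℂ} {γ : ℝ → Fin n → ℂ} :
    HasContinuationAlong f γ ↔ ContinuesAlong f γ :=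
  ⟨fun ⟨φ, h0, h1, h2⟩ => ⟨φ, h0, h1, h2⟩, fun ⟨φ, h0, h⟩ => ⟨φ, h0, h.1, h.2⟩⟩

theorem IsContinuationOn.mono {J J' : Set ℝ} {γ : ℝ → Y} {φ : ℝ → Y → ℂ}
    (h : IsContinuationOn J γ φ) (hJ : J' ⊆ J) : IsContinuationOn J' γ φ :=
  ⟨fun t ht => h.analyticAt t (hJ ht),
    fun t ht => (h.coherent t (hJ ht)).filter_mono (nhdsWithin_mono t hJ)⟩

theorem isContinuationOn_const {J : Set ℝ} {γ : ℝ → Y} {g : Y → ℂ}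
    (h : ∀ t ∈ J, AnalyticAt ℂ g (γ t)) : IsContinuationOn J γ fun _ => g :=
  ⟨h, fun _ _ => Eventually.of_forall fun _ => EventuallyEq.rfl⟩

theorem eventuallyEq_iff_of_mem_ball {f g : Y → ℂ} {a b c : Y} {r : ℝ}
    (hf : AnalyticOnNhd ℂ f (Metric.ball c r)) (hg : AnalyticOnNhd ℂ g (Metric.ball c r))
    (ha : a ∈ Metric.ball c r) (hb : b ∈ Metric.ball c r) :
    f =ᶠ[𝓝 a] g ↔ f =ᶠ[𝓝 b] g := by
  have key : ∀ a ∈ Metric.ball c r, ∀ b ∈ Metric.ball c r, f =ᶠ[𝓝 a] g → f =ᶠ[𝓝 b] g := by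
    intro a ha b hb h
    have := hf.eqOn_of_preconnected_of_eventuallyEq hg
      ((convex_ball c r).isPreconnected) ha h
    exact this.eventuallyEq_of_mem (Metric.isOpen_ball.mem_nhds hb)
  exact ⟨key a ha b hb, key b hb a ha⟩

/-- Uniqueness of continuation: by the identity theorem on a ball around `γ t`, whether the two
germs agree is locally constant in time. -/
theorem IsContinuationOn.eventuallyEq_of_eventuallyEq {J : Set ℝ} (hJ : IsPreconnected J)
    {γ : ℝ → Y} (hγ : ContinuousOn γ J) {φ ψ : ℝ → Y → ℂ} (hφ : IsContinuationOn J γ φ)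
    (hψ : IsContinuationOn J γ ψ) {t₁ t₂ : ℝ} (h₁ : t₁ ∈ J) (h₂ : t₂ ∈ J)
    (h : φ t₁ =ᶠ[𝓝 (γ t₁)] ψ t₁) : φ t₂ =ᶠ[𝓝 (γ t₂)] ψ t₂ := by
  have key := hJ.induction₂
    (fun t t' => (φ t =ᶠ[𝓝 (γ t)] ψ t) ↔ (φ t' =ᶠ[𝓝 (γ t')] ψ t')) ?_
    (fun _ _ _ _ _ _ h h' => h.trans h') (fun _ _ _ _ h => h.symm) h₁ h₂
  · exact key.1 h
  · intro t ht
    obtain ⟨r₁, hr₁, h1⟩ := (hφ.analyticAt t ht).exists_ball_analyticOnNhd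
    obtain ⟨r₂, hr₂, h2⟩ := (hψ.analyticAt t ht).exists_ball_analyticOnNhd
    have h1' := h1.mono (Metric.ball_subset_ball (min_le_left r₁ r₂))
    have h2' := h2.mono (Metric.ball_subset_ball (min_le_right r₁ r₂))
    have hr : 0 < min r₁ r₂ := lt_min hr₁ hr₂
    filter_upwards [hφ.coherent t ht, hψ.coherent t ht,
      hγ t ht (Metric.ball_mem_nhds (γ t) hr)] with s hs1 hs2 hs3
    rw [eventuallyEq_iff_of_mem_ball h1' h2' (Metric.mem_ball_self hr) hs3]
    exact ⟨fun h => (hs1.trans h).trans hs2.symm, fun h => (hs1.symm.trans h).trans hs2⟩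

theorem IsContinuationOn.comp {Z : Type*} [NormedAddCommGroup Z] [NormedSpace ℂ Z] {J : Set ℝ}
    {γ : ℝ → Z} {A : Z → Y} (hA : ∀ t ∈ J, AnalyticAt ℂ A (γ t)) {φ : ℝ → Y → ℂ}
    (h : IsContinuationOn J (fun t => A (γ t)) φ) :
    IsContinuationOn J γ fun t z => φ t (A z) := by
  refine ⟨fun t ht => (h.analyticAt t ht).fun_comp (hA t ht), fun t ht => ?_⟩
  filter_upwards [h.coherent t ht, self_mem_nhdsWithin] with s hs hsJ
  exact (hA s hsJ).continuousAt.eventually hs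

theorem ContinuesAlong.comp {Z : Type*} [NormedAddCommGroup Z] [NormedSpace ℂ Z]
    {γ : ℝ → Z} {A : Z → Y} (hA : ∀ t ∈ Icc (0 : ℝ) 1, AnalyticAt ℂ A (γ t)) {f : Y → ℂ}
    (h : ContinuesAlong f fun t => A (γ t)) : ContinuesAlong (fun z => f (A z)) γ := by
  obtain ⟨φ, h0, h1⟩ := h
  exact ⟨fun t z => φ t (A z), (hA 0 (by simp)).continuousAt.eventually h0, h1.comp hA⟩

theorem ContinuesAlong.mul {f g : Y → ℂ} {γ : ℝ → Y} (hf : ContinuesAlong f γ)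
    (hg : ContinuesAlong g γ) : ContinuesAlong (fun y => f y * g y) γ := by
  obtain ⟨φ, hφ0, hφ⟩ := hf
  obtain ⟨ψ, hψ0, hψ⟩ := hg
  refine ⟨fun t y => φ t y * ψ t y, hφ0.mul hψ0,
    fun t ht => (hφ.analyticAt t ht).mul (hψ.analyticAt t ht), fun t ht => ?_⟩
  filter_upwards [hφ.coherent t ht, hψ.coherent t ht] with s h1 h2
  exact h1.mul h2

theorem continuesAlong_of_analyticAt {f : Y → ℂ} {γ : ℝ → Y}
    (hf : ∀ t ∈ Icc (0 : ℝ) 1, AnalyticAt ℂ f (γ t)) : ContinuesAlong f γ :=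
  ⟨fun _ => f, EventuallyEq.rfl, isContinuationOn_const hf⟩

theorem ContinuesAlong.congr {f g : Y → ℂ} {γ : ℝ → Y} (hf : ContinuesAlong f γ)
    (h : f =ᶠ[𝓝 (γ 0)] g) : ContinuesAlong g γ := by
  obtain ⟨φ, h0, h1⟩ := hf
  exact ⟨φ, h0.trans h, h1⟩

theorem ContinuesAlong.analyticAt_zero {f : Y → ℂ} {γ : ℝ → Y} (hf : ContinuesAlong f γ) :
    AnalyticAt ℂ f (γ 0) := by
  obtain ⟨φ, h0, h1, -⟩ := hf
  exact (h1 0 (by simp)).congr h0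

section Joint

variable {y : ℝ → ℝ → Y} {φ : ℝ → ℝ → Y → ℂ}

/-- The germ at `(t, s₀)` is holomorphic on a ball that contains all `y t' s` with `t'` near `t` and
`s` near `s₀`. By uniqueness along the short piece of path, agreement with it at a single time `t₁ ∈
U` spreads to all of `U`. Since `t₁` is arbitrary in `U`, the transfer works both towards and away
from `t`. -/
theorem exists_transfer (hy : ContinuousOn (fun q : ℝ × ℝ => y q.1 q.2) (Icc 0 1 ×ˢ univ))
    (hφ : ∀ s, IsContinuationOn (Icc 0 1) (fun t => y t s) fun t => φ t s) (s₀ : ℝ) {t : ℝ}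
    (ht : t ∈ Icc (0 : ℝ) 1) :
    ∃ U ∈ 𝓝[Icc 0 1] t, t ∈ U ∧
      (∀ t₁ ∈ U, φ t₁ s₀ =ᶠ[𝓝 (y t₁ s₀)] φ t s₀) ∧
      (∀ t₁ ∈ U, ContinuousAt (y t₁) s₀) ∧
      ∀ t₁ ∈ U, (∀ᶠ s in 𝓝 s₀, φ t₁ s =ᶠ[𝓝 (y t₁ s)] φ t₁ s₀) →
        ∀ᶠ s in 𝓝 s₀, ∀ t' ∈ U, φ t' s =ᶠ[𝓝 (y t' s)] φ t s₀ := by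
  obtain ⟨r, hr, hg⟩ := ((hφ s₀).analyticAt t ht).exists_ball_analyticOnNhd
  have hcts : ∀ t' ∈ Icc (0 : ℝ) 1, ContinuousAt (y t') s₀ := by
    intro t' ht'
    have h1 : ContinuousOn (fun s : ℝ => y t' s) univ :=
      hy.comp (f := fun s : ℝ => (t', s)) (by fun_prop) fun s _ => ⟨ht', mem_univ _⟩
    exact (continuousOn_univ.1 h1).continuousAt
  have h1 := hy (t, s₀) ⟨ht, mem_univ _⟩ (Metric.ball_mem_nhds (y t s₀) hr)
  rw [nhdsWithin_prod_eq, nhdsWithin_univ, mem_map, mem_prod_iff] at h1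
  obtain ⟨U₁, hU₁, W, hW, hUW⟩ := h1
  obtain ⟨ε, hε, hεU⟩ := Metric.mem_nhdsWithin_iff.1 (inter_mem hU₁ ((hφ s₀).coherent t ht))
  refine ⟨Metric.ball t ε ∩ Icc 0 1, inter_mem (mem_nhdsWithin_of_mem_nhds (Metric.ball_mem_nhds t hε)) self_mem_nhdsWithin, ⟨Metric.mem_ball_self hε, ht⟩,
    fun t₁ h₁ => (hεU h₁).2, fun t₁ h₁ => hcts t₁ h₁.2, fun t₁ h₁ hC => ?_⟩
  have e1 : ∀ᶠ s in 𝓝 s₀, φ t₁ s₀ =ᶠ[𝓝 (y t₁ s)] φ t s₀ :=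
    (hcts t₁ h₁.2).eventually (hεU h₁).2.eventuallyEq_nhds
  filter_upwards [hC, e1, hW] with s hs1 hs2 hs3 t' ht'
  have hpre : IsPreconnected (Metric.ball t ε ∩ Icc 0 1) :=
    ((convex_ball t ε).inter (convex_Icc 0 1)).isPreconnected
  refine IsContinuationOn.eventuallyEq_of_eventuallyEq hpre (γ := fun t => y t s)
    (φ := fun t => φ t s) (ψ := fun _ => φ t s₀) ?_
    ((hφ s).mono inter_subset_right) (isContinuationOn_const ?_) h₁ ht' (hs1.trans hs2)
  · exact hy.comp (f := fun t : ℝ => (t, s)) (by fun_prop) fun t' ht' => ⟨ht'.2, mem_univ _⟩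
  · intro t' ht'
    exact hg _ (hUW (mk_mem_prod (hεU ht').1 hs3))

/-- Continuations along a continuous family of paths, starting from one function, depend
continuously on the parameter of the family. -/
theorem eventually_prod_eventuallyEq
    (hy : ContinuousOn (fun q : ℝ × ℝ => y q.1 q.2) (Icc 0 1 ×ˢ univ))
    (hφ : ∀ s, IsContinuationOn (Icc 0 1) (fun t => y t s) fun t => φ t s) {h : Y → ℂ}
    (h0 : ∀ s, φ 0 s =ᶠ[𝓝 (y 0 s)] h) (s₀ : ℝ) {t : ℝ} (ht : t ∈ Icc (0 : ℝ) 1) :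
    ∀ᶠ q in 𝓝[Icc 0 1 ×ˢ univ] (t, s₀), φ q.1 q.2 =ᶠ[𝓝 (y q.1 q.2)] φ t s₀ := by
  -- Stability in `s` at a fixed time is propagated from time `0`, where all germs come from `h`. A
  -- final transfer makes it uniform in time near `t`.
  have key : ∀ t ∈ Icc (0 : ℝ) 1, ∀ᶠ s in 𝓝 s₀, φ t s =ᶠ[𝓝 (y t s)] φ t s₀ := by
    intro t ht
    have := (isPreconnected_Icc (a := (0 : ℝ)) (b := 1)).induction₂
      (fun t t' => (∀ᶠ s in 𝓝 s₀, φ t s =ᶠ[𝓝 (y t s)] φ t s₀) ↔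
        (∀ᶠ s in 𝓝 s₀, φ t' s =ᶠ[𝓝 (y t' s)] φ t' s₀)) ?_
      (fun _ _ _ _ _ _ h h' => h.trans h') (fun _ _ _ _ h => h.symm)
      (show (0 : ℝ) ∈ Icc (0 : ℝ) 1 by simp) ht
    · refine this.1 ?_
      have hc : ContinuousAt (y 0) s₀ := by
        obtain ⟨U, -, hU, -, h, -⟩ := exists_transfer hy hφ s₀ (show (0 : ℝ) ∈ Icc (0 : ℝ) 1 by simp)
        exact h 0 hU
      filter_upwards [hc.eventually (h0 s₀).eventuallyEq_nhds] with s hs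
      exact (h0 s).trans hs.symm
    · intro t ht
      obtain ⟨U, hU, htU, h1, h2, h3⟩ := exists_transfer hy hφ s₀ ht
      filter_upwards [hU] with t' ht'
      constructor
      · intro h
        filter_upwards [h3 t htU h, (h2 t' ht').eventually (h1 t' ht').eventuallyEq_nhds]
          with s hs hs'
        exact (hs t' ht').trans hs'.symm
      · intro h
        filter_upwards [h3 t' ht' h] with s hs using hs t htU
  obtain ⟨U, hU, htU, -, -, h3⟩ := exists_transfer hy hφ s₀ ht
  rw [nhdsWithin_prod_eq, nhdsWithin_univ]
  filter_upwards [prod_mem_prod hU (h3 t htU (key t ht))] with q hq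
  exact hq.2 q.1 hq.1

end Joint

end Continuation

/-! ### Integrals over moving contours -/

theorem IsCompact.exists_ball_inter_subset {α : Type*} [PseudoMetricSpace α] {s : Set α}
    {c : α → Set α} (hs : IsCompact s) (hc : ∀ x ∈ s, c x ∈ 𝓝[s] x) :
    ∃ δ > 0, ∀ x ∈ s, ∃ y ∈ s, Metric.ball x δ ∩ s ⊆ c y := by
  obtain ⟨δ, hδ, h⟩ := lebesgue_number_lemma_of_emetric_nhdsWithin' (c := fun x _ => c x) hs hc
  obtain ⟨ε, hε0, hε⟩ := ENNReal.lt_iff_exists_real_btwn.1 hδ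
  refine ⟨ε, by simpa using hε.1, fun x hx => ?_⟩
  obtain ⟨y, hy⟩ := h x hx
  refine ⟨y, y.2, fun z hz => hy ⟨?_, hz.2⟩⟩
  rw [Metric.mem_eball, edist_dist]
  exact ((ENNReal.ofReal_lt_ofReal_iff (by simpa using hε.1)).2 hz.1).trans hε.2

section Contour

variable {E : Type*} [NormedAddCommGroup E] [NormedSpace ℂ E]

/-- A ball on which `A` is holomorphic with a holomorphic primitive `P` in the last variable. -/
structure PrimitiveChart (E : Type*) [NormedAddCommGroup E] [NormedSpace ℂ E] where
  A : E × ℂ → ℂ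
  P : E × ℂ → ℂ
  center : E × ℂ
  radius : ℝ
  analyticOn : AnalyticOnNhd ℂ A (Metric.ball center radius)
  analyticOn_P : AnalyticOnNhd ℂ P (Metric.ball center radius)
  hasDerivAt : ∀ y ∈ Metric.ball center radius, HasDerivAt (fun u => P (y.1, u)) (A y) y.2

/-- The domain of a chart. -/
def PrimitiveChart.dom (C : PrimitiveChart E) : Set (E × ℂ) := Metric.ball C.center C.radius

theorem PrimitiveChart.isOpen_dom (C : PrimitiveChart E) : IsOpen C.dom := Metric.isOpen_ball

/-- Balls of the maximum norm are products of balls. This lets contour points of one time be paired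
with base points of another. -/
theorem PrimitiveChart.mem_dom_of_mem_of_mem (C : PrimitiveChart E) {x x' : E} {u u' : ℂ}
    (h : (x, u) ∈ C.dom) (h' : (x', u') ∈ C.dom) : (x', u) ∈ C.dom := by
  simp only [PrimitiveChart.dom, Metric.mem_ball, Prod.dist_eq, max_lt_iff] at *
  exact ⟨h'.1, h.2⟩

/-- The integrands agree on the convex intersection of the domains. On its slice over `x`, which is
again convex, the two primitives therefore differ by a constant; the constant may depend on `x`. -/
theorem PrimitiveChart.sub_eq_sub (C C' : PrimitiveChart E) {b : E × ℂ} (hb : b ∈ C.dom)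
    (hb' : b ∈ C'.dom) (h : C.A =ᶠ[𝓝 b] C'.A) {x : E} {u v : ℂ} (hu : (x, u) ∈ C.dom)
    (hu' : (x, u) ∈ C'.dom) (hv : (x, v) ∈ C.dom) (hv' : (x, v) ∈ C'.dom) :
    C.P (x, u) - C.P (x, v) = C'.P (x, u) - C'.P (x, v) := by
  have hconv : Convex ℝ (C.dom ∩ C'.dom) :=
    (convex_ball _ _).inter (convex_ball _ _)
  have heq : EqOn C.A C'.A (C.dom ∩ C'.dom) :=
    (C.analyticOn.mono inter_subset_left).eqOn_of_preconnected_of_eventuallyEq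
      (C'.analyticOn.mono inter_subset_right) hconv.isPreconnected ⟨hb, hb'⟩ h
  set S : Set ℂ := {w | (x, w) ∈ C.dom ∩ C'.dom} with hS
  have hSo : IsOpen S := (C.isOpen_dom.inter C'.isOpen_dom).preimage (by fun_prop)
  have hSc : Convex ℝ S := by
    intro a ha b hb s t hs ht hst
    have := hconv ha hb hs ht hst
    simpa [hS, ← add_smul, hst] using this
  have hd : ∀ w ∈ S, HasDerivAt (fun w => C.P (x, w) - C'.P (x, w)) 0 w := by
    intro w hw
    have h1 := (C.hasDerivAt _ hw.1).sub (C'.hasDerivAt _ hw.2)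
    rw [heq hw, sub_self] at h1
    exact h1
  have := hSo.is_const_of_deriv_eq_zero hSc.isPreconnected
    (fun w hw => (hd w hw).differentiableAt.differentiableWithinAt)
    (fun w hw => (hd w hw).deriv) (show u ∈ S from ⟨hu, hu'⟩) (show v ∈ S from ⟨hv, hv'⟩)
  linear_combination this

variable {γ : ℝ → E} {c : ℝ → ℝ → ℂ} {φ : ℝ → ℝ → E × ℂ → ℂ} {h : E × ℂ → ℂ}

/-- Joint continuity of the germs in `(t, s)` makes each chart valid near its parameter, and a
Lebesgue number of the unit square makes the range of validity a uniform `δ`. -/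
theorem exists_charts (hγ : ContinuousOn γ (Icc 0 1))
    (hc : ContinuousOn (fun q : ℝ × ℝ => c q.1 q.2) (Icc 0 1 ×ˢ univ))
    (hφ : ∀ s, IsContinuationOn (Icc 0 1) (fun t => (γ t, c t s)) fun t => φ t s)
    (h0 : ∀ s, φ 0 s =ᶠ[𝓝 (γ 0, c 0 s)] h) :
    ∃ δ > 0, ∃ C : ℝ → ℝ → PrimitiveChart E, ∀ t ∈ Icc (0 : ℝ) 1, ∀ s ∈ Icc (0 : ℝ) 1,
      ∀ t' ∈ Icc (0 : ℝ) 1, ∀ s' ∈ Icc (0 : ℝ) 1, |t' - t| < δ → |s' - s| < δ →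
        (γ t', c t' s') ∈ (C t s).dom ∧ φ t' s' =ᶠ[𝓝 (γ t', c t' s')] (C t s).A := by
  have hy : ContinuousOn (fun q : ℝ × ℝ => (γ q.1, c q.1 q.2)) (Icc 0 1 ×ˢ univ) :=
    (hγ.comp continuousOn_fst fun q hq => hq.1).prodMk hc
  have hchart : ∀ q : ℝ × ℝ, ∃ C : PrimitiveChart E, q ∈ Icc (0 : ℝ) 1 ×ˢ Icc (0 : ℝ) 1 →
      C.A = φ q.1 q.2 ∧ (γ q.1, c q.1 q.2) ∈ C.dom := by
    intro q
    by_cases hq : q ∈ Icc (0 : ℝ) 1 ×ˢ Icc (0 : ℝ) 1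
    · obtain ⟨ρ, hρ, h1, P, h2, h3⟩ := ((hφ q.2).analyticAt q.1 hq.1).exists_primitive_snd
      exact ⟨⟨φ q.1 q.2, P, _, ρ, h1, h2, h3⟩, fun _ => ⟨rfl, Metric.mem_ball_self hρ⟩⟩
    · exact ⟨⟨0, 0, 0, 0, by simp, by simp, by simp⟩, fun h => absurd h hq⟩
  choose C hC using hchart
  obtain ⟨δ, hδ, H⟩ := (isCompact_Icc.prod isCompact_Icc).exists_ball_inter_subset
    (s := Icc (0 : ℝ) 1 ×ˢ Icc (0 : ℝ) 1)
    (c := fun q => {q' | (γ q'.1, c q'.1 q'.2) ∈ (C q).dom ∧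
      φ q'.1 q'.2 =ᶠ[𝓝 (γ q'.1, c q'.1 q'.2)] (C q).A}) (by
      intro q hq
      have hle : 𝓝[Icc (0 : ℝ) 1 ×ˢ Icc (0 : ℝ) 1] q ≤ 𝓝[Icc (0 : ℝ) 1 ×ˢ univ] q :=
        nhdsWithin_mono _ (prod_mono_right (subset_univ _))
      have e1 := eventually_prod_eventuallyEq hy hφ h0 q.2 hq.1
      have e2 := hy q ⟨hq.1, mem_univ _⟩ ((C q).isOpen_dom.mem_nhds (hC q hq).2)
      filter_upwards [hle e1, hle e2] with q' h1 h2
      exact ⟨h2, (hC q hq).1 ▸ h1⟩)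
  have H' : ∀ q : ℝ × ℝ, ∃ y : ℝ × ℝ, q ∈ Icc (0 : ℝ) 1 ×ˢ Icc (0 : ℝ) 1 →
      Metric.ball q δ ∩ Icc (0 : ℝ) 1 ×ˢ Icc (0 : ℝ) 1 ⊆ {q' | (γ q'.1, c q'.1 q'.2) ∈ (C y).dom ∧
        φ q'.1 q'.2 =ᶠ[𝓝 (γ q'.1, c q'.1 q'.2)] (C y).A} := by
    intro q
    by_cases hq : q ∈ Icc (0 : ℝ) 1 ×ˢ Icc (0 : ℝ) 1
    · obtain ⟨y, -, hy⟩ := H q hq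
      exact ⟨y, fun _ => hy⟩
    · exact ⟨0, fun h => absurd h hq⟩
  choose y hyC using H'
  refine ⟨δ, hδ, fun t s => C (y (t, s)), fun t ht s hs t' ht' s' hs' h1 h2 => ?_⟩
  exact hyC (t, s) ⟨ht, hs⟩ (show (t', s') ∈ _ from ⟨by
    simpa [Prod.dist_eq, Real.dist_eq] using ⟨h1, h2⟩, ht', hs'⟩)

/-- The integral of a function over a contour continues along a path if the function continues
along the motions of the points of a closed contour. -/
theorem continuesAlong_integral (hγ : ContinuousOn γ (Icc 0 1))
    (hc : ContinuousOn (fun q : ℝ × ℝ => c q.1 q.2) (Icc 0 1 ×ˢ univ))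
    (hper : ∀ t, c t 1 = c t 0) {c' : ℝ → ℂ} (hc' : Continuous c')
    (hderiv : ∀ s, HasDerivAt (c 0) (c' s) s)
    (hcont : ∀ s, ContinuesAlong h fun t => (γ t, c t s)) :
    ContinuesAlong (fun x => ∫ s in (0 : ℝ)..1, h (x, c 0 s) * c' s) γ := by
  classical
  -- The chosen continuations at `s = 0` and `s = 1` are unrelated functions. As both end points
  -- trace the same path, the second is replaced by the first, so the contour closes up on the level
  -- of germs too.
  obtain ⟨φ, hφ0, hφ, hφ1⟩ : ∃ φ : ℝ → ℝ → E × ℂ → ℂ,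
      (∀ s, φ 0 s =ᶠ[𝓝 (γ 0, c 0 s)] h) ∧
      (∀ s, IsContinuationOn (Icc 0 1) (fun t => (γ t, c t s)) fun t => φ t s) ∧
      ∀ t, φ t 1 = φ t 0 := by
    choose φ h0 h1 using hcont
    refine ⟨fun t s => if s = 1 then φ 0 t else φ s t, fun s => ?_, fun s => ?_, fun t => by simp⟩
    · by_cases hs : s = 1
      · subst hs; simpa [hper] using h0 0
      · simpa [hs] using h0 s
    · by_cases hs : s = 1
      · subst hs; simpa [hper] using h1 0
      · simpa [hs] using h1 s
  obtain ⟨δ, hδ, C, hC⟩ := exists_charts hγ hc hφ hφ0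
  obtain ⟨m, hm⟩ := exists_nat_one_div_lt hδ
  set σ : ℕ → ℝ := fun k => k / ((m : ℝ) + 1) with hσ
  have hm0 : (0 : ℝ) < (m : ℝ) + 1 := by positivity
  have hσ0 : σ 0 = 0 := by simp [hσ]
  have hσ1 : σ (m + 1) = 1 := by simp only [hσ]; push_cast; exact div_self hm0.ne'
  have hσI : ∀ k ≤ m + 1, σ k ∈ Icc (0 : ℝ) 1 := by
    intro k hk
    have : (k : ℝ) ≤ m + 1 := by exact_mod_cast hk
    exact ⟨by positivity, by rw [hσ, div_le_one hm0]; exact this⟩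
  have hσs : ∀ k, σ (k + 1) = σ k + 1 / ((m : ℝ) + 1) := by
    intro k; simp only [hσ]; push_cast; ring
  have hσle : ∀ k, σ k ≤ σ (k + 1) := fun k => by
    rw [hσs]; linarith [show 0 < 1 / ((m : ℝ) + 1) by positivity]
  have hσd : ∀ k, ∀ s ∈ Icc (σ k) (σ (k + 1)), |s - σ k| < δ := by
    intro k s hs
    rw [abs_of_nonneg (sub_nonneg.2 hs.1)]
    linarith [hs.2, hσs k]
  have hσd' : ∀ k, |σ (k + 1) - σ k| < δ := fun k => hσd k _ ⟨hσle k, le_rfl⟩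
  have hself : ∀ a : ℝ, |a - a| < δ := fun a => by simpa using hδ
  -- The integral over the contour at time `t`, expressed by increments of local primitives. Only
  -- the vertices enter, so no derivative of `c t` is required for `t > 0`.
  set Φ : ℝ → E → ℂ := fun t x => ∑ k ∈ Finset.range (m + 1),
    ((C t (σ k)).P (x, c t (σ (k + 1))) - (C t (σ k)).P (x, c t (σ k))) with hΦ
  have hopen : ∀ (K : PrimitiveChart E) (x : E) (u : ℂ), (x, u) ∈ K.dom →
      ∀ᶠ x' in 𝓝 x, (x', u) ∈ K.dom := by
    intro K x u hx
    exact (show Continuous fun x' : E => (x', u) by fun_prop).continuousAt.eventually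
      (K.isOpen_dom.mem_nhds hx)
  have h0I : (0 : ℝ) ∈ Icc (0 : ℝ) 1 := by simp
  refine ⟨Φ, ?_, ?_, ?_⟩
  · have hc0 : Continuous (c 0) := continuous_iff_continuousAt.2 fun s => (hderiv s).continuousAt
    -- At time `0` the integrand is `h` itself along each whole subarc, by compactness for all `x`
    -- in one neighbourhood, so the increments are genuine integrals.
    have key : ∀ᶠ x in 𝓝 (γ 0), ∀ k ∈ Finset.range (m + 1), ∀ s ∈ Icc (σ k) (σ (k + 1)),
        (x, c 0 s) ∈ (C 0 (σ k)).dom ∧ h (x, c 0 s) = (C 0 (σ k)).A (x, c 0 s) := by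
      rw [Filter.eventually_all_finset]
      intro k hk
      have hk' : k + 1 ≤ m + 1 := Finset.mem_range.1 hk
      refine isCompact_Icc.eventually_forall_of_forall_eventually
        (P := fun x s => (x, c 0 s) ∈ (C 0 (σ k)).dom ∧
          h (x, c 0 s) = (C 0 (σ k)).A (x, c 0 s)) fun s hs => ?_
      have hsI : s ∈ Icc (0 : ℝ) 1 :=
        ⟨(hσI k (by omega)).1.trans hs.1, hs.2.trans (hσI (k + 1) hk').2⟩
      have h1 := hC 0 h0I (σ k) (hσI k (by omega)) 0 h0I s hsI (hself 0) (hσd k s hs)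
      have hcont : ContinuousAt (fun z : E × ℝ => (z.1, c 0 z.2)) (γ 0, s) :=
        (continuous_fst.prodMk (hc0.comp continuous_snd)).continuousAt
      exact (hcont.eventually ((C 0 (σ k)).isOpen_dom.mem_nhds h1.1)).and
        (hcont.eventually ((hφ0 s).symm.trans h1.2))
    filter_upwards [key] with x hx
    have hint : ∀ k < m + 1,
        IntervalIntegrable (fun s => h (x, c 0 s) * c' s) MeasureTheory.volume (σ k) (σ (k + 1)) ∧
        ∫ s in σ k..σ (k + 1), h (x, c 0 s) * c' s =
          (C 0 (σ k)).P (x, c 0 (σ (k + 1))) - (C 0 (σ k)).P (x, c 0 (σ k)) := by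
      intro k hk
      have hx' := hx k (Finset.mem_range.2 hk)
      rw [← uIcc_of_le (hσle k)] at hx'
      have hco : ContinuousOn (fun s => (C 0 (σ k)).A (x, c 0 s) * c' s)
          (uIcc (σ k) (σ (k + 1))) := by
        refine ContinuousOn.mul ?_ hc'.continuousOn
        exact (C 0 (σ k)).analyticOn.continuousOn.comp (by fun_prop) fun s hs => (hx' s hs).1
      have heq : EqOn (fun s => (C 0 (σ k)).A (x, c 0 s) * c' s) (fun s => h (x, c 0 s) * c' s)
          (uIcc (σ k) (σ (k + 1))) := fun s hs => by
        simp only [(hx' s hs).2]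
      refine ⟨(hco.congr heq.symm).intervalIntegrable, ?_⟩
      rw [← intervalIntegral.integral_congr heq]
      refine intervalIntegral.integral_eq_sub_of_hasDerivAt
        (f := fun s => (C 0 (σ k)).P (x, c 0 s)) (fun s hs => ?_) hco.intervalIntegrable
      exact ((C 0 (σ k)).hasDerivAt _ (hx' s hs).1).comp s (hderiv s)
    have hsum := intervalIntegral.sum_integral_adjacent_intervals fun k hk => (hint k hk).1
    rw [hσ0, hσ1] at hsum
    rw [← hsum]
    exact (Finset.sum_congr rfl fun k hk => (hint k (Finset.mem_range.1 hk)).2).symm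
  · intro t ht
    refine Finset.analyticAt_fun_sum _ fun k hk => ?_
    have hk' : k + 1 ≤ m + 1 := Finset.mem_range.1 hk
    have h1 := hC t ht (σ k) (hσI k (by omega)) t ht (σ k) (hσI k (by omega)) (hself t) (hself _)
    have h2 := hC t ht (σ k) (hσI k (by omega)) t ht _ (hσI (k + 1) hk') (hself t) (hσd' k)
    have hpair : ∀ u : ℂ, (γ t, u) ∈ (C t (σ k)).dom →
        AnalyticAt ℂ (fun x : E => (C t (σ k)).P (x, u)) (γ t) := fun u hu =>
      AnalyticAt.fun_comp (f := fun x : E => (x, u)) ((C t (σ k)).analyticOn_P _ hu)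
        (analyticAt_id.prod analyticAt_const)
    exact (hpair _ h2.1).sub (hpair _ h1.1)
  · intro t ht
    have hnear : ∀ᶠ t' in 𝓝[Icc 0 1] t, |t' - t| < δ := by
      refine mem_nhdsWithin_of_mem_nhds ?_
      simpa [Metric.ball, Real.dist_eq] using Metric.ball_mem_nhds t hδ
    filter_upwards [hnear, self_mem_nhdsWithin] with t' htt ht'
    have hdom : ∀ s ∈ Icc (0 : ℝ) 1, ∀ s' ∈ Icc (0 : ℝ) 1, |s' - s| < δ →
        ∀ᶠ x in 𝓝 (γ t'), (x, c t' s') ∈ (C t s).dom ∧ (x, c t s') ∈ (C t s).dom ∧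
          (x, c t' s') ∈ (C t' s).dom := by
      intro s hs s' hs' hss
      have h1 := (hC t ht s hs t' ht' s' hs' htt hss).1
      have h2 := (hC t ht s hs t ht s' hs' (hself t) hss).1
      have h3 := (hC t' ht' s hs t' ht' s' hs' (hself t') hss).1
      exact (hopen _ _ _ h1).and ((hopen _ _ _
        ((C t s).mem_dom_of_mem_of_mem h2 h1)).and (hopen _ _ _ h3))
    have hall : ∀ᶠ x in 𝓝 (γ t'), ∀ k ∈ Finset.range (m + 2), ∀ l ∈ Finset.range (m + 2),
        |σ l - σ k| < δ → (x, c t' (σ l)) ∈ (C t (σ k)).dom ∧ (x, c t (σ l)) ∈ (C t (σ k)).dom ∧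
          (x, c t' (σ l)) ∈ (C t' (σ k)).dom := by
      rw [Filter.eventually_all_finset]
      intro k hk
      rw [Filter.eventually_all_finset]
      intro l hl
      by_cases hkl : |σ l - σ k| < δ
      · filter_upwards [hdom _ (hσI k (Nat.lt_succ_iff.1 (Finset.mem_range.1 hk))) _
          (hσI l (Nat.lt_succ_iff.1 (Finset.mem_range.1 hl))) hkl] with x hx _ using hx
      · exact Eventually.of_forall fun x hx => absurd hx hkl
    filter_upwards [hall] with x hx
    have hx' : ∀ k l, k ≤ m + 1 → l ≤ m + 1 → |σ l - σ k| < δ → (x, c t' (σ l)) ∈ (C t (σ k)).dom ∧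
        (x, c t (σ l)) ∈ (C t (σ k)).dom ∧ (x, c t' (σ l)) ∈ (C t' (σ k)).dom :=
      fun k l hk hl => hx k (by simp; omega) l (by simp; omega)
    -- `e k` is the integral from the `k`-th vertex of the old contour to that of the new one. The
    -- difference of corresponding sides is `e (k + 1) - e k`, so the total difference telescopes.
    set e : ℕ → ℂ := fun k => (C t (σ k)).P (x, c t' (σ k)) - (C t (σ k)).P (x, c t (σ k)) with he
    have hterm : ∀ k ∈ Finset.range (m + 1),
        ((C t' (σ k)).P (x, c t' (σ (k + 1))) - (C t' (σ k)).P (x, c t' (σ k))) -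
        ((C t (σ k)).P (x, c t (σ (k + 1))) - (C t (σ k)).P (x, c t (σ k))) =
        e (k + 1) - e k := by
      intro k hk
      have hk1 : k + 1 ≤ m + 1 := Finset.mem_range.1 hk
      have hk0 : k ≤ m + 1 := by omega
      have a1 := hx' k k hk0 hk0 (hself _)
      have a2 := hx' k (k + 1) hk0 hk1 (hσd' k)
      have a3 := hx' (k + 1) (k + 1) hk1 hk1 (hself _)
      have b1 := hC t ht _ (hσI k hk0) t' ht' _ (hσI k hk0) htt (hself _)
      have b2 := hC t' ht' _ (hσI k hk0) t' ht' _ (hσI k hk0) (hself _) (hself _)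
      have b3 := hC t ht _ (hσI k hk0) t ht _ (hσI _ hk1) (hself _) (hσd' k)
      have b4 := hC t ht _ (hσI _ hk1) t ht _ (hσI _ hk1) (hself _) (hself _)
      have c1 := (C t' (σ k)).sub_eq_sub (C t (σ k)) b2.1 b1.1 (b2.2.symm.trans b1.2)
        a2.2.2 a2.1 a1.2.2 a1.1
      have c2 := (C t (σ k)).sub_eq_sub (C t (σ (k + 1))) b3.1 b4.1 (b3.2.symm.trans b4.2)
        a2.1 a3.1 a2.2.1 a3.2.1
      simp only [he]
      linear_combination c1 + c2
    -- The charts at the parameters `0` and `1` may differ, but there they carry the same germ of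
    -- the integrand, hence the same increments.
    have hloop : e (m + 1) = e 0 := by
      have a1 := hx' (m + 1) (m + 1) le_rfl le_rfl (hself _)
      have a0 := hx' 0 0 (by omega) (by omega) (hself _)
      have b1 := hC t ht _ (hσI _ le_rfl) t ht _ (hσI (m + 1) le_rfl) (hself _) (hself _)
      have b0 := hC t ht _ (hσI 0 (by omega)) t ht _ (hσI 0 (by omega)) (hself _) (hself _)
      simp only [hσ0, hσ1, hper, hφ1, he] at a1 a0 b1 b0 ⊢
      exact (C t 1).sub_eq_sub (C t 0) b1.1 b0.1 (b1.2.symm.trans b0.2) a1.1 a0.1 a1.2.1 a0.2.1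
    have hsum := Finset.sum_congr rfl hterm
    rw [Finset.sum_range_sub, hloop, sub_self, Finset.sum_sub_distrib] at hsum
    exact sub_eq_zero.1 hsum

end Contour

/-! ### Isotopies of the plane that follow moving points -/

section Isotopy

/-- A continuous function on `ℂ` with value `1` on the disc of radius `ρ` around `a` and value `0`
outside the disc of radius `2ρ`. -/
noncomputable def plateau (a : ℂ) (ρ : ℝ) (u : ℂ) : ℝ := max 0 (min 1 (2 - ‖u - a‖ / ρ))

theorem plateau_nonneg (a : ℂ) (ρ : ℝ) (u : ℂ) : 0 ≤ plateau a ρ u := le_max_left _ _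

theorem plateau_le_one (a : ℂ) (ρ : ℝ) (u : ℂ) : plateau a ρ u ≤ 1 :=
  max_le zero_le_one (min_le_left _ _)

theorem plateau_eq_one {a : ℂ} {ρ : ℝ} (hρ : 0 < ρ) {u : ℂ} (h : ‖u - a‖ ≤ ρ) :
    plateau a ρ u = 1 := by
  have : ‖u - a‖ / ρ ≤ 1 := (div_le_one hρ).2 h
  rw [plateau, min_eq_left (by linarith), max_eq_right zero_le_one]

theorem plateau_eq_zero {a : ℂ} {ρ : ℝ} (hρ : 0 < ρ) {u : ℂ} (h : 2 * ρ ≤ ‖u - a‖) :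
    plateau a ρ u = 0 := by
  have : 2 ≤ ‖u - a‖ / ρ := (le_div_iff₀ hρ).2 h
  rw [plateau, max_eq_left ((min_le_right _ _).trans (by linarith))]

theorem continuous_plateau (a : ℂ) (ρ : ℝ) : Continuous (plateau a ρ) := by
  unfold plateau; fun_prop

theorem abs_plateau_sub_le (a : ℂ) {ρ : ℝ} (hρ : 0 < ρ) (u v : ℂ) :
    |plateau a ρ u - plateau a ρ v| ≤ ‖u - v‖ / ρ := by
  have h1 : |plateau a ρ u - plateau a ρ v| ≤
      |(2 - ‖u - a‖ / ρ) - (2 - ‖v - a‖ / ρ)| := by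
    refine (abs_max_sub_max_le_max _ _ _ _).trans (max_le (by simp) ?_)
    exact (abs_min_sub_min_le_max _ _ _ _).trans (max_le (by simp) le_rfl)
  refine h1.trans ?_
  rw [show (2 - ‖u - a‖ / ρ) - (2 - ‖v - a‖ / ρ) = (‖v - a‖ - ‖u - a‖) / ρ by ring, abs_div,
    abs_of_pos hρ]
  refine div_le_div_of_nonneg_right ?_ hρ.le
  refine (abs_norm_sub_norm_le _ _).trans ?_
  rw [sub_sub_sub_cancel_right, norm_sub_rev]

/-- Near the time `t₀` the sets `Z t` consist of values of finitely many `C¹` functions with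
distinct values at `t₀`. -/
def MovesSmoothlyNear (Z : ℝ → Set ℂ) (t₀ : ℝ) : Prop :=
  ∃ ε > 0, ∃ (D : ℕ) (a : Fin D → ℝ → ℂ), Function.Injective (fun k => a k t₀) ∧
    (∀ k, ContDiffOn ℝ 1 (a k) (Icc 0 1 ∩ Metric.ball t₀ ε)) ∧
    ∀ t ∈ Icc 0 1 ∩ Metric.ball t₀ ε, ∀ u ∈ Z t, ∃ k, u = a k t

/-- A motion of the points of the plane during the time `J`, starting at the time `t₁` with the
identity, such that all but finitely many points avoid `Z t` at all times `t`. -/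
structure IsMotion (Z : ℝ → Set ℂ) (J : Set ℝ) (t₁ : ℝ) (Φ : ℝ → ℂ → ℂ) : Prop where
  start : ∀ u, Φ t₁ u = u
  continuousOn : ContinuousOn (fun q : ℝ × ℂ => Φ q.1 q.2) (J ×ˢ univ)
  injective : ∀ t ∈ J, Function.Injective (Φ t)
  avoids : ∃ B : Set ℂ, B.Finite ∧ ∀ u ∉ B, ∀ t ∈ J, Φ t u ∉ Z t

theorem IsMotion.mono {Z : ℝ → Set ℂ} {J J' : Set ℝ} {t₁ : ℝ} {Φ : ℝ → ℂ → ℂ}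
    (h : IsMotion Z J t₁ Φ) (hJ : J' ⊆ J) : IsMotion Z J' t₁ Φ :=
  ⟨h.start, h.continuousOn.mono (prod_mono_left hJ), fun t ht => h.injective t (hJ ht),
    h.avoids.imp fun _ hB => ⟨hB.1, fun u hu t ht => hB.2 u hu t (hJ ht)⟩⟩

/-- Each point is displaced by the displacements of the `a k`, weighted with plateau functions
around `a k t₀`. Plateaus have Lipschitz constant `1 / ρ` and the displacements sum to at most `ρ /
2`, so the displacement field is `1/2`-Lipschitz and the motion injective. Near `a k t₀` the other
plateaus vanish and the motion is translation along with `a k`; only a point starting at `a k t₁`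
can ever meet `a k`. -/
theorem MovesSmoothlyNear.exists_isMotion {Z : ℝ → Set ℂ} {t₀ : ℝ} (ht₀ : t₀ ∈ Icc (0 : ℝ) 1)
    (h : MovesSmoothlyNear Z t₀) :
    ∃ ε > 0, ∀ t₁ ∈ Icc 0 1 ∩ Metric.ball t₀ ε, ∃ Φ : ℝ → ℂ → ℂ,
      IsMotion Z (Icc 0 1 ∩ Metric.ball t₀ ε) t₁ Φ ∧
      ∀ u, ContDiffOn ℝ 1 (fun t => Φ t u) (Icc 0 1 ∩ Metric.ball t₀ ε) := by
  obtain ⟨ε, hε, D, a, hinj, ha, hZ⟩ := h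
  obtain ⟨ρ, hρ0, hρ⟩ : ∃ ρ > 0, ∀ k l, k ≠ l → 4 * ρ ≤ ‖a k t₀ - a l t₀‖ := by
    have : ∀ᶠ ρ in 𝓝[>] (0 : ℝ), ∀ k l, k ≠ l → 4 * ρ ≤ ‖a k t₀ - a l t₀‖ := by
      refine eventually_all.2 fun k => eventually_all.2 fun l => ?_
      by_cases hkl : k = l
      · exact Eventually.of_forall fun _ h => absurd hkl h
      · have hpos : 0 < ‖a k t₀ - a l t₀‖ := norm_pos_iff.2 (sub_ne_zero.2 (hinj.ne hkl))
        have : Tendsto (fun ρ : ℝ => 4 * ρ) (𝓝[>] 0) (𝓝 0) := by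
          have : Continuous fun ρ : ℝ => 4 * ρ := by fun_prop
          simpa using (this.tendsto 0).mono_left nhdsWithin_le_nhds
        filter_upwards [this.eventually_le_const hpos] with ρ hρ _ using hρ
    obtain ⟨ρ, h1, h2⟩ := (this.and self_mem_nhdsWithin).exists
    exact ⟨ρ, h2, h1⟩
  -- Chosen so that `D` displacements of size `2 * η` sum to at most `ρ / 2`; `D + 1` also covers `D
  -- = 0`.
  set η : ℝ := ρ / (4 * (D + 1)) with hη
  have hη0 : 0 < η := by positivity
  have hηρ : η * (4 * (D + 1)) = ρ := by rw [hη]; field_simp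
  have hclose : ∀ᶠ t in 𝓝[Icc 0 1] t₀, ∀ k, ‖a k t - a k t₀‖ < η := by
    refine eventually_all.2 fun k => ?_
    have hc : ContinuousWithinAt (a k) (Icc 0 1) t₀ := by
      have := (ha k).continuousOn t₀ ⟨ht₀, Metric.mem_ball_self hε⟩
      exact (continuousWithinAt_inter (Metric.ball_mem_nhds t₀ hε)).1 this
    have := hc (Metric.ball_mem_nhds (a k t₀) hη0)
    filter_upwards [this] with t ht
    simpa [dist_eq_norm] using ht
  obtain ⟨ε₁, hε₁, h1⟩ := Metric.mem_nhdsWithin_iff.1 hclose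
  have hsub : Icc 0 1 ∩ Metric.ball t₀ (min ε ε₁) ⊆ Icc 0 1 ∩ Metric.ball t₀ ε :=
    inter_subset_inter_right _ (Metric.ball_subset_ball (min_le_left _ _))
  have hcl : ∀ t ∈ Icc 0 1 ∩ Metric.ball t₀ (min ε ε₁), ∀ k, ‖a k t - a k t₀‖ < η :=
    fun t ht => h1 ⟨Metric.ball_subset_ball (min_le_right _ _) ht.2, ht.1⟩
  refine ⟨min ε ε₁, lt_min hε hε₁, fun t₁ ht₁ => ?_⟩
  set J := Icc 0 1 ∩ Metric.ball t₀ (min ε ε₁) with hJ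
  set Φ : ℝ → ℂ → ℂ := fun t u =>
    u + ∑ k, (plateau (a k t₀) ρ u : ℂ) * (a k t - a k t₁) with hΦ
  have hδ : ∀ t ∈ J, ∀ k, ‖a k t - a k t₁‖ ≤ 2 * η := by
    intro t ht k
    rw [← sub_sub_sub_cancel_right (a k t) (a k t₁) (a k t₀)]
    exact (norm_sub_le _ _).trans (by linarith [hcl t ht k, hcl t₁ ht₁ k])
  have hsum : ∑ _k : Fin D, 2 * η ≤ ρ / 2 := by
    simp only [Finset.sum_const, Finset.card_univ, Fintype.card_fin, nsmul_eq_mul]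
    nlinarith
  have hnorm : ∀ t ∈ J, ∀ u, ‖Φ t u - u‖ ≤ ρ / 2 := by
    intro t ht u
    simp only [hΦ, add_sub_cancel_left]
    refine (norm_sum_le _ _).trans ((Finset.sum_le_sum fun k _ => ?_).trans hsum)
    rw [norm_mul, Complex.norm_real, Real.norm_of_nonneg (plateau_nonneg _ _ _)]
    exact (mul_le_of_le_one_left (norm_nonneg _) (plateau_le_one _ _ _)).trans (hδ t ht k)
  refine ⟨Φ, ⟨fun u => by simp [hΦ], ?_, ?_, ?_⟩, ?_⟩
  · refine continuousOn_snd.add (continuousOn_finsetSum _ fun k _ => ContinuousOn.mul ?_ ?_)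
    · exact (Complex.continuous_ofReal.comp
        ((continuous_plateau _ _).comp continuous_snd)).continuousOn
    · refine ContinuousOn.sub ?_ continuousOn_const
      exact ((ha k).continuousOn.mono hsub).comp continuousOn_fst fun q hq => hq.1
  · intro t ht u v huv
    by_contra hne
    have hpos : 0 < ‖u - v‖ := norm_pos_iff.2 (sub_ne_zero.2 hne)
    have : u - v = ∑ k, ((plateau (a k t₀) ρ v - plateau (a k t₀) ρ u : ℝ) : ℂ) *
        (a k t - a k t₁) := by
      simp only [hΦ] at huv
      push_cast
      simp only [sub_mul, Finset.sum_sub_distrib]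
      linear_combination huv
    have h2 : ‖u - v‖ ≤ ‖u - v‖ / ρ * (ρ / 2) := by
      calc ‖u - v‖ ≤ ∑ k : Fin D, ‖u - v‖ / ρ * (2 * η) := by
            rw [this]
            refine (norm_sum_le _ _).trans (Finset.sum_le_sum fun k _ => ?_)
            rw [← this, norm_mul, Complex.norm_real, Real.norm_eq_abs]
            refine mul_le_mul ?_ (hδ t ht k) (norm_nonneg _) (by positivity)
            rw [norm_sub_rev]
            exact abs_plateau_sub_le _ hρ0 _ _
        _ = ‖u - v‖ / ρ * ∑ _k : Fin D, 2 * η := by rw [Finset.mul_sum]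
        _ ≤ _ := mul_le_mul_of_nonneg_left hsum (by positivity)
    have h3 : ‖u - v‖ / ρ * (ρ / 2) = ‖u - v‖ / 2 := by field_simp
    linarith
  · refine ⟨range fun k => a k t₁, finite_range _, fun u hu t ht hmem => hu ?_⟩
    obtain ⟨k, hk⟩ := hZ t (hsub ht) _ hmem
    have h2 : ‖u - a k t₀‖ ≤ ρ := by
      have e : u - a k t₀ = (a k t - a k t₀) - (Φ t u - u) := by rw [← hk]; ring
      have hηle : η ≤ ρ / 4 := by nlinarith
      rw [e]
      exact (norm_sub_le _ _).trans (by linarith [hcl t ht k, hnorm t ht u])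
    have h3 : Φ t u = u + (a k t - a k t₁) := by
      simp only [hΦ]
      congr 1
      rw [Finset.sum_eq_single k, plateau_eq_one hρ0 h2]
      · simp
      · intro l _ hl
        rw [plateau_eq_zero hρ0]
        · simp
        · have := hρ l k hl
          have h4 : ‖a l t₀ - a k t₀‖ ≤ ‖u - a k t₀‖ + ‖u - a l t₀‖ := by
            rw [← sub_sub_sub_cancel_left (a k t₀) (a l t₀) u]
            exact norm_sub_le _ _
          linarith
      · simp
    exact ⟨k, by simp only; linear_combination h3 - hk⟩
  · intro u
    refine contDiffOn_const.add (ContDiffOn.sum fun k _ => contDiffOn_const.mul ?_)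
    exact ((ha k).mono hsub).sub contDiffOn_const

/-- Injectivity of `Ψ t₁` keeps the exceptional set finite: the points that are bad for the second
motion have finitely many preimages. -/
theorem IsMotion.trans {Z : ℝ → Set ℂ} {t₀ t₁ t₂ : ℝ} (h₀₁ : t₀ ≤ t₁) (h₁₂ : t₁ ≤ t₂)
    {Ψ Φ : ℝ → ℂ → ℂ}
    (hΨ : IsMotion Z (Icc t₀ t₁) t₀ Ψ) (hΦ : IsMotion Z (Icc t₁ t₂) t₁ Φ) :
    IsMotion Z (Icc t₀ t₂) t₀ fun t u => if t ≤ t₁ then Ψ t u else Φ t (Ψ t₁ u) := by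
  have hlate : ∀ t ∈ Icc t₁ t₂, ∀ u,
      (if t ≤ t₁ then Ψ t u else Φ t (Ψ t₁ u)) = Φ t (Ψ t₁ u) := by
    intro t ht u
    split_ifs with h
    · obtain rfl : t = t₁ := le_antisymm h ht.1
      exact (hΦ.start _).symm
    · rfl
  refine ⟨fun u => by simp [h₀₁, hΨ.start], ?_, ?_, ?_⟩
  · rw [← Icc_union_Icc_eq_Icc h₀₁ h₁₂, union_prod]
    refine ContinuousOn.union_of_isClosed ?_ ?_ (isClosed_Icc.prod isClosed_univ)
      (isClosed_Icc.prod isClosed_univ)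
    · refine hΨ.continuousOn.congr fun q hq => ?_
      simp [hq.1.2]
    · have hend : Continuous (Ψ t₁) := by
        refine continuousOn_univ.1 ?_
        exact hΨ.continuousOn.comp (f := fun u : ℂ => (t₁, u)) (by fun_prop)
          fun u _ => ⟨⟨h₀₁, le_rfl⟩, mem_univ _⟩
      have h2 : ContinuousOn (fun q : ℝ × ℂ => Φ q.1 (Ψ t₁ q.2)) (Icc t₁ t₂ ×ˢ univ) :=
        hΦ.continuousOn.comp (f := fun q : ℝ × ℂ => (q.1, Ψ t₁ q.2))
          (continuousOn_fst.prodMk (hend.comp continuous_snd).continuousOn)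
          fun q hq => ⟨hq.1, mem_univ _⟩
      exact h2.congr fun q hq => hlate q.1 hq.1 q.2
  · intro t ht
    by_cases h : t ≤ t₁
    · simpa [h] using hΨ.injective t ⟨ht.1, h⟩
    · simp only [h, if_false]
      exact (hΦ.injective t ⟨(not_le.1 h).le, ht.2⟩).comp (hΨ.injective t₁ ⟨h₀₁, le_rfl⟩)
  · obtain ⟨B, hB, h1⟩ := hΨ.avoids
    obtain ⟨B', hB', h2⟩ := hΦ.avoids
    refine ⟨B ∪ Ψ t₁ ⁻¹' B', hB.union (hB'.preimage
      (hΨ.injective t₁ ⟨h₀₁, le_rfl⟩).injOn), fun u hu t ht => ?_⟩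
    simp only [mem_union, not_or] at hu
    by_cases h : t ≤ t₁
    · simpa [h] using h1 u hu.1 t ⟨ht.1, h⟩
    · simpa [h] using h2 _ hu.2 t ⟨(not_le.1 h).le, ht.2⟩

/-- A path that is `C¹` on each of the `m` intervals of the equidistant subdivision of `[0,1]`. -/
def IsPiecewiseC1 {F : Type*} [NormedAddCommGroup F] [NormedSpace ℝ F] (m : ℕ) (η : ℝ → F) :
    Prop :=
  ∀ i < m, ContDiffOn ℝ 1 η (Icc (i / m) ((i + 1) / m))

/-- If the points of `Z t` move smoothly, then there is a piecewise smooth isotopy of the plane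
for which all but finitely many points avoid `Z t` at all times. -/
theorem exists_isMotion {Z : ℝ → Set ℂ} (hZ : ∀ t ∈ Icc (0 : ℝ) 1, MovesSmoothlyNear Z t) :
    ∃ m : ℕ, 0 < m ∧ ∃ Ψ : ℝ → ℂ → ℂ, IsMotion Z (Icc 0 1) 0 Ψ ∧
      ∀ u, IsPiecewiseC1 m fun t => Ψ t u := by
  have hstep : ∀ t₀ : ℝ, ∃ ε : ℝ, t₀ ∈ Icc (0 : ℝ) 1 → 0 < ε ∧
      ∀ t₁ ∈ Icc 0 1 ∩ Metric.ball t₀ ε, ∃ Φ : ℝ → ℂ → ℂ,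
      IsMotion Z (Icc 0 1 ∩ Metric.ball t₀ ε) t₁ Φ ∧
      ∀ u, ContDiffOn ℝ 1 (fun t => Φ t u) (Icc 0 1 ∩ Metric.ball t₀ ε) := by
    intro t₀
    by_cases ht₀ : t₀ ∈ Icc (0 : ℝ) 1
    · obtain ⟨ε, h1, h2⟩ := (hZ t₀ ht₀).exists_isMotion ht₀
      exact ⟨ε, fun _ => ⟨h1, h2⟩⟩
    · exact ⟨0, fun h => absurd h ht₀⟩
  choose ε hε using hstep
  obtain ⟨δ, hδ, hL⟩ := isCompact_Icc.exists_ball_inter_subset (s := Icc (0 : ℝ) 1)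
    (c := fun t => Metric.ball t (ε t))
    fun t ht => mem_nhdsWithin_of_mem_nhds (Metric.ball_mem_nhds t (hε t ht).1)
  obtain ⟨n, hn⟩ := exists_nat_one_div_lt hδ
  set m := n + 1 with hm
  have hmR : (0 : ℝ) < m := by positivity
  have hn' : 1 / (m : ℝ) < δ := by simpa [hm] using hn
  -- Each interval of length `1 / m` fits into one of the neighbourhoods where a local motion
  -- exists. The motions are composed one interval at a time.
  have key : ∀ j ≤ m, ∃ Ψ : ℝ → ℂ → ℂ, IsMotion Z (Icc 0 (j / m)) 0 Ψ ∧
      ∀ u, ∀ i < j, ContDiffOn ℝ 1 (fun t => Ψ t u) (Icc (i / m) ((i + 1) / m)) := by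
    intro j
    induction j with
    | zero =>
      intro _
      obtain ⟨Φ, h, -⟩ := (hε 0 (by simp)).2 0 ⟨by simp, Metric.mem_ball_self (hε 0 (by simp)).1⟩
      refine ⟨Φ, h.mono ?_, by simp⟩
      intro t ht
      obtain rfl : t = 0 := by simpa using ht
      exact ⟨by simp, Metric.mem_ball_self (hε 0 (by simp)).1⟩
    | succ j ih =>
      intro hj
      obtain ⟨Ψ, hΨ, hΨC⟩ := ih (by omega)
      have hjm : (j : ℝ) + 1 ≤ m := by exact_mod_cast hj
      have hle : (j : ℝ) / m ≤ (j + 1) / m := by gcongr; linarith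
      have hjI : (j : ℝ) / m ∈ Icc (0 : ℝ) 1 :=
        ⟨by positivity, (div_le_one hmR).2 (by linarith)⟩
      obtain ⟨t₀, ht₀, hsub⟩ := hL _ hjI
      have hJ : Icc ((j : ℝ) / m) ((j + 1) / m) ⊆ Icc 0 1 ∩ Metric.ball t₀ (ε t₀) := by
        intro t ht
        have htI : t ∈ Icc (0 : ℝ) 1 :=
          ⟨hjI.1.trans ht.1, ht.2.trans ((div_le_one hmR).2 hjm)⟩
        refine ⟨htI, hsub ⟨?_, htI⟩⟩
        rw [Metric.mem_ball, Real.dist_eq, abs_of_nonneg (sub_nonneg.2 ht.1)]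
        have := ht.2
        rw [add_div] at this
        linarith
      obtain ⟨Φ, hΦ, hΦC⟩ := (hε t₀ ht₀).2 _ (hJ ⟨le_rfl, hle⟩)
      push_cast
      refine ⟨_, hΨ.trans hjI.1 hle (hΦ.mono hJ), fun u i hi => ?_⟩
      rcases Nat.lt_succ_iff_lt_or_eq.1 hi with hij | rfl
      · refine (hΨC u i hij).congr fun t ht => if_pos (ht.2.trans ?_)
        have : (i : ℝ) + 1 ≤ j := by exact_mod_cast hij
        gcongr
      · refine ((hΦC _).mono hJ).congr (f := fun t => Φ t (Ψ (i / m) u)) fun t ht => ?_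
        split_ifs with h
        · obtain rfl : t = i / m := le_antisymm h ht.1
          exact (hΦ.start _).symm
        · rfl
  obtain ⟨Ψ, h1, h2⟩ := key m le_rfl
  rw [div_self hmR.ne'] at h1
  exact ⟨m, by omega, Ψ, h1, fun u i hi => h2 u i hi⟩

end Isotopy

/-! ### From `C¹` to piecewise `C¹` paths by slowing down at the corners -/

section Reparametrization

variable {F : Type*} [NormedAddCommGroup F] [NormedSpace ℝ F]

theorem contDiffOn_one_Icc_iff {g : ℝ → F} {a b : ℝ} (hab : a < b) :
    ContDiffOn ℝ 1 g (Icc a b) ↔ ∃ G : ℝ → F, ContinuousOn G (Icc a b) ∧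
      ∀ t ∈ Icc a b, HasDerivWithinAt g (G t) (Icc a b) t := by
  have hu := uniqueDiffOn_Icc hab
  have hiff := contDiffOn_succ_iff_derivWithin (𝕜 := ℝ) (n := 0) (f := g) hu
  rw [zero_add] at hiff
  rw [hiff, contDiffOn_zero]
  constructor
  · rintro ⟨h1, -, h2⟩
    exact ⟨_, h2, fun t ht => (h1 t ht).hasDerivWithinAt⟩
  · rintro ⟨G, h1, h2⟩
    refine ⟨fun t ht => (h2 t ht).differentiableWithinAt, by simp, h1.congr fun t ht => ?_⟩
    exact (h2 t ht).derivWithin (hu t ht)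

theorem ContDiffOn.glue_Icc {g : ℝ → F} {a b c : ℝ} (hab : a < b) (hbc : b < c)
    (h₁ : ContDiffOn ℝ 1 g (Icc a b)) (h₂ : ContDiffOn ℝ 1 g (Icc b c))
    (hd₁ : HasDerivWithinAt g 0 (Icc a b) b) (hd₂ : HasDerivWithinAt g 0 (Icc b c) b) :
    ContDiffOn ℝ 1 g (Icc a c) := by
  rw [contDiffOn_one_Icc_iff hab] at h₁
  rw [contDiffOn_one_Icc_iff hbc] at h₂
  rw [contDiffOn_one_Icc_iff (hab.trans hbc)]
  obtain ⟨G₁, hG₁, h₁⟩ := h₁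
  obtain ⟨G₂, hG₂, h₂⟩ := h₂
  have e1 : G₁ b = 0 :=
    (uniqueDiffOn_Icc hab b ⟨hab.le, le_rfl⟩).eq_deriv _ (h₁ b ⟨hab.le, le_rfl⟩) hd₁
  have e2 : G₂ b = 0 :=
    (uniqueDiffOn_Icc hbc b ⟨le_rfl, hbc.le⟩).eq_deriv _ (h₂ b ⟨le_rfl, hbc.le⟩) hd₂
  refine ⟨fun t => if t ≤ b then G₁ t else G₂ t, ?_, fun t ht => ?_⟩
  · rw [← Icc_union_Icc_eq_Icc hab.le hbc.le]
    refine ContinuousOn.union_of_isClosed ?_ ?_ isClosed_Icc isClosed_Icc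
    · exact hG₁.congr fun t ht => by simp [ht.2]
    · refine hG₂.congr fun t ht => ?_
      split_ifs with h
      · obtain rfl : t = b := le_antisymm h ht.1
        rw [e1, e2]
      · rfl
  · rcases lt_trichotomy t b with h | rfl | h
    · simp only [h.le, if_true]
      refine (h₁ t ⟨ht.1, h.le⟩).mono_of_mem_nhdsWithin ?_
      rw [mem_nhdsWithin]
      exact ⟨Iio b, isOpen_Iio, h, fun s hs => ⟨hs.2.1, hs.1.le⟩⟩
    · simp only [le_refl, if_true, e1]
      rw [← Icc_union_Icc_eq_Icc hab.le hbc.le]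
      exact hd₁.union hd₂
    · simp only [not_le.2 h, if_false]
      refine (h₂ t ⟨h.le, ht.2⟩).mono_of_mem_nhdsWithin ?_
      rw [mem_nhdsWithin]
      exact ⟨Ioi b, isOpen_Ioi, h, fun s hs => ⟨hs.1.le, hs.2.2⟩⟩

theorem IsPiecewiseC1.contDiffOn {m : ℕ} (hm : 0 < m) {g : ℝ → F} (hg : IsPiecewiseC1 m g)
    (hl : ∀ i < m, HasDerivWithinAt g 0 (Icc (i / m) ((i + 1) / m)) (i / m))
    (hr : ∀ i < m, HasDerivWithinAt g 0 (Icc (i / m) ((i + 1) / m)) ((i + 1) / m)) :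
    ContDiffOn ℝ 1 g (Icc 0 1) := by
  have hmR : (0 : ℝ) < m := by exact_mod_cast hm
  have key : ∀ j : ℕ, j < m → ContDiffOn ℝ 1 g (Icc 0 ((j + 1 : ℕ) / m)) := by
    intro j
    induction j with
    | zero => intro h; simpa using hg 0 h
    | succ j ih =>
      intro hj
      have h1 : (j : ℝ) / m < (j + 1 : ℕ) / m := by push_cast; gcongr; linarith
      have h2 : ((j + 1 : ℕ) : ℝ) / m < ((j + 1 + 1 : ℕ) : ℝ) / m := by push_cast; gcongr; linarith
      refine ContDiffOn.glue_Icc (by positivity) h2 (ih (by omega)) ?_ ?_ ?_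
      · simpa using hg (j + 1) hj
      · have := hr j (by omega)
        push_cast
        refine this.mono_of_mem_nhdsWithin ?_
        rw [mem_nhdsWithin]
        push_cast at h1
        exact ⟨Ioi (j / m), isOpen_Ioi, h1, fun s hs => ⟨hs.1.le, hs.2.2⟩⟩
      · simpa using hl (j + 1) hj
  have := key (m - 1) (by omega)
  rwa [Nat.sub_add_cancel hm, div_self hmR.ne'] at this

/-- A change of time which slows down to speed zero at the multiples of `1 / m`. -/
noncomputable def slowTime (m : ℕ) (t : ℝ) : ℝ :=
  t - Real.sin (2 * Real.pi * m * t) / (2 * Real.pi * m)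

theorem hasDerivAt_slowTime {m : ℕ} (hm : 0 < m) (t : ℝ) :
    HasDerivAt (slowTime m) (1 - Real.cos (2 * Real.pi * m * t)) t := by
  have hc : (2 * Real.pi * m : ℝ) ≠ 0 := by positivity
  have h1 : HasDerivAt (fun t : ℝ => 2 * Real.pi * m * t) (2 * Real.pi * m) t := by
    simpa using (hasDerivAt_id t).const_mul (2 * Real.pi * m)
  refine ((hasDerivAt_id t).sub (h1.sin.div_const (2 * Real.pi * m))).congr_deriv ?_
  field_simp

theorem contDiff_slowTime (m : ℕ) : ContDiff ℝ 1 (slowTime m) := by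
  unfold slowTime
  fun_prop

theorem slowTime_div {m : ℕ} (hm : 0 < m) (i : ℕ) : slowTime m (i / m) = i / m := by
  have hmR : (m : ℝ) ≠ 0 := by positivity
  rw [slowTime, show 2 * Real.pi * m * (i / m) = ((2 * i : ℕ) : ℝ) * Real.pi by
    push_cast; field_simp, Real.sin_nat_mul_pi]
  simp

/-- The derivative has zeros, so its sign alone does not suffice. Strictness comes from `sin b - sin
a = 2 sin x cos y` and `|sin x| < x`. -/
theorem strictMono_slowTime {m : ℕ} (hm : 0 < m) : StrictMono (slowTime m) := by
  intro a b hab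
  have hc : (0 : ℝ) < 2 * Real.pi * m := by positivity
  have key : Real.sin (2 * Real.pi * m * b) - Real.sin (2 * Real.pi * m * a) <
      2 * Real.pi * m * b - 2 * Real.pi * m * a := by
    rw [Real.sin_sub_sin]
    set x := (2 * Real.pi * m * b - 2 * Real.pi * m * a) / 2 with hx
    have hx0 : 0 < x := by
      rw [hx]; have := mul_lt_mul_of_pos_left hab hc; linarith
    have h1 : |Real.sin x| < x := by
      simpa [abs_of_pos hx0] using Real.abs_sin_lt_abs hx0.ne'
    have h2 := abs_le.1 (Real.abs_cos_le_one ((2 * Real.pi * m * b + 2 * Real.pi * m * a) / 2))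
    have h3 : Real.sin x * Real.cos ((2 * Real.pi * m * b + 2 * Real.pi * m * a) / 2) ≤
        |Real.sin x| := by
      refine (le_abs_self _).trans ?_
      rw [abs_mul]
      exact mul_le_of_le_one_right (abs_nonneg _) (Real.abs_cos_le_one _)
    linarith
  have h4 : (Real.sin (2 * Real.pi * m * b) - Real.sin (2 * Real.pi * m * a)) / (2 * Real.pi * m) <
      b - a := by
    rw [div_lt_iff₀ hc]; linarith
  rw [sub_div] at h4
  simp only [slowTime]
  linarith

theorem surjective_slowTime {m : ℕ} (hm : 0 < m) : Function.Surjective (slowTime m) := by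
  have hmR : (m : ℝ) ≠ 0 := by positivity
  intro y
  have hcont := (contDiff_slowTime m).continuous
  obtain ⟨k, hk⟩ := exists_nat_ge |y|
  have hk' := abs_le.1 hk
  have h1 : slowTime m k = k := by
    have := slowTime_div hm (k * m)
    rwa [Nat.cast_mul, mul_div_cancel_right₀ _ hmR] at this
  have h2 : slowTime m (-k) = -k := by
    simp only [slowTime, mul_neg, Real.sin_neg, neg_div] at h1 ⊢
    linarith
  have := intermediate_value_univ (-k : ℝ) k hcont
  rw [h1, h2] at this
  exact this ⟨hk'.1, hk'.2⟩

variable {Y : Type*} [NormedAddCommGroup Y] [NormedSpace ℂ Y]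

/-- The change of time is a homeomorphism fixing `0` and `1`. Coherence of germs is a topological
condition on time, so a merely continuous inverse suffices to undo it. -/
theorem ContinuesAlong.of_comp_slowTime {m : ℕ} (hm : 0 < m) {f : Y → ℂ} {η : ℝ → Y}
    (h : ContinuesAlong f fun t => η (slowTime m t)) : ContinuesAlong f η := by
  have hmR : (m : ℝ) ≠ 0 := by positivity
  set e := (strictMono_slowTime hm).orderIsoOfSurjective _ (surjective_slowTime hm) with he
  have hes : ∀ t, slowTime m (e.symm t) = t := fun t => e.apply_symm_apply t
  have h0 : e.symm 0 = 0 := e.injective (by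
    rw [e.apply_symm_apply]
    have := slowTime_div hm 0
    rw [Nat.cast_zero, zero_div] at this
    exact this.symm)
  have h1 : e.symm 1 = 1 := e.injective (by
    rw [e.apply_symm_apply]
    have := slowTime_div hm m
    rw [div_self hmR] at this
    exact this.symm)
  have hmaps : MapsTo e.symm (Icc 0 1) (Icc 0 1) := fun t ht =>
    ⟨h0 ▸ e.symm.monotone ht.1, h1 ▸ e.symm.monotone ht.2⟩
  obtain ⟨φ, hφ0, hφ1, hφ2⟩ := h
  have hs0 := hes 0
  rw [h0] at hs0
  simp only [hs0] at hφ0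
  refine ⟨fun t => φ (e.symm t), by simpa only [h0] using hφ0, fun t ht => ?_, fun t ht => ?_⟩
  · simpa only [hes] using hφ1 _ (hmaps ht)
  · have hc : Tendsto e.symm (𝓝[Icc 0 1] t) (𝓝[Icc 0 1] e.symm t) :=
      tendsto_nhdsWithin_iff.2 ⟨e.symm.continuous.continuousAt.mono_left nhdsWithin_le_nhds,
        eventually_nhdsWithin_of_forall fun s hs => hmaps hs⟩
    filter_upwards [hc.eventually (hφ2 _ (hmaps ht))] with s hs
    simpa only [hes] using hs

/-- At each node the speed is zero, so the chain rule makes both one-sided derivatives vanish and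
the pieces fit together. -/
theorem IsPiecewiseC1.contDiffOn_comp_slowTime {m : ℕ} (hm : 0 < m) {η : ℝ → F}
    (h : IsPiecewiseC1 m η) : ContDiffOn ℝ 1 (fun t => η (slowTime m t)) (Icc 0 1) := by
  have hmR : (0 : ℝ) < m := by positivity
  have hend : ∀ i : ℕ, slowTime m ((i + 1 : ℝ) / m) = (i + 1) / m := fun i => by
    simpa using slowTime_div hm (i + 1)
  have hmaps : ∀ i : ℕ, MapsTo (slowTime m) (Icc ((i : ℝ) / m) ((i + 1) / m))
      (Icc (i / m) ((i + 1) / m)) := by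
    intro i t ht
    have h1 := (strictMono_slowTime hm).monotone ht.1
    have h2 := (strictMono_slowTime hm).monotone ht.2
    rw [slowTime_div hm i] at h1
    rw [hend] at h2
    exact ⟨h1, h2⟩
  have hder : ∀ i < m, ∀ j : ℕ, ((j : ℝ) / m) ∈ Icc ((i : ℝ) / m) ((i + 1) / m) →
      HasDerivWithinAt (fun t => η (slowTime m t)) 0 (Icc (i / m) ((i + 1) / m)) (j / m) := by
    intro i hi j hj
    have hd := (hasDerivAt_slowTime hm (j / m)).hasDerivWithinAt (s := Icc ((i : ℝ) / m) ((i + 1) / m))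
    rw [show 2 * Real.pi * m * (j / m) = j * (2 * Real.pi) by field_simp,
      Real.cos_nat_mul_two_pi, sub_self] at hd
    have hη := ((h i hi).differentiableOn one_ne_zero) (slowTime m (j / m)) (hmaps i hj)
    have := hη.hasDerivWithinAt.scomp (j / m : ℝ) hd (hmaps i)
    rw [zero_smul] at this
    exact this
  refine IsPiecewiseC1.contDiffOn hm (fun i hi => ?_) (fun i hi => ?_) fun i hi => ?_
  · exact (h i hi).comp (contDiff_slowTime m).contDiffOn (hmaps i)
  · exact hder i hi i ⟨le_rfl, by gcongr; linarith⟩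
  · have := hder i hi (i + 1) ⟨by push_cast; gcongr; linarith, by push_cast; exact le_rfl⟩
    simpa using this

/-- The continuation property of germs for `C¹` paths extends to piecewise `C¹` paths. -/
theorem ContinuableAvoiding.continuesAlong {n : ℕ} {f : (Fin n → ℂ) → ℂ} {V : Set (Fin n → ℂ)}
    (h : ContinuableAvoiding f V) : ∃ τ : ℝ, 0 < τ ∧ AnalyticOnNhd ℂ f (Metric.ball 0 τ) ∧
      ∀ (m : ℕ) (η : ℝ → Fin n → ℂ), 0 < m → IsPiecewiseC1 m η → η 0 ∈ Metric.ball 0 τ →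
        (∀ t ∈ Icc (0 : ℝ) 1, η t ∉ V) → ContinuesAlong f η := by
  obtain ⟨τ, hτ, hf, H⟩ := h
  refine ⟨τ, hτ, hf, fun m η hm hη h0 hV => ?_⟩
  have hmR : (m : ℝ) ≠ 0 := by positivity
  have s0 : slowTime m 0 = 0 := by simpa using slowTime_div hm 0
  have s1 : slowTime m 1 = 1 := by simpa [hmR] using slowTime_div hm m
  refine ContinuesAlong.of_comp_slowTime hm (hasContinuationAlong_iff.1
    (H _ (hη.contDiffOn_comp_slowTime hm) (by simpa [s0] using h0) fun t ht => hV _ ⟨?_, ?_⟩))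
  · simpa [s0] using (strictMono_slowTime hm).monotone ht.1
  · simpa [s1] using (strictMono_slowTime hm).monotone ht.2

end Reparametrization

/-! ### Smooth motion of simple roots -/

section Roots

variable {N : ℕ}

/-- The zeros of the polynomial obtained from `G` by specializing its coefficients at `x`. -/
def fiberRoots (G : Polynomial (MvPolynomial (Fin N) ℂ)) (x : Fin N → ℂ) : Set ℂ :=
  {u | (G.map (MvPolynomial.eval x)).eval u = 0}

theorem Polynomial.card_roots_of_encard {p : Polynomial ℂ} {D : ℕ} (hD : p.natDegree ≤ D)
    (h : {u | p.eval u = 0}.encard = D) :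
    p ≠ 0 ∧ p.roots.toFinset.card = D ∧ p.natDegree = D ∧
      ∀ u, p.eval u = 0 → p.derivative.eval u ≠ 0 := by
  have hp : p ≠ 0 := by
    rintro rfl
    simp [Set.encard_univ] at h
  have hset : {u | p.eval u = 0} = (p.roots.toFinset : Set ℂ) := by
    ext u; simp [hp]
  rw [hset, Set.encard_coe_eq_coe_finsetCard] at h
  have h1 : p.roots.toFinset.card = D := by exact_mod_cast h
  have h2 := Multiset.toFinset_card_le p.roots
  have h3 := p.card_roots'
  have hnd : p.roots.Nodup := by
    rw [← Multiset.toFinset_card_eq_card_iff_nodup]; omega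
  refine ⟨hp, h1, by omega, fun u hu hu' => ?_⟩
  have := (Polynomial.one_lt_rootMultiplicity_iff_isRoot hp).2 ⟨hu, hu'⟩
  rw [← Polynomial.count_roots] at this
  exact absurd (Multiset.nodup_iff_count_le_one.1 hnd u) (by omega)

theorem MvPolynomial.contDiff_eval {σ : Type*} [Fintype σ] (P : MvPolynomial σ ℂ) :
    ContDiff ℂ 1 fun x : σ → ℂ => MvPolynomial.eval x P := by
  induction P using MvPolynomial.induction_on with
  | C a => simpa using contDiff_const
  | add p q hp hq => simpa using hp.add hq
  | mul_X p i hp => simpa using hp.mul (contDiff_apply ℂ ℂ i)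

theorem contDiff_eval_map (G : Polynomial (MvPolynomial (Fin N) ℂ)) :
    ContDiff ℂ 1 fun y : (Fin N → ℂ) × ℂ => (G.map (MvPolynomial.eval y.1)).eval y.2 := by
  have : (fun y : (Fin N → ℂ) × ℂ => (G.map (MvPolynomial.eval y.1)).eval y.2) =
      fun y => ∑ k ∈ Finset.range (G.natDegree + 1),
        MvPolynomial.eval y.1 (G.coeff k) * y.2 ^ k := by
    funext y
    rw [Polynomial.eval_map, Polynomial.eval₂_eq_sum_range]
  rw [this]
  refine ContDiff.sum fun k _ => ContDiff.mul ?_ (contDiff_snd.pow k)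
  exact (MvPolynomial.contDiff_eval (G.coeff k)).comp contDiff_fst

theorem ContinuousLinearMap.isInvertible_of_apply_one_ne_zero {L : ℂ →L[ℂ] ℂ} (h : L 1 ≠ 0) :
    L.IsInvertible := by
  refine ⟨ContinuousLinearEquiv.unitsEquivAut ℂ (Units.mk0 _ h), ?_⟩
  ext
  simp

theorem exists_implicit_root (G : Polynomial (MvPolynomial (Fin N) ℂ)) {x₀ : Fin N → ℂ} {u₀ : ℂ}
    (h0 : (G.map (MvPolynomial.eval x₀)).eval u₀ = 0)
    (h1 : (G.map (MvPolynomial.eval x₀)).derivative.eval u₀ ≠ 0) :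
    ∃ a : (Fin N → ℂ) → ℂ, ContDiffAt ℂ 1 a x₀ ∧ a x₀ = u₀ ∧ ∀ᶠ x in 𝓝 x₀, a x ∈ fiberRoots G x := by
  set f : (Fin N → ℂ) × ℂ → ℂ := fun y => (G.map (MvPolynomial.eval y.1)).eval y.2 with hf
  have cdf : ContDiffAt ℂ 1 f (x₀, u₀) := (contDiff_eval_map G).contDiffAt
  have hinv : (fderiv ℂ f (x₀, u₀) ∘L .inr ℂ (Fin N → ℂ) ℂ).IsInvertible := by
    refine ContinuousLinearMap.isInvertible_of_apply_one_ne_zero ?_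
    have e1 : HasDerivAt (fun u => f (x₀, u)) (fderiv ℂ f (x₀, u₀) (0, 1)) u₀ := by
      have e2 : HasDerivAt (fun u : ℂ => (x₀, u)) ((0 : Fin N → ℂ), (1 : ℂ)) u₀ :=
        (hasDerivAt_const u₀ x₀).prodMk (hasDerivAt_id u₀)
      exact (cdf.differentiableAt one_ne_zero).hasFDerivAt.comp_hasDerivAt u₀ e2
    have e3 := e1.unique ((G.map (MvPolynomial.eval x₀)).hasDerivAt u₀)
    simpa [e3] using h1
  refine ⟨cdf.implicitFunction one_ne_zero hinv, cdf.contDiffAt_implicitFunction one_ne_zero hinv,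
    cdf.implicitFunction_apply_self one_ne_zero hinv, ?_⟩
  filter_upwards [cdf.eventually_apply_implicitFunction one_ne_zero hinv] with x hx
  exact hx.trans h0

/-- The `D` roots are simple, so each extends to an implicit function. Nearby these functions stay
distinct and the coefficient of degree `D` stays nonzero; as there are at most `D` roots, they are
all of them. -/
theorem movesSmoothlyNear_of_encard {G : Polynomial (MvPolynomial (Fin N) ℂ)} {D : ℕ}
    (hG : G.natDegree ≤ D) {γ : ℝ → Fin N → ℂ} (hγ : ContDiffOn ℝ 1 γ (Icc 0 1)) {t₀ : ℝ}
    (ht₀ : t₀ ∈ Icc (0 : ℝ) 1) (h : (fiberRoots G (γ t₀)).encard = D) {Z : ℝ → Set ℂ}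
    (hZ : ∀ t, Z t ⊆ fiberRoots G (γ t)) : MovesSmoothlyNear Z t₀ := by
  classical
  have hdeg : ∀ x, (G.map (MvPolynomial.eval x)).natDegree ≤ D := fun x =>
    Polynomial.natDegree_map_le.trans hG
  obtain ⟨hp, hcard, hnat, hder⟩ := Polynomial.card_roots_of_encard (hdeg (γ t₀)) h
  set p := G.map (MvPolynomial.eval (γ t₀)) with hpdef
  have e : p.roots.toFinset ≃ Fin D := p.roots.toFinset.equivFinOfCardEq hcard
  have hroot : ∀ k, p.eval (e.symm k : ℂ) = 0 := fun k => by
    have := (e.symm k).2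
    rw [Multiset.mem_toFinset, Polynomial.mem_roots hp] at this
    exact this
  have hex := fun k => exists_implicit_root G (hroot k) (hder _ (hroot k))
  choose a ha ha0 haroot using hex
  have hlead : ∀ᶠ x in 𝓝 (γ t₀), (G.map (MvPolynomial.eval x)).coeff D ≠ 0 := by
    have hc : Continuous fun x => (G.map (MvPolynomial.eval x)).coeff D := by
      simp only [Polynomial.coeff_map]
      exact (MvPolynomial.contDiff_eval _).continuous
    refine hc.continuousAt.eventually_ne ?_
    rw [← hpdef, ← hnat]
    exact Polynomial.leadingCoeff_ne_zero.2 hp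
  have hdist : ∀ᶠ x in 𝓝 (γ t₀), ∀ k l, k ≠ l → a k x ≠ a l x := by
    refine eventually_all.2 fun k => eventually_all.2 fun l => ?_
    by_cases hkl : k = l
    · exact Eventually.of_forall fun _ h => absurd hkl h
    · have hne : a k (γ t₀) ≠ a l (γ t₀) := by
        rw [ha0, ha0]
        exact fun h => hkl (e.symm.injective (Subtype.ext h))
      have h3 := ((ha k).continuousAt.sub (ha l).continuousAt).eventually_ne (sub_ne_zero.2 hne)
      filter_upwards [h3] with x hx _ using sub_ne_zero.1 hx
  have hsmooth : ∀ᶠ x in 𝓝 (γ t₀), ∀ k, ContDiffAt ℝ 1 (a k) x :=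
    eventually_all.2 fun k => ((ha k).restrict_scalars ℝ).eventually (by simp)
  have hall : ∀ᶠ x in 𝓝 (γ t₀), (∀ k, ContDiffAt ℝ 1 (a k) x) ∧
      ∀ u ∈ fiberRoots G x, ∃ k, u = a k x := by
    filter_upwards [hsmooth, hlead, hdist, eventually_all.2 haroot] with x h1 h2 h3 h4
    refine ⟨h1, fun u hu => ?_⟩
    set q := G.map (MvPolynomial.eval x) with hq
    have hq0 : q ≠ 0 := fun h => h2 (by rw [h, Polynomial.coeff_zero])
    have hinj : Function.Injective fun k => a k x := fun k l hkl => by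
      by_contra hne
      exact h3 k l hne hkl
    have hsub : Finset.univ.image (fun k => a k x) ⊆ q.roots.toFinset := by
      intro v hv
      obtain ⟨k, -, rfl⟩ := Finset.mem_image.1 hv
      rw [Multiset.mem_toFinset, Polynomial.mem_roots hq0]
      exact h4 k
    have heq := Finset.eq_of_subset_of_card_le hsub (by
      rw [Finset.card_image_of_injective _ hinj, Finset.card_univ, Fintype.card_fin]
      exact ((Multiset.toFinset_card_le _).trans q.card_roots').trans (hdeg x))
    have hu' : u ∈ q.roots.toFinset := by
      rw [Multiset.mem_toFinset, Polynomial.mem_roots hq0]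
      exact hu
    rw [← heq] at hu'
    obtain ⟨k, -, hk⟩ := Finset.mem_image.1 hu'
    exact ⟨k, hk.symm⟩
  have hnear := (hγ.continuousOn t₀ ht₀).eventually hall
  obtain ⟨ε, hε, hball⟩ := Metric.mem_nhdsWithin_iff.1 hnear
  refine ⟨ε, hε, D, fun k t => a k (γ t), ?_, fun k t ht => ?_, fun t ht u hu => ?_⟩
  · intro k l hkl
    simp only [ha0] at hkl
    exact e.symm.injective (Subtype.ext hkl)
  · exact ((hball ⟨ht.2, ht.1⟩).1 k).comp_contDiffWithinAt t ((hγ t ht.1).mono inter_subset_left)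
  · exact (hball ⟨ht.2, ht.1⟩).2 u (hZ t hu)

end Roots

/-! ### The angular average as a circle integral -/

section Average

theorem circleIntegral_inv_smul_eq (g : ℂ → ℂ) {r : ℝ} (hr : r ≠ 0) :
    (∮ z in C(0, r), (z - 0)⁻¹ • g z) =
      Complex.I * ∫ θ in (0 : ℝ)..2 * Real.pi, g (circleMap 0 r θ) := by
  rw [circleIntegral, ← intervalIntegral.integral_const_mul]
  refine intervalIntegral.integral_congr fun θ _ => ?_
  have := circleMap_ne_center (c := (0 : ℂ)) (θ := θ) hr
  simp only [deriv_circleMap, sub_zero, smul_eq_mul]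
  field_simp

theorem integral_circleMap_eq_of_annulus {g : ℂ → ℂ} {r R : ℝ} (h0 : 0 < r) (hle : r ≤ R)
    (hg : ∀ z : ℂ, r ≤ ‖z‖ → ‖z‖ ≤ R → DifferentiableAt ℂ g z) :
    ∫ θ in (0 : ℝ)..2 * Real.pi, g (circleMap 0 R θ) =
      ∫ θ in (0 : ℝ)..2 * Real.pi, g (circleMap 0 r θ) := by
  have := Complex.circleIntegral_sub_center_inv_smul_eq_of_differentiable_on_annulus_off_countable
    (c := 0) (f := g) h0 hle countable_empty
    (fun z hz => (hg z (by simpa using hz.2) (by simpa using hz.1)).continuousAt.continuousWithinAt)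
    (fun z hz => hg z (by simpa using le_of_lt (not_le.1 fun h => hz.1.2 (by simpa using h)))
      (by simpa using le_of_lt (by simpa using hz.1.1)))
  rw [circleIntegral_inv_smul_eq g h0.ne', circleIntegral_inv_smul_eq g (h0.trans_le hle).ne'] at this
  exact mul_left_cancel₀ Complex.I_ne_zero this

theorem integral_circleMap_eq_center {g : ℂ → ℂ} {r : ℝ} (h0 : 0 < r)
    (hg : ∀ z : ℂ, ‖z‖ ≤ r → DifferentiableAt ℂ g z) :
    ∫ θ in (0 : ℝ)..2 * Real.pi, g (circleMap 0 r θ) = 2 * Real.pi * g 0 := by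
  have := Complex.circleIntegral_sub_inv_smul_of_differentiable_on_off_countable
    (c := 0) (w := 0) (R := r) (f := g) countable_empty (by simpa using h0)
    (fun z hz => (hg z (by simpa using hz)).continuousAt.continuousWithinAt)
    (fun z hz => hg z (by simpa using le_of_lt (by simpa using hz.1)))
  rw [circleIntegral_inv_smul_eq g h0.ne', smul_eq_mul] at this
  refine mul_left_cancel₀ Complex.I_ne_zero ?_
  rw [this]; ring

/-- The average of `k(√ξ e^{-iθ}, √ξ e^{iθ})` is the integral of `k(u, ξ/u)` over circles. -/
theorem integral_sqrt_eq_integral_circleMap {k : ℂ × ℂ → ℂ} {R r : ℝ} {ξ : ℂ}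
    (hk : DifferentiableOn ℂ k (Metric.ball 0 R)) (hr : 0 < r) (hrR : r < R)
    (hξ : ‖ξ‖ < r * R) :
    ∫ θ in (0 : ℝ)..2 * Real.pi, k (Complex.sqrt ξ * Complex.exp (-(Complex.I * θ)),
        Complex.sqrt ξ * Complex.exp (Complex.I * θ)) =
      ∫ θ in (0 : ℝ)..2 * Real.pi, k (circleMap 0 r θ, ξ / circleMap 0 r θ) := by
  have hR : 0 < R := hr.trans hrR
  have hkd : ∀ a b : ℂ, ‖a‖ < R → ‖b‖ < R → DifferentiableAt ℂ k (a, b) := fun a b ha hb =>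
    hk.differentiableAt (Metric.isOpen_ball.mem_nhds (by
      simpa [Prod.norm_def] using ⟨ha, hb⟩))
  have hsq : Complex.sqrt ξ * Complex.sqrt ξ = ξ := by
    rw [← sq, Complex.sqrt]
    exact_mod_cast Complex.cpow_nat_inv_pow ξ two_ne_zero
  -- The circle of radius `‖√ξ‖` degenerates here; both sides equal `2π k(0, 0)` by the mean value
  -- property.
  by_cases h0 : ξ = 0
  · subst h0
    have hs : Complex.sqrt 0 = 0 := by simp
    have := integral_circleMap_eq_center (g := fun u => k (u, 0)) hr fun z hz =>
      DifferentiableAt.comp (f := fun u : ℂ => (u, (0 : ℂ))) z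
        (hkd z 0 (hz.trans_lt hrR) (by simpa using hR)) (by fun_prop)
    simp only [hs, zero_mul, zero_div, this, intervalIntegral.integral_const]
    simp
  · set s := Complex.sqrt ξ with hs
    have hs0 : s ≠ 0 := fun h => h0 (by rw [← hsq, h, zero_mul])
    set ρ := ‖s‖ with hρ
    have hρ0 : 0 < ρ := norm_pos_iff.2 hs0
    have hρsq : ρ * ρ = ‖ξ‖ := by rw [hρ, ← norm_mul, hsq]
    have hρR : ρ < R := by
      by_contra h
      have := mul_le_mul (not_lt.1 h) (not_lt.1 h) hR.le hρ0.le
      nlinarith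
    set g : ℂ → ℂ := fun u => k (u, ξ / u) with hg
    -- Between the circles of radii `r` and `‖√ξ‖`, both `u` and `ξ / u` stay below `R` in norm, so
    -- Cauchy's theorem on the annulus allows changing the radius.
    have hgd : ∀ z : ℂ, min r ρ ≤ ‖z‖ → ‖z‖ ≤ max r ρ → DifferentiableAt ℂ g z := by
      intro z h1 h2
      have hz0 : 0 < ‖z‖ := (lt_min hr hρ0).trans_le h1
      have hz : z ≠ 0 := norm_pos_iff.1 hz0
      refine DifferentiableAt.comp (f := fun u : ℂ => (u, ξ / u)) z
        (hkd z (ξ / z) (h2.trans_lt (max_lt hrR hρR)) ?_) ?_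
      · rw [norm_div, div_lt_iff₀ hz0]
        rcases min_le_iff.1 h1 with h | h
        · nlinarith
        · nlinarith
      · exact differentiableAt_id.prodMk ((differentiableAt_const ξ).div differentiableAt_id hz)
    have e1 : ∫ θ in (0 : ℝ)..2 * Real.pi, g (circleMap 0 r θ) =
        ∫ θ in (0 : ℝ)..2 * Real.pi, g (circleMap 0 ρ θ) := by
      rcases le_total r ρ with h | h
      · refine (integral_circleMap_eq_of_annulus hr h fun z h1 h2 => hgd z ?_ ?_).symm
        · rwa [min_eq_left h]
        · rwa [max_eq_right h]
      · refine integral_circleMap_eq_of_annulus hρ0 h fun z h1 h2 => hgd z ?_ ?_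
        · rwa [min_eq_right h]
        · rwa [max_eq_left h]
    rw [e1]
    -- The circle is run through backwards from `arg √ξ`; reflection and periodicity remove this,
    -- and with it the choice of the square root.
    have hpolar : ∀ θ : ℝ, s * Complex.exp (-(Complex.I * θ)) = circleMap 0 ρ (s.arg - θ) := by
      intro θ
      rw [circleMap, zero_add]
      conv_lhs => rw [← Complex.norm_mul_exp_arg_mul_I s]
      rw [mul_assoc, ← Complex.exp_add]
      rw [← hρ]
      push_cast
      congr 2
      ring
    have e2 : ∀ θ : ℝ, k (s * Complex.exp (-(Complex.I * θ)), s * Complex.exp (Complex.I * θ)) =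
        g (circleMap 0 ρ (s.arg - θ)) := by
      intro θ
      rw [← hpolar]
      simp only [hg]
      congr 2
      rw [eq_div_iff (mul_ne_zero hs0 (Complex.exp_ne_zero _)),
        show s * Complex.exp (Complex.I * θ) * (s * Complex.exp (-(Complex.I * θ))) =
          s * s * (Complex.exp (Complex.I * θ) * Complex.exp (-(Complex.I * θ))) by ring,
        ← Complex.exp_add, hsq]
      simp
    simp only [e2]
    rw [intervalIntegral.integral_comp_sub_left (fun θ => g (circleMap 0 ρ θ)) s.arg]
    have hper : Function.Periodic (fun θ => g (circleMap 0 ρ θ)) (2 * Real.pi) := fun θ => by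
      simp only [periodic_circleMap 0 ρ θ]
    have := hper.intervalIntegral_add_eq (s.arg - 2 * Real.pi) 0
    rw [sub_add_cancel, zero_add] at this
    rw [sub_zero, this]

end Average

/-! ### Continuation of angular averages -/

section AverageContinuation

variable {N : ℕ}

/-- The circle of radius `r`, with parameter interval `[0,1]`. -/
noncomputable def unitCircleMap (r : ℝ) (s : ℝ) : ℂ := circleMap 0 r (2 * Real.pi * s)

theorem hasDerivAt_unitCircleMap (r s : ℝ) :
    HasDerivAt (unitCircleMap r) (unitCircleMap r s * (2 * Real.pi * Complex.I)) s := by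
  have h1 : HasDerivAt (fun s : ℝ => 2 * Real.pi * s) (2 * Real.pi) s := by
    simpa using (hasDerivAt_id s).const_mul (2 * Real.pi)
  have h2 := (hasDerivAt_circleMap 0 r (2 * Real.pi * s)).scomp s h1
  refine h2.congr_deriv ?_
  simp only [unitCircleMap, Complex.real_smul]
  push_cast
  ring

theorem continuous_unitCircleMap (r : ℝ) : Continuous (unitCircleMap r) :=
  (continuous_circleMap 0 r).comp (by fun_prop)

theorem norm_unitCircleMap {r : ℝ} (hr : 0 < r) (s : ℝ) : ‖unitCircleMap r s‖ = r := by
  simp [unitCircleMap, abs_of_pos hr]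

theorem unitCircleMap_one (r : ℝ) : unitCircleMap r 1 = unitCircleMap r 0 := by
  have := periodic_circleMap 0 r 0
  simpa [unitCircleMap] using this

/-- The factor `1 / (2πi u)` is kept in the integrand, leaving the derivative of the contour as the
last factor, which is the shape `continuesAlong_integral` needs. -/
theorem integral_circleMap_eq_integral_unitCircleMap (g : ℂ → ℂ) {r : ℝ} (hr : 0 < r) :
    (1 / (2 * Real.pi) : ℂ) * ∫ θ in (0 : ℝ)..2 * Real.pi, g (circleMap 0 r θ) =
      ∫ s in (0 : ℝ)..1, g (unitCircleMap r s) * ((unitCircleMap r s)⁻¹ * (2 * Real.pi * Complex.I)⁻¹) *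
        (unitCircleMap r s * (2 * Real.pi * Complex.I)) := by
  have hpi : (2 * Real.pi : ℝ) ≠ 0 := by positivity
  have h1 := intervalIntegral.integral_comp_mul_left (a := 0) (b := 1)
    (fun θ => g (circleMap 0 r θ)) hpi
  rw [mul_zero, mul_one] at h1
  have h2 : ∀ s : ℝ, g (unitCircleMap r s) *
      ((unitCircleMap r s)⁻¹ * (2 * Real.pi * Complex.I)⁻¹) *
        (unitCircleMap r s * (2 * Real.pi * Complex.I)) = g (circleMap 0 r (2 * Real.pi * s)) := by
    intro s
    have h3 : unitCircleMap r s ≠ 0 := norm_pos_iff.1 (by rw [norm_unitCircleMap hr]; exact hr)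
    have h4 := Complex.two_pi_I_ne_zero
    have h5 : (unitCircleMap r s)⁻¹ * (2 * Real.pi * Complex.I)⁻¹ *
        (unitCircleMap r s * (2 * Real.pi * Complex.I)) = 1 := by
      rw [← mul_inv, inv_mul_cancel₀ (mul_ne_zero h3 h4)]
    rw [mul_assoc, h5, mul_one, unitCircleMap]
  simp only [h2]
  rw [h1, Complex.real_smul]
  push_cast
  rw [one_div]

/-- The substitution `(x, u) ↦ (x, u, x_l / u)`. -/
noncomputable def hyperbolaMap (l : Fin N) (y : (Fin N → ℂ) × ℂ) : (Fin N → ℂ) × ℂ × ℂ :=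
  (y.1, y.2, y.1 l / y.2)

theorem analyticAt_hyperbolaMap (l : Fin N) {y : (Fin N → ℂ) × ℂ} (hy : y.2 ≠ 0) :
    AnalyticAt ℂ (hyperbolaMap l) y := by
  have h1 : AnalyticAt ℂ (fun y : (Fin N → ℂ) × ℂ => y.1 l) y :=
    ((ContinuousLinearMap.proj (R := ℂ) (φ := fun _ : Fin N => ℂ) l).comp
      (ContinuousLinearMap.fst ℂ (Fin N → ℂ) ℂ)).analyticAt y
  exact analyticAt_fst.prod (analyticAt_snd.prod (h1.div analyticAt_snd hy))

/-- The average over `θ` of `k(x, √ξ e^{-iθ}, √ξ e^{iθ})` with `ξ = x_l`. -/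
noncomputable def thetaAverage (l : Fin N) (k : (Fin N → ℂ) × ℂ × ℂ → ℂ) (x : Fin N → ℂ) : ℂ :=
  (1 / (2 * Real.pi) : ℂ) * ∫ θ in (0 : ℝ)..(2 * Real.pi),
    k (x, Complex.sqrt (x l) * Complex.exp (-(Complex.I * θ)),
      Complex.sqrt (x l) * Complex.exp (Complex.I * θ))

theorem mem_ball_zero_prod_iff {x : Fin N → ℂ} {a b : ℂ} {τ : ℝ} :
    (x, a, b) ∈ Metric.ball (0 : (Fin N → ℂ) × ℂ × ℂ) τ ↔ ‖x‖ < τ ∧ ‖a‖ < τ ∧ ‖b‖ < τ := by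
  simp [Prod.norm_def]

/-- From `‖x l‖ < τ² / 8` and `r > τ / 4` one gets `‖x l / u‖ < τ / 2`. A whole interval of radii is
admitted so that finitely many can later be excluded. -/
theorem hyperbolaMap_mem_ball {l : Fin N} {τ r : ℝ} {x : Fin N → ℂ} {u : ℂ} (hτ : 0 < τ)
    (hr : r ∈ Ioo (τ / 4) (τ / 2)) (hx : ‖x‖ < min (τ / 2) (τ ^ 2 / 8)) (hu : ‖u‖ = r) :
    hyperbolaMap l (x, u) ∈ Metric.ball (0 : (Fin N → ℂ) × ℂ × ℂ) τ := by
  obtain ⟨hx1, hx2⟩ := lt_min_iff.1 hx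
  have hr0 : 0 < r := lt_trans (by positivity) hr.1
  refine mem_ball_zero_prod_iff.2 ⟨by linarith, by linarith [hr.2], ?_⟩
  rw [norm_div, hu, div_lt_iff₀ hr0]
  have := norm_le_pi_norm x l
  nlinarith [hr.1]

theorem thetaAverage_eq_integral {l : Fin N} {k : (Fin N → ℂ) × ℂ × ℂ → ℂ} {τ r : ℝ} (hτ : 0 < τ)
    (hk : AnalyticOnNhd ℂ k (Metric.ball 0 τ)) (hr : r ∈ Ioo (τ / 4) (τ / 2)) {x : Fin N → ℂ}
    (hx : ‖x‖ < min (τ / 2) (τ ^ 2 / 8)) :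
    thetaAverage l k x = ∫ s in (0 : ℝ)..1, k (hyperbolaMap l (x, unitCircleMap r s)) *
      ((unitCircleMap r s)⁻¹ * (2 * Real.pi * Complex.I)⁻¹) *
        (unitCircleMap r s * (2 * Real.pi * Complex.I)) := by
  obtain ⟨hx1, hx2⟩ := lt_min_iff.1 hx
  have hr0 : 0 < r := lt_trans (by positivity) hr.1
  have hd : DifferentiableOn ℂ (fun p : ℂ × ℂ => k (x, p)) (Metric.ball 0 τ) := by
    rintro ⟨a, b⟩ hp
    have hp' : ‖a‖ < τ ∧ ‖b‖ < τ := by simpa [Prod.norm_def] using hp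
    have h1 : DifferentiableAt ℂ k (x, a, b) :=
      (hk _ (mem_ball_zero_prod_iff.2 ⟨by linarith, hp'⟩)).differentiableAt
    exact (DifferentiableAt.comp (f := fun p : ℂ × ℂ => (x, p)) (a, b) h1
      (by fun_prop)).differentiableWithinAt
  have h2 : ‖x l‖ < r * τ := (norm_le_pi_norm x l).trans_lt (by nlinarith [hr.1])
  rw [thetaAverage, integral_sqrt_eq_integral_circleMap hd hr0 (by linarith [hr.2]) h2]
  exact integral_circleMap_eq_integral_unitCircleMap (fun u => k (hyperbolaMap l (x, u))) hr0

/-- The circle is transported by an isotopy avoiding the common roots of the `G α`. That `0` is a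
root of every `G α` keeps the contour off the pole of `x l / u`. -/
theorem continuableAvoiding_thetaAverage {l : Fin N} {k : (Fin N → ℂ) × ℂ × ℂ → ℂ} {τ : ℝ}
    (hτ : 0 < τ) (hk : AnalyticOnNhd ℂ k (Metric.ball 0 τ)) {ι : Type*}
    {G : ι → Polynomial (MvPolynomial (Fin N) ℂ)} {D : ι → ℕ} (hG : ∀ α, (G α).natDegree ≤ D α)
    (hzero : ∀ α x, 0 ∈ fiberRoots (G α) x)
    (hcont : ∀ (m : ℕ) (γ : ℝ → Fin N → ℂ) (η : ℝ → ℂ), 0 < m → ContDiffOn ℝ 1 γ (Icc 0 1) →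
      IsPiecewiseC1 m η → hyperbolaMap l (γ 0, η 0) ∈ Metric.ball 0 τ →
      (∀ t ∈ Icc (0 : ℝ) 1, η t ≠ 0) →
      (∀ t ∈ Icc (0 : ℝ) 1, ∃ α, η t ∉ fiberRoots (G α) (γ t)) →
      ContinuesAlong k fun t => hyperbolaMap l (γ t, η t)) :
    ContinuableAvoiding (thetaAverage l k) {x | ∀ α, (fiberRoots (G α) x).encard ≠ D α} := by
  set τ' := min (τ / 2) (τ ^ 2 / 8) with hτ'
  have hτ'0 : 0 < τ' := by positivity
  set h : (Fin N → ℂ) × ℂ → ℂ := fun y => k (hyperbolaMap l y) *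
    (y.2⁻¹ * (2 * Real.pi * Complex.I)⁻¹) with hh
  have hfac : ∀ y : (Fin N → ℂ) × ℂ, y.2 ≠ 0 →
      AnalyticAt ℂ (fun y : (Fin N → ℂ) × ℂ => y.2⁻¹ * (2 * Real.pi * Complex.I)⁻¹) y :=
    fun y hy => (analyticAt_snd.inv hy).mul analyticAt_const
  have hcirc : ∀ r ∈ Ioo (τ / 4) (τ / 2), ∀ x : Fin N → ℂ, ‖x‖ < τ' →
      (fun x => ∫ s in (0 : ℝ)..1, h (x, unitCircleMap r s) *
        (unitCircleMap r s * (2 * Real.pi * Complex.I))) =ᶠ[𝓝 x] thetaAverage l k := by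
    intro r hr x hx
    filter_upwards [Metric.isOpen_ball.mem_nhds (show x ∈ Metric.ball 0 τ' by simpa using hx)]
      with x' hx'
    exact (thetaAverage_eq_integral hτ hk hr (mem_ball_zero_iff.1 hx')).symm
  have hcd : ∀ r, Continuous fun s => unitCircleMap r s * (2 * Real.pi * Complex.I) := fun r =>
    (continuous_unitCircleMap r).mul continuous_const
  refine ⟨τ', hτ'0, fun x hx => ?_, fun γ hγ hγ0 hγV => ?_⟩
  · have hx' : ‖x‖ < τ' := by simpa using hx
    have hr : τ / 3 ∈ Ioo (τ / 4) (τ / 2) := ⟨by linarith, by linarith⟩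
    have := continuesAlong_integral (γ := fun _ => x) (c := fun _ s => unitCircleMap (τ / 3) s)
      (h := h) continuousOn_const
      ((continuous_unitCircleMap _).comp continuous_snd).continuousOn
      (fun _ => unitCircleMap_one _) (hcd _) (fun s => hasDerivAt_unitCircleMap _ s)
      fun s => continuesAlong_of_analyticAt fun t _ => by
        have hn := norm_unitCircleMap (r := τ / 3) (by positivity) s
        have hne : unitCircleMap (τ / 3) s ≠ 0 := norm_pos_iff.1 (by rw [hn]; positivity)
        exact (AnalyticAt.fun_comp (hk _ (hyperbolaMap_mem_ball hτ hr hx' hn))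
          (analyticAt_hyperbolaMap l hne)).mul (hfac _ hne)
    exact this.analyticAt_zero.congr (hcirc _ hr x hx')
  · have hγ0' : ‖γ 0‖ < τ' := by simpa using hγ0
    -- Only the intersection must be avoided. Near each time it lies in the root set of some `G α`
    -- with `D α` distinct roots, where `α` may vary with time.
    set Z : ℝ → Set ℂ := fun t => {u | ∀ α, u ∈ fiberRoots (G α) (γ t)} with hZ
    have hmove : ∀ t ∈ Icc (0 : ℝ) 1, MovesSmoothlyNear Z t := by
      intro t ht
      have h1 := hγV t ht
      simp only [mem_ofPred_eq, not_forall, not_not] at h1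
      obtain ⟨α, hα⟩ := h1
      exact movesSmoothlyNear_of_encard (hG α) hγ ht hα fun t u hu => hu α
    obtain ⟨m, hm, Ψ, hΨ, hΨC⟩ := exists_isMotion hmove
    obtain ⟨B, hB, hav⟩ := hΨ.avoids
    -- The radius is chosen so that the circle contains none of the finitely many exceptional
    -- starting points.
    obtain ⟨r, hr, hrB⟩ := (Ioo_infinite (show τ / 4 < τ / 2 by linarith)).exists_notMem_finite
      (hB.image norm)
    have hr0 : 0 < r := lt_trans (by positivity) hr.1
    have hnB : ∀ s, unitCircleMap r s ∉ B := fun s hs =>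
      hrB ⟨_, hs, norm_unitCircleMap hr0 s⟩
    have hstart : Ψ 0 = id := funext hΨ.start
    have key := continuesAlong_integral (γ := γ) (c := fun t s => Ψ t (unitCircleMap r s)) (h := h)
      (c' := fun s => unitCircleMap r s * (2 * Real.pi * Complex.I))
      hγ.continuousOn
      (hΨ.continuousOn.comp (f := fun q : ℝ × ℝ => (q.1, unitCircleMap r q.2))
        (continuous_fst.prodMk ((continuous_unitCircleMap r).comp continuous_snd)).continuousOn
        fun q hq => ⟨hq.1, mem_univ _⟩)
      (fun t => by simp only [unitCircleMap_one]) (hcd r)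
      (fun s => by simpa only [hΨ.start] using hasDerivAt_unitCircleMap r s) ?_
    · simp only [hΨ.start] at key
      exact hasContinuationAlong_iff.2 (key.congr (hcirc r hr _ hγ0'))
    · intro s
      have hav' : ∀ t ∈ Icc (0 : ℝ) 1, ∃ α, Ψ t (unitCircleMap r s) ∉ fiberRoots (G α) (γ t) := by
        intro t ht
        have := hav _ (hnB s) t ht
        simpa [hZ] using this
      have hne : ∀ t ∈ Icc (0 : ℝ) 1, Ψ t (unitCircleMap r s) ≠ 0 := by
        intro t ht h0
        obtain ⟨α, hα⟩ := hav' t ht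
        exact hα (h0 ▸ hzero α _)
      refine ContinuesAlong.mul ?_ (continuesAlong_of_analyticAt fun t ht => hfac _ (hne t ht))
      refine ContinuesAlong.comp (fun t ht => analyticAt_hyperbolaMap l (hne t ht)) ?_
      refine hcont m γ _ hm hγ (hΨC _) ?_ hne hav'
      rw [hΨ.start]
      exact hyperbolaMap_mem_ball hτ hr hγ0' (norm_unitCircleMap hr0 s)

end AverageContinuation

/-! ### Discriminants and separability -/

section Discriminant

open Polynomial

/-- The resultant is taken with the formal degrees `D` and `D - 1`: it vanishes also when the degree
drops, and its size is unchanged by specialization. -/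
theorem Polynomial.resultant_derivative_ne_zero_iff {L : Type*} [Field L] [CharZero L] {g : L[X]}
    {D : ℕ} (hD : 0 < D) (hg : g.natDegree ≤ D) :
    resultant g (derivative g) D (D - 1) ≠ 0 ↔ g.natDegree = D ∧ g.Separable := by
  rcases hg.eq_or_lt with h | h
  · have hg0 : g ≠ 0 := by rintro rfl; simp at h; omega
    have hder : (derivative g).natDegree = D - 1 := by
      rw [Polynomial.natDegree_derivative, h]
    have := Polynomial.resultant_eq_zero_iff (f := g) (g := derivative g)
    rw [h, hder] at this
    simp [Ne, this, hg0, Polynomial.Separable, h]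
  · have hzero : resultant g (derivative g) D (D - 1) = 0 := by
      by_cases h1 : g.natDegree = 0
      · have : derivative g = 0 := by
          rw [Polynomial.eq_C_of_natDegree_eq_zero h1, derivative_C]
        rw [this, Polynomial.resultant_zero_right, zero_pow hD.ne', zero_mul]
      · refine Polynomial.resultant_eq_zero_of_lt_lt _ _ _ _ h ?_
        have := Polynomial.natDegree_derivative_lt h1
        omega
    simp [hzero, h.ne]

theorem Polynomial.encard_eq_iff_separable {p : ℂ[X]} {D : ℕ} (hD : p.natDegree ≤ D) :
    {u | p.eval u = 0}.encard = D ↔ p.natDegree = D ∧ p.Separable := by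
  have hset : p ≠ 0 → {u | p.eval u = 0} = (p.roots.toFinset : Set ℂ) := by
    intro hp
    ext u; simp [hp]
  constructor
  · intro h
    obtain ⟨hp, hcard, hnat, -⟩ := Polynomial.card_roots_of_encard hD h
    refine ⟨hnat, (Polynomial.nodup_roots_iff_of_splits hp (IsAlgClosed.splits p)).1 ?_⟩
    rw [← Multiset.toFinset_card_eq_card_iff_nodup, hcard,
      Polynomial.splits_iff_card_roots.1 (IsAlgClosed.splits p), hnat]
  · rintro ⟨h1, h2⟩
    rw [hset h2.ne_zero, Set.encard_coe_eq_coe_finsetCard, Multiset.toFinset_card_of_nodup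
      ((Polynomial.nodup_roots_iff_of_splits h2.ne_zero (IsAlgClosed.splits p)).2 h2),
      Polynomial.splits_iff_card_roots.1 (IsAlgClosed.splits p), h1]

/-- The condition that the specialization of `G` has `D` distinct roots is the nonvanishing of a
polynomial, which is not zero if `G` has degree `D` and is separable over some extension field. -/
theorem exists_discriminant {N : ℕ} {G : (MvPolynomial (Fin N) ℂ)[X]} {D : ℕ}
    (hG : G.natDegree ≤ D) (hD : 0 < D) :
    ∃ Δ : MvPolynomial (Fin N) ℂ,
      (∀ x, (fiberRoots G x).encard = D ↔ MvPolynomial.eval x Δ ≠ 0) ∧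
      ∀ (L : Type) [Field L] [CharZero L] (φ : MvPolynomial (Fin N) ℂ →+* L),
        (G.map φ).natDegree = D → (G.map φ).Separable → Δ ≠ 0 := by
  have key : ∀ (L : Type) [Field L] [CharZero L] (φ : MvPolynomial (Fin N) ℂ →+* L),
      φ (resultant G (derivative G) D (D - 1)) ≠ 0 ↔
        (G.map φ).natDegree = D ∧ (G.map φ).Separable := by
    intro L _ _ φ
    rw [← Polynomial.resultant_derivative_ne_zero_iff hD (natDegree_map_le.trans hG),
      Polynomial.derivative_map, Polynomial.resultant_map_map]
  refine ⟨resultant G (derivative G) D (D - 1), fun x => ?_, fun L _ _ φ h1 h2 h0 => ?_⟩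
  · rw [key, ← Polynomial.encard_eq_iff_separable (natDegree_map_le.trans hG)]
    rfl
  · exact (key L φ).2 ⟨h1, h2⟩ (by rw [h0, map_zero])

theorem Squarefree.map_algEquiv {A B : Type*} [CommRing A] [CommRing B] [Algebra ℂ A] [Algebra ℂ B]
    {a : A} (ha : Squarefree a) (e : A ≃ₐ[ℂ] B) : Squarefree (e a) := by
  intro g hg
  have h1 : e.symm g * e.symm g ∣ a := by
    have := map_dvd e.symm hg
    rwa [map_mul, e.symm_apply_apply] at this
  simpa using (ha _ h1).map e

/-- Gauss's lemma: after clearing denominators, the primitive part of a square divisor over `K` has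
its square dividing `G` over `A`, so it is a unit. -/
theorem Squarefree.map_fractionRing {A : Type*} [CommRing A] [IsDomain A]
    [UniqueFactorizationMonoid A] {K : Type*} [Field K] [Algebra A K] [IsFractionRing A K] {G : A[X]}
    (hG : Squarefree G) : Squarefree (G.map (algebraMap A K)) := by
  obtain ⟨_⟩ : Nonempty (NormalizedGCDMonoid A) := inferInstance
  intro g hg
  have hinj : Function.Injective (algebraMap A K) := IsFractionRing.injective A K
  have hG0 : G.map (algebraMap A K) ≠ 0 := (Polynomial.map_ne_zero_iff hinj).2 hG.ne_zero
  have hg0 : g ≠ 0 := by rintro rfl; simp at hg; exact hG0 hg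
  obtain ⟨b, hb, hbg⟩ := IsLocalization.integerNormalization_spec (nonZeroDivisors A) g
  set h := IsLocalization.integerNormalization (nonZeroDivisors A) g with hh
  have hb0 : algebraMap A K b ≠ 0 := by
    rw [Ne, map_eq_zero_iff _ hinj]; exact nonZeroDivisors.ne_zero hb
  have hbg' : h.map (algebraMap A K) = C (algebraMap A K b) * g := by
    rw [hbg, Algebra.smul_def, Polynomial.algebraMap_apply]
  have hne : h ≠ 0 := by
    intro h0
    rw [h0, Polynomial.map_zero] at hbg'
    exact mul_ne_zero (C_ne_zero.2 hb0) hg0 hbg'.symm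
  have hc0 : algebraMap A K h.content ≠ 0 := by
    rw [Ne, map_eq_zero_iff _ hinj, Polynomial.content_eq_zero_iff]; exact hne
  have hassoc : h.primPart.map (algebraMap A K) ∣ g := by
    refine (IsUnit.dvd_mul_left (u := C (algebraMap A K b)) (isUnit_C.2 hb0.isUnit)).1 ?_
    rw [← hbg']
    exact Polynomial.map_dvd _ h.primPart_dvd
  have hassoc' : g ∣ h.primPart.map (algebraMap A K) := by
    refine (IsUnit.dvd_mul_left (u := C (algebraMap A K h.content)) (isUnit_C.2 hc0.isUnit)).1 ?_
    rw [← Polynomial.map_C, ← Polynomial.map_mul, ← h.eq_C_content_mul_primPart, hbg']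
    exact dvd_mul_left _ _
  have hprim := h.isPrimitive_primPart
  have hdvd : h.primPart * h.primPart ∣ G := by
    refine (hprim.mul hprim).dvd_of_fraction_map_dvd_fraction_map (K := K) ?_
    rw [Polynomial.map_mul]
    exact (mul_dvd_mul hassoc hassoc).trans hg
  exact isUnit_of_dvd_unit hassoc' ((hG _ hdvd).map (mapRingHom (algebraMap A K)))

theorem Squarefree.separable_map_fractionRing {A : Type*} [CommRing A] [IsDomain A]
    [UniqueFactorizationMonoid A] [CharZero A] {G : A[X]}
    (hG : Squarefree G) : (G.map (algebraMap A (FractionRing A))).Separable :=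
  PerfectField.separable_iff_squarefree.2 hG.map_fractionRing

end Discriminant

/-! ### Polynomials that are simple in one variable -/

section Simple

variable {n : ℕ}

theorem eval_map_finSuccEquiv_swap (k : Fin (n + 1)) (P : MvPolynomial (Fin (n + 1)) ℂ)
    (s : Fin n → ℂ) (u : ℂ) :
    ((MvPolynomial.finSuccEquiv ℂ n (MvPolynomial.rename (Equiv.swap 0 k) P)).map
      (MvPolynomial.eval s)).eval u =
      MvPolynomial.eval ((Fin.cons u s : Fin (n + 1) → ℂ) ∘ Equiv.swap 0 k) P := by
  rw [← MvPolynomial.eval_eq_eval_mv_eval', MvPolynomial.eval_rename]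

theorem natDegree_finSuccEquiv_swap (k : Fin (n + 1)) (P : MvPolynomial (Fin (n + 1)) ℂ) :
    (MvPolynomial.finSuccEquiv ℂ n (MvPolynomial.rename (Equiv.swap 0 k) P)).natDegree =
      P.degreeOf k := by
  rw [MvPolynomial.natDegree_finSuccEquiv]
  have := MvPolynomial.degreeOf_rename_of_injective (p := P) (Equiv.swap 0 k).injective k
  rwa [Equiv.swap_apply_right] at this

theorem finSuccEquiv_swap_ne_zero (k : Fin (n + 1)) {P : MvPolynomial (Fin (n + 1)) ℂ}
    (hP : P ≠ 0) : MvPolynomial.finSuccEquiv ℂ n (MvPolynomial.rename (Equiv.swap 0 k) P) ≠ 0 := by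
  rw [Ne, EmbeddingLike.map_eq_zero_iff]
  exact (map_ne_zero_iff _ (MvPolynomial.rename_injective _ (Equiv.swap 0 k).injective)).2 hP

theorem IsSimpleIn.exists_good {k : Fin (n + 1)} {P : MvPolynomial (Fin (n + 1)) ℂ}
    (hP : IsSimpleIn k P) : ∃ r : MvPolynomial (Fin n) ℂ, r ≠ 0 ∧
      ∀ s, MvPolynomial.eval s r ≠ 0 →
        {u : ℂ | MvPolynomial.eval ((Fin.cons u s : Fin (n + 1) → ℂ) ∘ Equiv.swap 0 k) P = 0}.encard =
          (P.degreeOf k : ℕ∞) := by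
  obtain ⟨hP0, hnd⟩ := hP
  have hdeg := natDegree_finSuccEquiv_swap k P
  have hne := finSuccEquiv_swap_ne_zero k hP0
  have hev := eval_map_finSuccEquiv_swap k P
  set p := MvPolynomial.finSuccEquiv ℂ n (MvPolynomial.rename (Equiv.swap 0 k) P) with hp
  simp only [← hev, ← hdeg]
  -- The discriminant needs positive degree. In degree zero the polynomial is its constant
  -- coefficient `c`, and `c ≠ 0` at the point leaves no roots.
  rcases Nat.eq_zero_or_pos p.natDegree with h0 | hpos
  · obtain ⟨c, hc⟩ := Polynomial.natDegree_eq_zero.1 h0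
    refine ⟨c, fun h => hne (by rw [← hc, h, Polynomial.C_0]), fun s hs => ?_⟩
    rw [h0, ← hc]
    simp [hs]
  · obtain ⟨Δ, h1, h2⟩ := exists_discriminant (le_refl p.natDegree) hpos
    have hinj : Function.Injective (algebraMap (MvPolynomial (Fin n) ℂ)
        (AlgebraicClosure (FractionRing (MvPolynomial (Fin n) ℂ)))) := by
      rw [IsScalarTower.algebraMap_eq (MvPolynomial (Fin n) ℂ)
        (FractionRing (MvPolynomial (Fin n) ℂ)), RingHom.coe_comp]
      exact (algebraMap (FractionRing (MvPolynomial (Fin n) ℂ)) (AlgebraicClosure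
        (FractionRing (MvPolynomial (Fin n) ℂ)))).injective.comp
        (IsFractionRing.injective (MvPolynomial (Fin n) ℂ) _)
    have hne' := (Polynomial.map_ne_zero_iff hinj).2 hne
    refine ⟨Δ, h2 _ _ (Polynomial.natDegree_map_eq_of_injective hinj p)
      ((Polynomial.nodup_roots_iff_of_splits hne' (IsAlgClosed.splits _)).1 hnd), fun s hs => ?_⟩
    exact (h1 s).2 hs

theorem Squarefree.isSimpleIn {P : MvPolynomial (Fin (n + 1)) ℂ} (hP : Squarefree P)
    (k : Fin (n + 1)) : IsSimpleIn k P := by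
  refine ⟨hP.ne_zero, ?_⟩
  set p := MvPolynomial.finSuccEquiv ℂ n (MvPolynomial.rename (Equiv.swap 0 k) P) with hp
  have hsq : Squarefree p := by
    have h1 : Squarefree (MvPolynomial.rename (Equiv.swap 0 k) P) :=
      hP.map_algEquiv (MvPolynomial.renameEquiv ℂ (Equiv.swap 0 k))
    exact h1.map_algEquiv (MvPolynomial.finSuccEquiv ℂ n)
  have h1 := hsq.separable_map_fractionRing
  have h2 := h1.map (f := algebraMap (FractionRing (MvPolynomial (Fin n) ℂ))
    (AlgebraicClosure (FractionRing (MvPolynomial (Fin n) ℂ))))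
  rw [Polynomial.map_map, ← IsScalarTower.algebraMap_eq] at h2
  exact (Polynomial.nodup_roots_iff_of_splits h2.ne_zero (IsAlgClosed.splits _)).2 h2

end Simple

/-! ### The substitution `v = ξ / u` in a bivariate polynomial -/

section Twist

open Polynomial

variable {R : Type*} [CommRing R]

/-- The polynomial `u ^ N * p(u, ξ / u)` in `u`, for a polynomial `p(u, v)` of degree at most `N`
in `v`; the outer variable of `p` is `v`. -/
noncomputable def twist (N : ℕ) (ξ : R) (p : R[X][X]) : R[X] :=
  ∑ l ∈ Finset.range (N + 1), p.coeff l * (C ξ ^ l * X ^ (N - l))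

/-- The bivariate polynomial `p(u, v)` has degree at most `M` in `u` and at most `N` in `v`. -/
def BiDegreeLE (p : R[X][X]) (M N : ℕ) : Prop :=
  p.natDegree ≤ N ∧ ∀ l, (p.coeff l).natDegree ≤ M

theorem BiDegreeLE.mono {p : R[X][X]} {M N M' N' : ℕ} (h : BiDegreeLE p M N) (hM : M ≤ M')
    (hN : N ≤ N') : BiDegreeLE p M' N' :=
  ⟨h.1.trans hN, fun l => (h.2 l).trans hM⟩

theorem BiDegreeLE.add {p q : R[X][X]} {M N : ℕ} (hp : BiDegreeLE p M N)
    (hq : BiDegreeLE q M N) : BiDegreeLE (p + q) M N :=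
  ⟨natDegree_add_le_of_degree_le hp.1 hq.1, fun l => by
    rw [coeff_add]; exact natDegree_add_le_of_degree_le (hp.2 l) (hq.2 l)⟩

theorem BiDegreeLE.mul {p q : R[X][X]} {M N M' N' : ℕ} (hp : BiDegreeLE p M N)
    (hq : BiDegreeLE q M' N') : BiDegreeLE (p * q) (M + M') (N + N') :=
  ⟨natDegree_mul_le_of_le hp.1 hq.1, fun l => by
    rw [coeff_mul]
    exact natDegree_sum_le_of_forall_le _ _ fun x _ => natDegree_mul_le_of_le (hp.2 _) (hq.2 _)⟩

theorem biDegreeLE_C {a : R[X]} {M : ℕ} (ha : a.natDegree ≤ M) : BiDegreeLE (C a) M 0 :=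
  ⟨by simp, fun l => by
    rw [coeff_C]; split_ifs
    · exact ha
    · simp⟩

theorem biDegreeLE_X : BiDegreeLE (X : R[X][X]) 0 1 :=
  ⟨natDegree_X_le, fun l => by
    rw [coeff_X]; split_ifs <;> simp⟩

theorem BiDegreeLE.pow {p : R[X][X]} {M N : ℕ} (hp : BiDegreeLE p M N) (m : ℕ) :
    BiDegreeLE (p ^ m) (m * M) (m * N) := by
  induction m with
  | zero => simpa using biDegreeLE_C (a := (1 : R[X])) (by simp)
  | succ m ih => rw [pow_succ, Nat.succ_mul, Nat.succ_mul]; exact ih.mul hp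

theorem BiDegreeLE.prod {σ : Type*} (s : Finset σ) {f : σ → R[X][X]} {a b : σ → ℕ}
    (h : ∀ k, BiDegreeLE (f k) (a k) (b k)) :
    BiDegreeLE (∏ k ∈ s, f k) (∑ k ∈ s, a k) (∑ k ∈ s, b k) := by
  classical
  induction s using Finset.induction_on with
  | empty => simpa using biDegreeLE_C (a := (1 : R[X])) (by simp)
  | insert k s hk ih =>
    rw [Finset.prod_insert hk, Finset.sum_insert hk, Finset.sum_insert hk]
    exact (h k).mul ih

theorem BiDegreeLE.sum {ι : Type*} (s : Finset ι) {f : ι → R[X][X]} {M N : ℕ}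
    (h : ∀ k ∈ s, BiDegreeLE (f k) M N) : BiDegreeLE (∑ k ∈ s, f k) M N :=
  ⟨natDegree_sum_le_of_forall_le _ _ fun k hk => (h k hk).1, fun l => by
    rw [finsetSum_coeff]
    exact natDegree_sum_le_of_forall_le _ _ fun k hk => (h k hk).2 l⟩

theorem biDegreeLE_aeval {σ : Type*} [Fintype σ] [Algebra ℂ R] (P : MvPolynomial σ ℂ)
    {f : σ → R[X][X]} {a b : σ → ℕ} (h : ∀ k, BiDegreeLE (f k) (a k) (b k)) {M N : ℕ}
    (hM : ∀ m ∈ P.support, ∑ k, m k * a k ≤ M) (hN : ∀ m ∈ P.support, ∑ k, m k * b k ≤ N) :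
    BiDegreeLE (MvPolynomial.aeval f P) M N := by
  rw [MvPolynomial.aeval_def, MvPolynomial.eval₂_eq']
  refine BiDegreeLE.sum _ fun m hm => ?_
  have h1 := (BiDegreeLE.prod Finset.univ fun k => (h k).pow (m k)).mono (hM m hm) (hN m hm)
  have h2 := (biDegreeLE_C (a := C (algebraMap ℂ R (P.coeff m))) (M := 0) (by simp)).mul h1
  rw [zero_add, zero_add] at h2
  exact h2

theorem biDegreeLE_aeval_of_le_one {σ : Type*} [Fintype σ] [DecidableEq σ] [Algebra ℂ R]
    (P : MvPolynomial σ ℂ) {f : σ → R[X][X]} {i j : σ}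
    (h : ∀ k, BiDegreeLE (f k) (if k = i then 1 else 0) (if k = j then 1 else 0)) :
    BiDegreeLE (MvPolynomial.aeval f P) (P.degreeOf i) (P.degreeOf j) := by
  refine biDegreeLE_aeval P h (fun m hm => ?_) fun m hm => ?_
  · simpa using MvPolynomial.monomial_le_degreeOf i hm
  · simpa using MvPolynomial.monomial_le_degreeOf j hm

theorem natDegree_twist_le {p : R[X][X]} {M N : ℕ} (hp : BiDegreeLE p M N) (ξ : R) :
    (twist N ξ p).natDegree ≤ M + N := by
  refine natDegree_sum_le_of_forall_le _ _ fun l _ => natDegree_mul_le_of_le (hp.2 l) ?_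
  rw [← C_pow]
  exact (natDegree_C_mul_X_pow_le _ _).trans (Nat.sub_le _ _)

/-- `w` plays the role of `ξ / u`. Asking only for `u * w = ξ` covers both evaluation at `u ≠ 0` and
a target ring in which `u` is not invertible. -/
theorem map_twist {S : Type*} [CommRing S] (ψ : R[X] →+* S) {w : S} {ξ : R}
    (hw : ψ X * w = ψ (C ξ)) {N : ℕ} {p : R[X][X]} (hp : p.natDegree ≤ N) :
    ψ (twist N ξ p) = ψ X ^ N * p.eval₂ ψ w := by
  rw [eval₂_eq_sum_range' ψ (Nat.lt_succ_of_le hp), twist, map_sum, Finset.mul_sum]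
  refine Finset.sum_congr rfl fun l hl => ?_
  have hl' : l ≤ N := Nat.lt_succ_iff.1 (Finset.mem_range.1 hl)
  rw [map_mul, map_mul, map_pow, map_pow, ← hw, ← Nat.sub_add_cancel hl', pow_add (ψ X)]
  simp only [Nat.add_sub_cancel]
  ring

theorem coeff_twist_zero (N : ℕ) (ξ : R) (p : R[X][X]) :
    (twist N ξ p).coeff 0 = (p.coeff N).coeff 0 * ξ ^ N := by
  rw [twist, finsetSum_coeff, Finset.sum_eq_single N]
  · rw [Nat.sub_self, pow_zero, mul_one, mul_coeff_zero, ← C_pow, coeff_C_zero]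
  · intro l hl hlN
    have hl' : l ≤ N := Nat.lt_succ_iff.1 (Finset.mem_range.1 hl)
    rw [mul_coeff_zero, mul_coeff_zero, coeff_X_pow, if_neg (by omega), mul_zero, mul_zero]
  · intro h; exact absurd (Finset.mem_range.2 (Nat.lt_succ_self N)) h

theorem coeff_twist_top {p : R[X][X]} {M N : ℕ} (hp : BiDegreeLE p M N) (ξ : R) :
    (twist N ξ p).coeff (M + N) = (p.coeff 0).coeff M := by
  rw [twist, finsetSum_coeff, Finset.sum_eq_single 0]
  · simp [coeff_mul_X_pow]
  · intro l hl hl0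
    have hl' : l ≤ N := Nat.lt_succ_iff.1 (Finset.mem_range.1 hl)
    refine coeff_eq_zero_of_natDegree_lt ?_
    refine lt_of_le_of_lt (natDegree_mul_le_of_le (n := N - l) (hp.2 l) ?_) (by omega)
    rw [← C_pow]
    exact natDegree_C_mul_X_pow_le _ _
  · simp

theorem eval_map_twist {N : ℕ} {ξ : R} {p : R[X][X]} (hp : p.natDegree ≤ N) (φ : R →+* ℂ)
    {u : ℂ} (hu : u ≠ 0) :
    ((twist N ξ p).map φ).eval u = u ^ N * p.eval₂ (eval₂RingHom φ u) (φ ξ / u) := by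
  have := map_twist (eval₂RingHom φ u) (w := φ ξ / u) (ξ := ξ)
    (by simp [mul_div_cancel₀, hu]) hp
  simpa [eval_map] using this

theorem eval₂_aeval {σ : Type*} {n : ℕ} (P : MvPolynomial σ ℂ)
    (f : σ → (MvPolynomial (Fin n) ℂ)[X][X]) (x : Fin n → ℂ) (u v : ℂ) :
    (MvPolynomial.aeval f P).eval₂ (eval₂RingHom (MvPolynomial.eval x) u) v =
      MvPolynomial.eval
        (fun k => (f k).eval₂ (eval₂RingHom (MvPolynomial.eval x) u) v) P := by
  induction P using MvPolynomial.induction_on with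
  | C a =>
    rw [MvPolynomial.aeval_C, MvPolynomial.eval_C, Polynomial.algebraMap_apply,
      Polynomial.algebraMap_apply, eval₂_C, coe_eval₂RingHom, eval₂_C, MvPolynomial.algebraMap_eq,
      MvPolynomial.eval_C]
  | add p q hp hq => rw [map_add, map_add, eval₂_add, hp, hq]
  | mul_X p k hp => rw [map_mul, map_mul, eval₂_mul, hp, MvPolynomial.aeval_X, MvPolynomial.eval_X]

theorem Squarefree.polynomial_C {B : Type*} [CommRing B] [IsDomain B] {b : B} (hb : Squarefree b) :
    Squarefree (C b) := by
  intro g hg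
  have hb0 : (C b : B[X]) ≠ 0 := C_ne_zero.2 hb.ne_zero
  have hdeg : g.natDegree = 0 := by
    obtain ⟨q, hq⟩ := hg
    have hne := hq ▸ hb0
    have h1 := congrArg natDegree hq
    rw [natDegree_C, natDegree_mul (left_ne_zero_of_mul hne) (right_ne_zero_of_mul hne),
      natDegree_mul (left_ne_zero_of_mul (left_ne_zero_of_mul hne))
        (left_ne_zero_of_mul (left_ne_zero_of_mul hne))] at h1
    omega
  obtain ⟨a, rfl⟩ := natDegree_eq_zero.1 hdeg
  rw [← C_mul] at hg
  have hab : a * a ∣ b := by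
    rw [C_dvd_iff_dvd_coeff] at hg
    simpa using hg 0
  exact isUnit_C.2 (hb a hab)

/-- Split off the full power of `X` from `h`. The square of the remaining factor is prime to `X`, so
it divides `C b`, and squarefreeness makes the factor a unit. -/
theorem exists_eq_C_mul_X_pow_of_sq_dvd {B : Type*} [CommRing B] [IsDomain B] {b : B}
    (hb : Squarefree b) {h : B[X]} {m : ℕ} (hdvd : h * h ∣ X ^ m * C b) :
    ∃ c : B, IsUnit c ∧ ∃ k, h = C c * X ^ k := by
  have hne : h ≠ 0 := by
    rintro rfl
    have : (X ^ m * C b : B[X]) = 0 := by simpa using hdvd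
    exact mul_ne_zero (pow_ne_zero _ X_ne_zero) (C_ne_zero.2 hb.ne_zero) this
  have hfin : FiniteMultiplicity (X : B[X]) h := by
    simpa using finiteMultiplicity_X_sub_C (0 : B) hne
  obtain ⟨q, hq, hX⟩ := hfin.exists_eq_pow_mul_and_not_dvd
  have hqq : ¬ X ∣ q * q := fun h => (prime_X.dvd_or_dvd h).elim hX hX
  have h2 : q * q ∣ C b := by
    have h3 : q * q ∣ X ^ m * C b :=
      (mul_dvd_mul (hq ▸ dvd_mul_left _ _) (hq ▸ dvd_mul_left _ _)).trans hdvd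
    obtain ⟨d, hd⟩ := h3
    have h4 : X ^ m ∣ d := prime_X.pow_dvd_of_dvd_mul_left m hqq ⟨C b, hd.symm⟩
    obtain ⟨e, rfl⟩ := h4
    refine ⟨e, mul_left_cancel₀ (pow_ne_zero m X_ne_zero) (hd.trans ?_)⟩
    ring
  obtain ⟨c, hc, hcq⟩ := Polynomial.isUnit_iff.1 (hb.polynomial_C q h2)
  exact ⟨c, hc, _, by rw [mul_comm, hcq]; exact hq⟩

end Twist

/-! ### Lifted paths, algebraic sets and root counts -/

theorem ContinuableAvoiding.mono {n : ℕ} {f : (Fin n → ℂ) → ℂ} {V W : Set (Fin n → ℂ)}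
    (h : ContinuableAvoiding f V) (hVW : V ⊆ W) : ContinuableAvoiding f W := by
  obtain ⟨τ, hτ, hf, H⟩ := h
  exact ⟨τ, hτ, hf, fun γ hγ h0 hW => H γ hγ h0 fun t ht hV => hW t ht (hVW hV)⟩

/-- Continuation of a germ composed with a linear map, along lifted paths. -/
theorem ContinuableAvoiding.continuesAlong_comp_linear {n N : ℕ} {f : (Fin n → ℂ) → ℂ}
    {V : Set (Fin n → ℂ)} (h : ContinuableAvoiding f V) (l : Fin N)
    {A : (Fin N → ℂ) × ℂ × ℂ → Fin n → ℂ} (hA : IsLinearMap ℂ A) :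
    ∃ τ : ℝ, 0 < τ ∧ AnalyticOnNhd ℂ (fun y => f (A y)) (Metric.ball 0 τ) ∧
      ∀ (m : ℕ) (γ : ℝ → Fin N → ℂ) (η : ℝ → ℂ), 0 < m → ContDiffOn ℝ 1 γ (Icc 0 1) →
        IsPiecewiseC1 m η → hyperbolaMap l (γ 0, η 0) ∈ Metric.ball 0 τ →
        (∀ t ∈ Icc (0 : ℝ) 1, η t ≠ 0) →
        (∀ t ∈ Icc (0 : ℝ) 1, A (hyperbolaMap l (γ t, η t)) ∉ V) →
        ContinuesAlong (fun y => f (A y)) fun t => hyperbolaMap l (γ t, η t) := by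
  obtain ⟨L, hL⟩ : ∃ L : (Fin N → ℂ) × ℂ × ℂ →L[ℂ] Fin n → ℂ, ∀ y, L y = A y :=
    ⟨LinearMap.toContinuousLinearMap (hA.mk' A), fun y => rfl⟩
  simp only [← hL]
  obtain ⟨τ, hτ, hf, H⟩ := h.continuesAlong
  have hnhds : L ⁻¹' Metric.ball 0 τ ∈ 𝓝 (0 : (Fin N → ℂ) × ℂ × ℂ) :=
    L.continuous.continuousAt.preimage_mem_nhds (by simpa using Metric.ball_mem_nhds 0 hτ)
  obtain ⟨τ', hτ', hsub⟩ := Metric.mem_nhds_iff.1 hnhds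
  refine ⟨τ', hτ', fun y hy => AnalyticAt.comp (g := f) (hf _ (hsub hy)) (L.analyticAt y),
    fun m γ η hm hγ hη h0 hη0 hV => ?_⟩
  refine ContinuesAlong.comp (f := f) (fun t _ => L.analyticAt _) ?_
  refine H m _ hm (fun i hi => ?_) (hsub h0) hV
  have hmR : (0 : ℝ) < m := by exact_mod_cast hm
  have hsub : Icc ((i : ℝ) / m) ((i + 1) / m) ⊆ Icc 0 1 := by
    refine Icc_subset_Icc (by positivity) ?_
    rw [div_le_one hmR]
    exact_mod_cast hi
  have h1 := hγ.mono hsub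
  have h2 := hη i hi
  have h3 : ContDiffOn ℝ 1 (fun t => γ t l) (Icc ((i : ℝ) / m) ((i + 1) / m)) :=
    contDiffOn_pi.1 h1 l
  have h4 : ContDiffOn ℝ 1 (fun t => γ t l / η t) (Icc ((i : ℝ) / m) ((i + 1) / m)) := by
    simp only [div_eq_mul_inv]
    exact h3.mul (h2.inv fun t ht => hη0 t (hsub ht))
  exact (L.restrictScalars ℝ).contDiff.comp_contDiffOn (h1.prodMk (h2.prodMk h4))

theorem isProperAlgebraicSubvariety_of_forall_mem_iff {n : ℕ} {ι : Type*} {V : Set (Fin n → ℂ)}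
    (Δ : ι → MvPolynomial (Fin n) ℂ)
    (hV : ∀ x, x ∈ V ↔ ∀ α, MvPolynomial.eval x (Δ α) = 0) (hne : V ≠ univ) :
    IsProperAlgebraicSubvariety V := by
  refine ⟨⟨Ideal.span (range Δ), ?_⟩, hne⟩
  ext x
  rw [hV, MvPolynomial.zeroLocus_span]
  simp

theorem exists_eval_ne_zero {n : ℕ} {p : MvPolynomial (Fin n) ℂ} (hp : p ≠ 0) :
    ∃ x, MvPolynomial.eval x p ≠ 0 := by
  by_contra! h
  exact hp (MvPolynomial.funext fun x => by rw [h, map_zero])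

/-- The roots of `P` in its `k`-th variable are infinite in number or at most `degreeOf k P`. -/
theorem encard_slice_le {n : ℕ} (k : Fin (n + 1)) (P : MvPolynomial (Fin (n + 1)) ℂ)
    (s : Fin n → ℂ) (h : {u : ℂ | MvPolynomial.eval
      ((Fin.cons u s : Fin (n + 1) → ℂ) ∘ Equiv.swap 0 k) P = 0}.Finite) :
    {u : ℂ | MvPolynomial.eval
      ((Fin.cons u s : Fin (n + 1) → ℂ) ∘ Equiv.swap 0 k) P = 0}.encard ≤ P.degreeOf k := by
  have hev := eval_map_finSuccEquiv_swap k P s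
  have hdeg := natDegree_finSuccEquiv_swap k P
  simp only [← hev] at h ⊢
  rw [← hdeg]
  set p := (MvPolynomial.finSuccEquiv ℂ n (MvPolynomial.rename (Equiv.swap 0 k) P)).map
    (MvPolynomial.eval s) with hp
  have hp0 : p ≠ 0 := by
    rintro h0
    rw [h0] at h
    exact Set.infinite_univ (by simpa using h)
  have : {u | p.eval u = 0} = (p.roots.toFinset : Set ℂ) := by ext u; simp [hp0]
  rw [this, Set.encard_coe_eq_coe_finsetCard]
  exact_mod_cast (Multiset.toFinset_card_le _).trans
    ((Polynomial.card_roots' _).trans Polynomial.natDegree_map_le)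

/-- `z ↦ c / z` is a bijection of the nonzero numbers, so the count is that of a union of two sets
of at most `M` and `N` elements; equality holds exactly if both are full and disjoint. The bounds
presuppose finiteness because a slice of a polynomial may vanish identically. -/
theorem encard_union_div_eq_iff {A B : Set ℂ} {c : ℂ} {M N : ℕ} (hc : c ≠ 0)
    (hA : A.Finite → A.encard ≤ M) (hB : B.Finite → B.encard ≤ N) :
    (insert 0 {u : ℂ | u ≠ 0 ∧ (u ∈ A ∨ c / u ∈ B)}).encard = (M + N + 1 : ℕ) ↔
      {z | z ≠ 0 ∧ z ∈ A}.encard = M ∧ {z | z ≠ 0 ∧ z ∈ B}.encard = N ∧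
        ∀ ω Ω : ℂ, ω ∈ A → Ω ∈ B → c ≠ ω * Ω := by
  set A' := {z | z ≠ 0 ∧ z ∈ A} with hA'
  set B' := {z | z ≠ 0 ∧ z ∈ B} with hB'
  set B'' := {z | z ≠ 0 ∧ c / z ∈ B} with hB''
  have hset : {u : ℂ | u ≠ 0 ∧ (u ∈ A ∨ c / u ∈ B)} = A' ∪ B'' := by
    ext u; simp only [hA', hB'', mem_union, mem_ofPred_eq]; tauto
  have himg : B'' = (fun z => c / z) '' B' := by
    ext z
    simp only [hB', hB'', mem_image, mem_ofPred_eq]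
    constructor
    · rintro ⟨h1, h2⟩
      exact ⟨c / z, ⟨div_ne_zero hc h1, h2⟩, by field_simp⟩
    · rintro ⟨w, ⟨h1, h2⟩, rfl⟩
      exact ⟨div_ne_zero hc h1, by rwa [show c / (c / w) = w by field_simp]⟩
  have hinj : InjOn (fun z : ℂ => c / z) B' := by
    intro a ha b hb hab
    have ha0 : a ≠ 0 := ha.1
    have hb0 : b ≠ 0 := hb.1
    have : c / a = c / b := hab
    field_simp at this
    exact this.symm
  have hcard : B''.encard = B'.encard := by rw [himg, hinj.encard_image]
  have hdisj : (∀ ω Ω : ℂ, ω ∈ A → Ω ∈ B → c ≠ ω * Ω) ↔ Disjoint A' B'' := by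
    rw [Set.disjoint_left]
    constructor
    · rintro h u ⟨h1, h2⟩ ⟨-, h3⟩
      exact h u _ h2 h3 (by field_simp)
    · rintro h ω Ω h1 h2 rfl
      have hω := left_ne_zero_of_mul hc
      exact h ⟨hω, h1⟩ ⟨hω, by rwa [mul_div_cancel_left₀ _ hω]⟩
  have h0 : (0 : ℂ) ∉ A' ∪ B'' := by
    rintro (h | h) <;> exact h.1 rfl
  rw [hset, hdisj, Set.encard_insert_of_notMem h0, ← hcard]
  have hadd := Set.encard_union_add_encard_inter A' B''
  push_cast
  have hcancel : (A' ∪ B'').encard + 1 = (M : ℕ∞) + N + 1 ↔ (A' ∪ B'').encard = M + N :=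
    (ENat.add_left_injective_of_ne_top ENat.one_ne_top).eq_iff
  rw [hcancel]
  constructor
  · intro h
    have hfin : (A' ∪ B'').Finite := by
      rw [← Set.encard_ne_top_iff, h]; exact_mod_cast ENat.natCast_ne_top (M + N)
    have hA'f : A'.Finite := hfin.subset subset_union_left
    have hB''f : B''.Finite := hfin.subset subset_union_right
    have hB'f : B'.Finite := by
      rw [← Set.encard_ne_top_iff, ← hcard, Set.encard_ne_top_iff]; exact hB''f
    have hAf : A.Finite := (hA'f.insert 0).subset fun z hz => by
      by_cases hz0 : z = 0
      · exact Or.inl hz0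
      · exact Or.inr ⟨hz0, hz⟩
    have hBf : B.Finite := (hB'f.insert 0).subset fun z hz => by
      by_cases hz0 : z = 0
      · exact Or.inl hz0
      · exact Or.inr ⟨hz0, hz⟩
    have hA1 : A'.encard ≤ M := (Set.encard_le_encard fun z hz => hz.2).trans (hA hAf)
    have hB1 : B''.encard ≤ N := hcard ▸ (Set.encard_le_encard fun z hz => hz.2).trans (hB hBf)
    have hI := (hA'f.inter_of_left B'')
    rw [h] at hadd
    rw [Set.disjoint_iff_inter_eq_empty, ← Set.encard_eq_zero]
    rw [← hA'f.cast_ncard_eq] at hA1 hadd ⊢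
    rw [← hB''f.cast_ncard_eq] at hB1 hadd ⊢
    rw [← hI.cast_ncard_eq] at hadd ⊢
    norm_cast at hA1 hB1 hadd ⊢
    omega
  · rintro ⟨h1, h2, h3⟩
    rw [Set.encard_union_eq h3, h1, h2]

/-! ### The averaged product of two germs -/

section Theta

open Polynomial

/-- The polynomial `u * P(ξ₁, q, p + u) * (u ^ N * Q(ξ₂, q + ξ₃ / u, p))` in `u`. -/
noncomputable def thetaPolynomial (P Q : MvPolynomial (Fin 3) ℂ) :
    (MvPolynomial (Fin 5) ℂ)[X] :=
  X * twist (Q.degreeOf 1) (MvPolynomial.X 2)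
    (MvPolynomial.aeval ![C (C (MvPolynomial.X 0)), C (C (MvPolynomial.X 3)),
        C (C (MvPolynomial.X 4) + X)] P *
      MvPolynomial.aeval ![C (C (MvPolynomial.X 1)), C (C (MvPolynomial.X 3)) + X,
        C (C (MvPolynomial.X 4))] Q)

theorem biDegreeLE_theta (P Q : MvPolynomial (Fin 3) ℂ) :
    BiDegreeLE (R := MvPolynomial (Fin 5) ℂ)
      (MvPolynomial.aeval ![C (C (MvPolynomial.X 0)), C (C (MvPolynomial.X 3)),
        C (C (MvPolynomial.X 4) + X)] P *
      MvPolynomial.aeval ![C (C (MvPolynomial.X 1)), C (C (MvPolynomial.X 3)) + X,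
        C (C (MvPolynomial.X 4))] Q) (P.degreeOf 2) (Q.degreeOf 1) := by
  have h1 := biDegreeLE_aeval (R := MvPolynomial (Fin 5) ℂ) P
    (f := ![C (C (MvPolynomial.X 0)), C (C (MvPolynomial.X 3)), C (C (MvPolynomial.X 4) + X)])
    (a := ![0, 0, 1]) (b := 0) (M := P.degreeOf 2) (N := 0)
    (by
      intro k
      fin_cases k
      · exact biDegreeLE_C (by simp)
      · exact biDegreeLE_C (by simp)
      · exact biDegreeLE_C (natDegree_add_le_of_degree_le (by simp) natDegree_X_le))
    (fun m hm => by simpa [Fin.sum_univ_three] using MvPolynomial.monomial_le_degreeOf 2 hm)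
    (by simp)
  have h2 := biDegreeLE_aeval (R := MvPolynomial (Fin 5) ℂ) Q
    (f := ![C (C (MvPolynomial.X 1)), C (C (MvPolynomial.X 3)) + X, C (C (MvPolynomial.X 4))])
    (a := 0) (b := ![0, 1, 0]) (M := 0) (N := Q.degreeOf 1)
    (by
      intro k
      fin_cases k
      · exact biDegreeLE_C (by simp)
      · exact ((biDegreeLE_C (M := 0) (by simp)).mono le_rfl zero_le_one).add biDegreeLE_X
      · exact biDegreeLE_C (by simp))
    (by simp)
    (fun m hm => by simpa [Fin.sum_univ_three] using MvPolynomial.monomial_le_degreeOf 1 hm)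
  simpa using h1.mul h2

theorem natDegree_thetaPolynomial_le (P Q : MvPolynomial (Fin 3) ℂ) :
    (thetaPolynomial P Q).natDegree ≤ P.degreeOf 2 + Q.degreeOf 1 + 1 := by
  rw [add_comm _ 1]
  exact natDegree_mul_le_of_le natDegree_X_le (natDegree_twist_le (biDegreeLE_theta P Q) _)

theorem fiberRoots_thetaPolynomial (P Q : MvPolynomial (Fin 3) ℂ) (x : Fin 5 → ℂ) :
    fiberRoots (thetaPolynomial P Q) x = insert 0 {u : ℂ | u ≠ 0 ∧
      (u ∈ {z : ℂ | MvPolynomial.eval ![x 0, x 3, x 4 + z] P = 0} ∨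
        x 2 / u ∈ {z : ℂ | MvPolynomial.eval ![x 1, x 3 + z, x 4] Q = 0})} := by
  ext u
  by_cases hu : u = 0
  · simp [hu, fiberRoots, thetaPolynomial]
  · rw [fiberRoots, thetaPolynomial, mem_ofPred_eq, Polynomial.map_mul, eval_mul, map_X, eval_X,
      eval_map_twist (biDegreeLE_theta P Q).1 _ hu, eval₂_mul, eval₂_aeval, eval₂_aeval]
    have h1 : (fun k => ((![C (C (MvPolynomial.X 0)), C (C (MvPolynomial.X 3)),
        C (C (MvPolynomial.X 4) + X)] : Fin 3 → (MvPolynomial (Fin 5) ℂ)[X][X]) k).eval₂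
          (eval₂RingHom (MvPolynomial.eval x) u) (MvPolynomial.eval x (MvPolynomial.X 2) / u)) =
        ![x 0, x 3, x 4 + u] := by
      funext k; fin_cases k <;> simp
    have h2 : (fun k => ((![C (C (MvPolynomial.X 1)), C (C (MvPolynomial.X 3)) + X,
        C (C (MvPolynomial.X 4))] : Fin 3 → (MvPolynomial (Fin 5) ℂ)[X][X]) k).eval₂
          (eval₂RingHom (MvPolynomial.eval x) u) (MvPolynomial.eval x (MvPolynomial.X 2) / u)) =
        ![x 1, x 3 + x 2 / u, x 4] := by
      funext k; fin_cases k <;> simp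
    rw [h1, h2]
    simp [hu]

theorem encard_setOf_add {A : Set ℂ} (c : ℂ) : {z : ℂ | c + z ∈ A}.encard = A.encard := by
  have : A = (fun z => c + z) '' {z : ℂ | c + z ∈ A} := by
    ext z
    exact ⟨fun h => ⟨z - c, by simpa using h, by simp⟩, fun ⟨w, h, e⟩ => e ▸ h⟩
  conv_rhs => rw [this]
  exact ((add_right_injective c).encard_image _).symm

theorem cons_comp_swap_two (a b u : ℂ) :
    (Fin.cons u ![b, a] : Fin 3 → ℂ) ∘ Equiv.swap 0 2 = ![a, b, u] := by
  funext k
  fin_cases k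
  · rfl
  · rfl
  · rfl

theorem cons_comp_swap_one (a b u : ℂ) :
    (Fin.cons u ![a, b] : Fin 3 → ℂ) ∘ Equiv.swap 0 1 = ![a, u, b] := by
  funext k
  fin_cases k
  · rfl
  · rfl
  · rfl

theorem encard_slice_two_le (P : MvPolynomial (Fin 3) ℂ) (a b c : ℂ)
    (h : {z : ℂ | MvPolynomial.eval ![a, b, c + z] P = 0}.Finite) :
    {z : ℂ | MvPolynomial.eval ![a, b, c + z] P = 0}.encard ≤ P.degreeOf 2 := by
  have h1 := encard_slice_le 2 P ![b, a]
  have h2 := encard_setOf_add (A := {z : ℂ | MvPolynomial.eval ![a, b, z] P = 0}) c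
  simp only [cons_comp_swap_two] at h1
  rw [← Set.encard_ne_top_iff] at h h1
  simp only [mem_ofPred_eq] at h2
  rw [h2] at h ⊢
  exact h1 h

theorem encard_slice_one_le (P : MvPolynomial (Fin 3) ℂ) (a b c : ℂ)
    (h : {z : ℂ | MvPolynomial.eval ![a, c + z, b] P = 0}.Finite) :
    {z : ℂ | MvPolynomial.eval ![a, c + z, b] P = 0}.encard ≤ P.degreeOf 1 := by
  have h1 := encard_slice_le 1 P ![a, b]
  have h2 := encard_setOf_add (A := {z : ℂ | MvPolynomial.eval ![a, z, b] P = 0}) c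
  simp only [cons_comp_swap_one] at h1
  rw [← Set.encard_ne_top_iff] at h h1
  simp only [mem_ofPred_eq] at h2
  rw [h2] at h ⊢
  exact h1 h

/-- The condition `x 2 ≠ 0` stands apart since the count need not imply it: when `Q` has degree `0`
in `q`, the count can be full at `x 2 = 0`. -/
theorem notMem_thetaAvoided_iff (P Q : MvPolynomial (Fin 3) ℂ) (x : Fin 5 → ℂ) :
    x ∉ thetaAvoided P Q ↔ x 2 ≠ 0 ∧
      (fiberRoots (thetaPolynomial P Q) x).encard = (P.degreeOf 2 + Q.degreeOf 1 + 1 : ℕ) := by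
  rw [thetaAvoided, notMem_compl_iff, mem_ofPred_eq]
  by_cases h : x 2 = 0
  · simp [h]
  · rw [fiberRoots_thetaPolynomial, encard_union_div_eq_iff h (encard_slice_two_le P _ _ _)
      (encard_slice_one_le Q _ _ _)]
    simp only [mem_ofPred_eq]
    tauto

theorem exists_forall_mem_thetaAvoided_iff (P Q : MvPolynomial (Fin 3) ℂ) :
    ∃ Δ : MvPolynomial (Fin 5) ℂ, ∀ x, x ∈ thetaAvoided P Q ↔ MvPolynomial.eval x Δ = 0 := by
  obtain ⟨Δ, hΔ, -⟩ := exists_discriminant (natDegree_thetaPolynomial_le P Q) (Nat.succ_pos _)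
  refine ⟨MvPolynomial.X 2 * Δ, fun x => ?_⟩
  rw [← not_iff_not, notMem_thetaAvoided_iff, hΔ]
  simp

/-- A generic `(ξ₁,ξ₂,q,p)` gives full root sets without `0`; then `ξ₃` is taken outside the finite
set of products of roots. -/
theorem thetaAvoided_ne_univ {P Q : MvPolynomial (Fin 3) ℂ} (hP : IsSimpleIn 2 P)
    (hQ : IsSimpleIn 1 Q) : thetaAvoided P Q ≠ univ := by
  obtain ⟨r, hr0, hr⟩ := hP.exists_good
  obtain ⟨s, hs0, hs⟩ := hQ.exists_good
  have hinj : ∀ {n : ℕ} {e : Fin n → Fin 4}, Function.Injective e →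
      ∀ {p : MvPolynomial (Fin n) ℂ}, p ≠ 0 → MvPolynomial.rename e p ≠ 0 := fun he _ hp =>
    (map_ne_zero_iff _ (MvPolynomial.rename_injective _ he)).2 hp
  -- The point `y` is `(ξ₁,ξ₂,q,p)`. The order `![2, 0]` reflects the swap of variables in
  -- `IsSimpleIn`; the factors `P` and `Q` ensure that `0` is not a root.
  have hprod : MvPolynomial.rename (![2, 0] : Fin 2 → Fin 4) r *
      MvPolynomial.rename (![1, 3] : Fin 2 → Fin 4) s *
      MvPolynomial.rename (![0, 2, 3] : Fin 3 → Fin 4) P *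
      MvPolynomial.rename (![1, 2, 3] : Fin 3 → Fin 4) Q ≠ 0 :=
    mul_ne_zero (mul_ne_zero (mul_ne_zero (hinj (by decide) hr0) (hinj (by decide) hs0))
      (hinj (by decide) hP.1)) (hinj (by decide) hQ.1)
  obtain ⟨y, hy⟩ := exists_eval_ne_zero hprod
  have c1 : y ∘ ![2, 0] = ![y 2, y 0] := by funext k; fin_cases k <;> rfl
  have c2 : y ∘ ![1, 3] = ![y 1, y 3] := by funext k; fin_cases k <;> rfl
  have c3 : y ∘ ![0, 2, 3] = ![y 0, y 2, y 3] := by funext k; fin_cases k <;> rfl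
  have c4 : y ∘ ![1, 2, 3] = ![y 1, y 2, y 3] := by funext k; fin_cases k <;> rfl
  simp only [map_mul, MvPolynomial.eval_rename, c1, c2, c3, c4] at hy
  obtain ⟨hy, hyQ⟩ := mul_ne_zero_iff.1 hy
  obtain ⟨hy, hyP⟩ := mul_ne_zero_iff.1 hy
  obtain ⟨hyr, hys⟩ := mul_ne_zero_iff.1 hy
  have hA := hr _ hyr
  have hB := hs _ hys
  simp only [cons_comp_swap_two] at hA
  simp only [cons_comp_swap_one] at hB
  have hA2 := encard_setOf_add (A := {z : ℂ | MvPolynomial.eval ![y 0, y 2, z] P = 0}) (y 3)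
  have hB2 := encard_setOf_add (A := {z : ℂ | MvPolynomial.eval ![y 1, z, y 3] Q = 0}) (y 2)
  rw [hA] at hA2
  rw [hB] at hB2
  simp only [mem_ofPred_eq] at hA2 hB2
  set A := {z : ℂ | MvPolynomial.eval ![y 0, y 2, y 3 + z] P = 0} with hAdef
  set B := {z : ℂ | MvPolynomial.eval ![y 1, y 2 + z, y 3] Q = 0} with hBdef
  have hAf : A.Finite := by rw [← Set.encard_ne_top_iff, hA2]; exact ENat.natCast_ne_top _
  have hBf : B.Finite := by rw [← Set.encard_ne_top_iff, hB2]; exact ENat.natCast_ne_top _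
  have hbad : (insert 0 (Set.image2 (fun ω Ω => ω * Ω) A B)).Finite := (hAf.image2 _ hBf).insert 0
  obtain ⟨c, hc⟩ := hbad.infinite_compl.nonempty
  rw [Set.mem_compl_iff, Set.mem_insert_iff, not_or] at hc
  rw [Set.ne_univ_iff_exists_notMem]
  have hA0 : {z : ℂ | z ≠ 0 ∧ MvPolynomial.eval ![y 0, y 2, y 3 + z] P = 0} = A := by
    ext z
    refine ⟨fun h => h.2, fun h => ⟨?_, h⟩⟩
    rintro rfl
    exact hyP (by simpa [hAdef] using h)
  have hB0 : {z : ℂ | z ≠ 0 ∧ MvPolynomial.eval ![y 1, y 2 + z, y 3] Q = 0} = B := by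
    ext z
    refine ⟨fun h => h.2, fun h => ⟨?_, h⟩⟩
    rintro rfl
    exact hyQ (by simpa [hBdef] using h)
  refine ⟨![y 0, y 1, c, y 2, y 3], ?_⟩
  rw [thetaAvoided, notMem_compl_iff, mem_ofPred_eq]
  refine ⟨(congrArg Set.encard hA0).trans hA2, (congrArg Set.encard hB0).trans hB2, hc.1,
    fun ω Ω hω hΩ h => hc.2 ⟨ω, hω, Ω, hΩ, h.symm⟩⟩

theorem isProperAlgebraicSubvariety_iInter_thetaAvoided {ι : Type*} [Nonempty ι]
    {P Q : ι → MvPolynomial (Fin 3) ℂ} (hP : ∀ α, IsSimpleIn 2 (P α))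
    (hQ : ∀ α, IsSimpleIn 1 (Q α)) :
    IsProperAlgebraicSubvariety (⋂ α, thetaAvoided (P α) (Q α)) := by
  choose Δ hΔ using fun α => exists_forall_mem_thetaAvoided_iff (P α) (Q α)
  refine isProperAlgebraicSubvariety_of_forall_mem_iff Δ (fun x => ?_) fun h => ?_
  · simp only [mem_iInter, hΔ]
  · obtain ⟨α⟩ := ‹Nonempty ι›
    exact thetaAvoided_ne_univ (hP α) (hQ α) (Set.iInter_eq_univ.1 h α)

/-- At a contour point that is not a root for the pair `(J, K)`, neither `P J` nor `Q K` vanishes at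
the argument of its germ, so both factors continue. The final enlargement of the avoided set only
adds `ξ₃ = 0`. -/
theorem continuableAvoiding_thetaProduct {ι κ : Type*} {P : ι → MvPolynomial (Fin 3) ℂ}
    {Q : κ → MvPolynomial (Fin 3) ℂ} {f g : (Fin 3 → ℂ) → ℂ}
    (hf : ContinuableAvoiding f (⋂ J, zeroSet (P J)))
    (hg : ContinuableAvoiding g (⋂ K, zeroSet (Q K))) :
    ContinuableAvoiding (thetaProduct f g) (⋂ α : ι × κ, thetaAvoided (P α.1) (Q α.2)) := by
  obtain ⟨τ₁, hτ₁, hf1, hf2⟩ := hf.continuesAlong_comp_linear (N := 5) 2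
    (A := fun y => ![y.1 0, y.1 3, y.1 4 + y.2.1])
    ⟨fun x y => by simp; ring, fun c x => by simp; ring⟩
  obtain ⟨τ₂, hτ₂, hg1, hg2⟩ := hg.continuesAlong_comp_linear (N := 5) 2
    (A := fun y => ![y.1 1, y.1 3 + y.2.2, y.1 4])
    ⟨fun x y => by simp; ring, fun c x => by simp; ring⟩
  have hb1 := Metric.ball_subset_ball (x := (0 : (Fin 5 → ℂ) × ℂ × ℂ)) (min_le_left τ₁ τ₂)
  have hb2 := Metric.ball_subset_ball (x := (0 : (Fin 5 → ℂ) × ℂ × ℂ)) (min_le_right τ₁ τ₂)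
  refine (continuableAvoiding_thetaAverage (l := 2)
    (k := fun y : (Fin 5 → ℂ) × ℂ × ℂ => f ![y.1 0, y.1 3, y.1 4 + y.2.1] *
      g ![y.1 1, y.1 3 + y.2.2, y.1 4]) (lt_min hτ₁ hτ₂)
    (fun y hy => (hf1 y (hb1 hy)).mul (hg1 y (hb2 hy)))
    (fun α : ι × κ => natDegree_thetaPolynomial_le (P α.1) (Q α.2))
    (fun α x => by rw [fiberRoots_thetaPolynomial]; exact mem_insert _ _)
    fun m γ η hm hγ hη h0 hη0 hav => ?_).mono fun x hx => ?_
  · refine (hf2 m γ η hm hγ hη (hb1 h0) hη0 fun t ht hmem => ?_).mul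
      (hg2 m γ η hm hγ hη (hb2 h0) hη0 fun t ht hmem => ?_)
    · obtain ⟨α, hα⟩ := hav t ht
      rw [fiberRoots_thetaPolynomial] at hα
      exact hα (Or.inr ⟨hη0 t ht, Or.inl (mem_iInter.1 hmem α.1)⟩)
    · obtain ⟨α, hα⟩ := hav t ht
      rw [fiberRoots_thetaPolynomial] at hα
      exact hα (Or.inr ⟨hη0 t ht, Or.inr (mem_iInter.1 hmem α.2)⟩)
  · refine mem_iInter.2 fun α => ?_
    by_contra h
    exact hx α ((notMem_thetaAvoided_iff _ _ x).1 h).2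

end Theta

/-! ### The operator `⊙ᵢⱼ` -/

section Hadamard

open Polynomial

variable {n : ℕ}

theorem shiftTwo_apply (i j : Fin n) (z : Fin n → ℂ) (a b : ℂ) (k : Fin n) :
    shiftTwo i j z a b k = z k + (if k = i then a else 0) + (if k = j then b else 0) := by
  simp [shiftTwo, Pi.single_apply]

/-- The coordinates of `z + u eᵢ + v eⱼ`, as polynomials in `v` and `u`. -/
noncomputable def shiftCoordinate (i j k : Fin n) : (MvPolynomial (Fin (n + 1)) ℂ)[X][X] :=
  C (C (MvPolynomial.X k.succ)) + (if k = i then C X else 0) + (if k = j then X else 0)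

theorem biDegreeLE_shiftCoordinate (i j k : Fin n) : BiDegreeLE (shiftCoordinate i j k)
    (if k = i then 1 else 0) (if k = j then 1 else 0) := by
  have h0 : BiDegreeLE (0 : (MvPolynomial (Fin (n + 1)) ℂ)[X][X]) 0 0 := by
    simpa using biDegreeLE_C (a := (0 : (MvPolynomial (Fin (n + 1)) ℂ)[X])) (M := 0) (by simp)
  refine BiDegreeLE.add (BiDegreeLE.add ?_ ?_) ?_
  · exact (biDegreeLE_C (M := 0) (by simp)).mono (Nat.zero_le _) (Nat.zero_le _)
  · split_ifs with h h'
    · exact (biDegreeLE_C natDegree_X_le).mono le_rfl zero_le_one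
    · exact biDegreeLE_C natDegree_X_le
    · exact h0.mono le_rfl zero_le_one
    · exact h0
  · split_ifs with h h' h'
    · exact biDegreeLE_X.mono zero_le_one le_rfl
    · exact biDegreeLE_X
    · exact h0.mono zero_le_one le_rfl
    · exact h0

/-- The polynomial `u ^ N * P(z + u eᵢ + (ξ / u) eⱼ)` in `u`. -/
noncomputable def hadamardPolynomial (i j : Fin n) (P : MvPolynomial (Fin n) ℂ) :
    (MvPolynomial (Fin (n + 1)) ℂ)[X] :=
  twist (P.degreeOf j) (MvPolynomial.X 0) (MvPolynomial.aeval (shiftCoordinate i j) P)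

theorem biDegreeLE_hadamard (i j : Fin n) (P : MvPolynomial (Fin n) ℂ) :
    BiDegreeLE (MvPolynomial.aeval (shiftCoordinate i j) P) (P.degreeOf i) (P.degreeOf j) :=
  biDegreeLE_aeval_of_le_one P (biDegreeLE_shiftCoordinate i j)

theorem natDegree_hadamardPolynomial_le (i j : Fin n) (P : MvPolynomial (Fin n) ℂ) :
    (hadamardPolynomial i j P).natDegree ≤ P.degreeOf i + P.degreeOf j :=
  natDegree_twist_le (biDegreeLE_hadamard i j P) _

theorem natDegree_X_mul_hadamardPolynomial_le (i j : Fin n) (P : MvPolynomial (Fin n) ℂ) :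
    (X * hadamardPolynomial i j P).natDegree ≤ P.degreeOf i + P.degreeOf j + 1 := by
  rw [add_comm (P.degreeOf i + P.degreeOf j) 1]
  exact natDegree_mul_le_of_le natDegree_X_le (natDegree_hadamardPolynomial_le i j P)

theorem fiberRoots_hadamardPolynomial (i j : Fin n) (P : MvPolynomial (Fin n) ℂ)
    (w : Fin (n + 1) → ℂ) :
    fiberRoots (X * hadamardPolynomial i j P) w = insert 0 {u : ℂ | u ≠ 0 ∧
      MvPolynomial.eval (shiftTwo i j (Fin.tail w) u (w 0 / u)) P = 0} := by
  ext u
  by_cases hu : u = 0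
  · simp [hu, fiberRoots]
  · rw [fiberRoots, hadamardPolynomial, mem_ofPred_eq, Polynomial.map_mul, eval_mul, map_X, eval_X,
      eval_map_twist (biDegreeLE_hadamard i j P).1 _ hu, eval₂_aeval]
    have h1 : (fun k => (shiftCoordinate i j k).eval₂ (eval₂RingHom (MvPolynomial.eval w) u)
        (MvPolynomial.eval w (MvPolynomial.X 0) / u)) =
        shiftTwo i j (Fin.tail w) u (w 0 / u) := by
      funext k
      rw [shiftTwo_apply, shiftCoordinate]
      split_ifs <;> simp [Fin.tail]
    rw [h1]
    simp [hu]

theorem notMem_hadamardAvoided_iff (i j : Fin n) (P : MvPolynomial (Fin n) ℂ)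
    (w : Fin (n + 1) → ℂ) :
    w ∉ hadamardAvoided i j P ↔ (fiberRoots (X * hadamardPolynomial i j P) w).encard =
      (P.degreeOf i + P.degreeOf j + 1 : ℕ) := by
  rw [hadamardAvoided, notMem_compl_iff, mem_ofPred_eq, fiberRoots_hadamardPolynomial,
    Set.encard_insert_of_notMem (fun h => h.1 rfl), Nat.cast_add_one]
  exact (ENat.add_left_injective_of_ne_top ENat.one_ne_top).eq_iff.symm

theorem continuableAvoiding_hadamardOp {i j : Fin n} {P : MvPolynomial (Fin n) ℂ}
    {F : (Fin n → ℂ) → ℂ} (hF : ContinuableAvoiding F (zeroSet P)) :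
    ContinuableAvoiding (hadamardOp i j F) (hadamardAvoided i j P) := by
  obtain ⟨τ, hτ, hF1, hF2⟩ := hF.continuesAlong_comp_linear (N := n + 1) 0
    (A := fun y => shiftTwo i j (Fin.tail y.1) y.2.1 y.2.2)
    ⟨fun x y => by
      funext k
      simp only [shiftTwo_apply, Pi.add_apply, Fin.tail, Prod.fst_add, Prod.snd_add]
      split_ifs <;> ring,
    fun c x => by
      funext k
      simp only [shiftTwo_apply, Pi.smul_apply, Fin.tail, Prod.smul_fst, Prod.smul_snd, smul_eq_mul]
      split_ifs <;> ring⟩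
  refine (continuableAvoiding_thetaAverage (l := 0) hτ hF1
    (fun _ : Unit => natDegree_X_mul_hadamardPolynomial_le i j P)
    (fun _ x => by rw [fiberRoots_hadamardPolynomial]; exact mem_insert _ _)
    fun m γ η hm hγ hη h0 hη0 hav => hF2 m γ η hm hγ hη h0 hη0 fun t ht hmem => ?_).mono
      fun x hx => ?_
  · obtain ⟨-, hα⟩ := hav t ht
    rw [fiberRoots_hadamardPolynomial] at hα
    exact hα (Or.inr ⟨hη0 t ht, hmem⟩)
  · by_contra h
    exact hx () ((notMem_hadamardAvoided_iff _ _ _ x).1 h)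

/-- The top coefficient of `P(z + u eᵢ)` in `u` is the leading coefficient of `P` in `zᵢ`. To see
that it is nonzero, it is evaluated at points with `zᵢ = 0`, where the shift just replaces `zᵢ` by
`u`. -/
theorem coeff_aeval_shift_ne_zero (i : Fin n) {P : MvPolynomial (Fin n) ℂ} (hP : P ≠ 0) :
    (MvPolynomial.aeval (fun k : Fin n => (C (MvPolynomial.X k.succ) + if k = i then X else 0 :
      (MvPolynomial (Fin (n + 1)) ℂ)[X])) P).coeff (P.degreeOf i) ≠ 0 := by
  obtain _ | n := n
  · exact i.elim0
  set q := MvPolynomial.aeval (fun k : Fin (n + 1) => (C (MvPolynomial.X k.succ) +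
    if k = i then X else 0 : (MvPolynomial (Fin (n + 2)) ℂ)[X])) P with hq
  have hev : ∀ (w : Fin (n + 2) → ℂ) (u : ℂ), (q.map (MvPolynomial.eval w)).eval u =
      MvPolynomial.eval (fun k => w k.succ + if k = i then u else 0) P := by
    intro w u
    have h1 : (MvPolynomial.eval w : MvPolynomial (Fin (n + 2)) ℂ →+* ℂ) =
        (MvPolynomial.aeval w : MvPolynomial (Fin (n + 2)) ℂ →ₐ[ℂ] ℂ) := by
      rw [MvPolynomial.coe_aeval_eq_eval]
    have h2 := MvPolynomial.comp_aeval_apply (fun k : Fin (n + 1) => (C (MvPolynomial.X k.succ) +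
      if k = i then X else 0 : (MvPolynomial (Fin (n + 2)) ℂ)[X]))
      (aevalTower (MvPolynomial.aeval w : MvPolynomial (Fin (n + 2)) ℂ →ₐ[ℂ] ℂ) u) P
    rw [← hq] at h2
    rw [eval_map, h1]
    refine h2.trans ?_
    rw [MvPolynomial.aeval_eq_eval]
    congr 2
    funext k
    split_ifs <;> simp
  intro h0
  have hdeg := natDegree_finSuccEquiv_swap i P
  have hne := finSuccEquiv_swap_ne_zero i hP
  obtain ⟨s, hs⟩ := exists_eval_ne_zero (leadingCoeff_ne_zero.2 hne)
  refine hs ?_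
  have hfun : (MvPolynomial.finSuccEquiv ℂ n (MvPolynomial.rename (Equiv.swap 0 i) P)).map
      (MvPolynomial.eval s) = q.map (MvPolynomial.eval
        (Fin.cons 0 ((Fin.cons 0 s : Fin (n + 1) → ℂ) ∘ Equiv.swap 0 i))) := by
    refine Polynomial.funext fun u => ?_
    rw [hev, eval_map_finSuccEquiv_swap]
    congr 2
    funext k
    by_cases hk : k = i
    · simp [hk]
    · have h1 : Equiv.swap 0 i k ≠ 0 := fun h => hk (by simpa using Equiv.swap_apply_eq_iff.1 h)
      obtain ⟨l, hl⟩ := Fin.exists_succ_eq.2 h1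
      simp [hk, ← hl]
  rw [leadingCoeff, hdeg, ← coeff_map, hfun, coeff_map, h0, map_zero]

/-- The constant coefficient is `ξ^N` times the coefficient of `u⁰ v^N` in `P(z + u eᵢ + v eⱼ)`.
Putting `u = 0` leaves a shift in `eⱼ` alone, also for `i = j`. -/
theorem coeff_zero_hadamardPolynomial_ne_zero (i j : Fin n) {P : MvPolynomial (Fin n) ℂ}
    (hP : P ≠ 0) : (hadamardPolynomial i j P).coeff 0 ≠ 0 := by
  rw [hadamardPolynomial, coeff_twist_zero]
  refine mul_ne_zero ?_ (pow_ne_zero _ (MvPolynomial.X_ne_zero 0))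
  have h := MvPolynomial.comp_aeval_apply (shiftCoordinate i j)
    (mapAlgHom (Polynomial.aeval (0 : MvPolynomial (Fin (n + 1)) ℂ)) |>.restrictScalars ℂ) P
  have h2 : (fun k => (mapAlgHom (Polynomial.aeval (0 : MvPolynomial (Fin (n + 1)) ℂ)) |>.restrictScalars ℂ)
      (shiftCoordinate i j k)) = fun k : Fin n => (C (MvPolynomial.X k.succ) + if k = j then X else 0 :
      (MvPolynomial (Fin (n + 1)) ℂ)[X]) := by
    funext k
    rw [shiftCoordinate]
    split_ifs <;> simp
  have h3 := coeff_aeval_shift_ne_zero j hP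
  rw [← h2, ← h] at h3
  simpa [coeff_zero_eq_aeval_zero] using h3

theorem coeff_top_hadamardPolynomial_ne_zero (i j : Fin n) {P : MvPolynomial (Fin n) ℂ}
    (hP : P ≠ 0) : (hadamardPolynomial i j P).coeff (P.degreeOf i + P.degreeOf j) ≠ 0 := by
  rw [hadamardPolynomial, coeff_twist_top (biDegreeLE_hadamard i j P)]
  have h := MvPolynomial.comp_aeval_apply (shiftCoordinate i j)
    ((Polynomial.aeval (0 : (MvPolynomial (Fin (n + 1)) ℂ)[X])).restrictScalars ℂ) P
  have h2 : (fun k => ((Polynomial.aeval (0 : (MvPolynomial (Fin (n + 1)) ℂ)[X])).restrictScalars ℂ)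
      (shiftCoordinate i j k)) = fun k : Fin n => (C (MvPolynomial.X k.succ) + if k = i then X else 0 :
      (MvPolynomial (Fin (n + 1)) ℂ)[X]) := by
    funext k
    rw [shiftCoordinate]
    split_ifs <;> simp
  have h3 := coeff_aeval_shift_ne_zero i hP
  rw [← h2, ← h] at h3
  simpa [coeff_zero_eq_aeval_zero] using h3

/-- The substitution `ξ ↦ u v`, `z ↦ z - u eᵢ - v eⱼ`, which turns `P(z + u eᵢ + (ξ / u) eⱼ)`
into `P(z)`. -/
noncomputable def unshift (i j : Fin n) :
    (MvPolynomial (Fin (n + 1)) ℂ)[X] →ₐ[ℂ] (MvPolynomial (Fin n) ℂ)[X][X] :=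
  aevalTower (MvPolynomial.aeval (Fin.cons (C X * X) fun k => C (C (MvPolynomial.X k)) -
    (if k = i then X else 0) - (if k = j then C X else 0) :
      Fin (n + 1) → (MvPolynomial (Fin n) ℂ)[X][X])) X

theorem unshift_X (i j : Fin n) : unshift i j X = X := by simp [unshift]

theorem unshift_hadamardPolynomial (i j : Fin n) (P : MvPolynomial (Fin n) ℂ) :
    unshift i j (hadamardPolynomial i j P) = X ^ P.degreeOf j * C (C P) := by
  -- In the target the outer `X` is `u` and `C X` is `v`; since `ξ ↦ u v`, the quotient `ξ / u` is
  -- represented by `v`.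
  have h1 := map_twist (S := (MvPolynomial (Fin n) ℂ)[X][X]) (unshift i j : (MvPolynomial (Fin (n + 1)) ℂ)[X] →+*
    (MvPolynomial (Fin n) ℂ)[X][X]) (w := C X) (ξ := MvPolynomial.X 0)
    (by simp [unshift]) (biDegreeLE_hadamard i j P).1
  refine h1.trans ?_
  have h2 := MvPolynomial.comp_aeval_apply (B := (MvPolynomial (Fin n) ℂ)[X][X])
    (shiftCoordinate i j) (aevalTower (A' := (MvPolynomial (Fin n) ℂ)[X][X]) (unshift i j) (C X)) P
  have h3 : (fun k => (aevalTower (A' := (MvPolynomial (Fin n) ℂ)[X][X]) (unshift i j) (C X))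
      (shiftCoordinate i j k)) = fun k => C (C (MvPolynomial.X k)) := by
    funext k
    rw [shiftCoordinate]
    split_ifs <;> simp only [map_add, map_zero, unshift, aevalTower_C, aevalTower_X,
      MvPolynomial.aeval_X, Fin.cons_succ] <;> split_ifs <;> ring
  have h4 := MvPolynomial.comp_aeval_apply (B := (MvPolynomial (Fin n) ℂ)[X][X]) (MvPolynomial.X : Fin n → MvPolynomial (Fin n) ℂ)
    ((CAlgHom (R := ℂ) (A := (MvPolynomial (Fin n) ℂ)[X])).comp
      (CAlgHom (R := ℂ) (A := MvPolynomial (Fin n) ℂ))) P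
  rw [MvPolynomial.aeval_X_left_apply] at h4
  rw [RingHom.coe_coe, unshift_X]
  congr 1
  refine h2.trans ?_
  rw [h3]
  exact h4.symm

/-- Once `u` is invertible, `v ↦ ξ / u` and `z ↦ z + u eᵢ + (ξ / u) eⱼ` undo the substitution. This
yields injectivity of `unshift`. -/
theorem exists_comp_unshift {K : Type*} [Field K] [Algebra ℂ K] (i j : Fin n)
    (φ : (MvPolynomial (Fin (n + 1)) ℂ)[X] →ₐ[ℂ] K) (hu : φ X ≠ 0) :
    ∃ δ : (MvPolynomial (Fin n) ℂ)[X][X] →ₐ[ℂ] K, δ.comp (unshift i j) = φ := by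
  set δ : (MvPolynomial (Fin n) ℂ)[X][X] →ₐ[ℂ] K :=
    aevalTower (aevalTower (MvPolynomial.aeval fun k => φ (C (MvPolynomial.X k.succ)) +
      (if k = i then φ X else 0) + (if k = j then φ (C (MvPolynomial.X 0)) / φ X else 0))
      (φ (C (MvPolynomial.X 0)) / φ X)) (φ X) with hδ
  have hsub : ∀ a b, δ (a - b) = δ a - δ b := fun a b => map_sub δ a b
  refine ⟨δ, Polynomial.algHom_ext' (MvPolynomial.algHom_ext fun k => ?_) (by simp [unshift, hδ])⟩
  refine Fin.cases ?_ (fun k => ?_) k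
  · simp [unshift, hu, hδ]
  · simp only [unshift, AlgHom.comp_apply, CAlgHom_apply, aevalTower_C, MvPolynomial.aeval_X,
      Fin.cons_succ]
    rw [hsub, hsub]
    split_ifs <;> simp only [hδ, map_zero, aevalTower_C, aevalTower_X, MvPolynomial.aeval_X] <;>
      split_ifs <;> ring

theorem unshift_injective (i j : Fin n) : Function.Injective (unshift i j) := by
  have hinj := IsFractionRing.injective (MvPolynomial (Fin (n + 1)) ℂ)[X]
    (FractionRing (MvPolynomial (Fin (n + 1)) ℂ)[X])
  obtain ⟨δ, hδ⟩ := exists_comp_unshift i j (IsScalarTower.toAlgHom ℂ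
    (MvPolynomial (Fin (n + 1)) ℂ)[X] (FractionRing (MvPolynomial (Fin (n + 1)) ℂ)[X]))
    ((map_ne_zero_iff _ hinj).2 X_ne_zero)
  intro a b hab
  refine hinj ?_
  have h := congrArg δ hab
  rwa [← AlgHom.comp_apply, ← AlgHom.comp_apply, hδ] at h

/-- Under `unshift` the polynomial becomes `u ^ (N + 1) * P(z)`, whose square divisors come from `c
u^k` with `c` a unit. By injectivity `g = c u^k`, and `k > 0` would make `u` divide
`hadamardPolynomial`, whose constant coefficient is not zero. -/
theorem Squarefree.X_mul_hadamardPolynomial {P : MvPolynomial (Fin n) ℂ} (hP : Squarefree P)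
    (i j : Fin n) : Squarefree (X * hadamardPolynomial i j P) := by
  intro g hg
  have h1 := map_dvd (unshift i j) hg
  rw [map_mul, map_mul, unshift_X, unshift_hadamardPolynomial, ← mul_assoc, ← pow_succ'] at h1
  obtain ⟨c, hc, k, hk⟩ := exists_eq_C_mul_X_pow_of_sq_dvd hP.polynomial_C h1
  obtain ⟨c', hc', rfl⟩ := Polynomial.isUnit_iff.1 hc
  obtain ⟨a, ha, rfl⟩ := MvPolynomial.isUnit_iff_eq_C_of_isReduced.1 hc'
  have hgk : g = C (MvPolynomial.C a) * X ^ k := by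
    refine unshift_injective i j (hk.trans ?_)
    rw [map_mul, map_pow, unshift_X]
    congr 1
    simp [unshift, Polynomial.algebraMap_apply, MvPolynomial.algebraMap_eq]
  have hunit : IsUnit (C (MvPolynomial.C a) : (MvPolynomial (Fin (n + 1)) ℂ)[X]) :=
    isUnit_C.2 (ha.map MvPolynomial.C)
  rcases Nat.eq_zero_or_pos k with rfl | hk0
  · rwa [hgk, pow_zero, mul_one]
  · have hX : X ∣ g := hgk ▸ (dvd_pow_self X hk0.ne').mul_left _
    have h2 : X ∣ hadamardPolynomial i j P :=
      (mul_dvd_mul_iff_left X_ne_zero).1 ((mul_dvd_mul hX hX).trans hg)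
    exact absurd (X_dvd_iff.1 h2) (coeff_zero_hadamardPolynomial_ne_zero i j hP.ne_zero)

theorem natDegree_X_mul_hadamardPolynomial (i j : Fin n) {P : MvPolynomial (Fin n) ℂ}
    (hP : P ≠ 0) :
    (X * hadamardPolynomial i j P).natDegree = P.degreeOf i + P.degreeOf j + 1 := by
  have h := coeff_top_hadamardPolynomial_ne_zero i j hP
  refine le_antisymm (natDegree_X_mul_hadamardPolynomial_le i j P) (le_natDegree_of_ne_zero ?_)
  rwa [coeff_X_mul]

theorem isProperAlgebraicSubvariety_hadamardAvoided {P : MvPolynomial (Fin n) ℂ}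
    (hP : Squarefree P) (i j : Fin n) : IsProperAlgebraicSubvariety (hadamardAvoided i j P) := by
  obtain ⟨Δ, hΔ, hne⟩ := exists_discriminant (natDegree_X_mul_hadamardPolynomial_le i j P)
    (Nat.succ_pos _)
  have hmem : ∀ w, w ∈ hadamardAvoided i j P ↔ MvPolynomial.eval w Δ = 0 := fun w => by
    rw [← not_iff_not, notMem_hadamardAvoided_iff, hΔ]
  refine isProperAlgebraicSubvariety_of_forall_mem_iff (fun _ : Unit => Δ)
    (fun w => by simp [hmem]) ?_
  have hΔ0 : Δ ≠ 0 := hne (FractionRing (MvPolynomial (Fin (n + 1)) ℂ)) (algebraMap _ _)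
    (by rw [natDegree_map_eq_of_injective (IsFractionRing.injective _ _),
      natDegree_X_mul_hadamardPolynomial i j hP.ne_zero])
    (hP.X_mul_hadamardPolynomial i j).separable_map_fractionRing
  obtain ⟨w, hw⟩ := exists_eval_ne_zero hΔ0
  exact Set.ne_univ_iff_exists_notMem _ |>.2 ⟨w, fun h => hw ((hmem w).1 h)⟩

end Hadamard

/-! ### Reduction to squarefree hypersurfaces and conclusion -/

/-- An algebro-resurgent germ continues off the zero set of a squarefree polynomial. -/
theorem IsAlgebroResurgent.exists_squarefree {n : ℕ} {f : (Fin n → ℂ) → ℂ}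
    (h : IsAlgebroResurgent f) :
    ∃ P : MvPolynomial (Fin n) ℂ, Squarefree P ∧ ContinuableAvoiding f (zeroSet P) := by
  obtain ⟨V, ⟨⟨I, rfl⟩, hne⟩, hf⟩ := h
  obtain ⟨_⟩ : Nonempty (NormalizedGCDMonoid (MvPolynomial (Fin n) ℂ)) := inferInstance
  obtain ⟨p, hpI, hp⟩ : ∃ p ∈ I, p ≠ 0 := by
    by_contra! h
    refine hne (Set.eq_univ_of_forall fun x => ?_)
    rw [MvPolynomial.mem_zeroLocus_iff]
    intro p hp
    rw [h p hp, map_zero]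
  -- `p` divides a power of its radical, so the radical vanishes wherever `p` does, in particular on
  -- `V`.
  refine ⟨UniqueFactorizationMonoid.radical p, UniqueFactorizationMonoid.squarefree_radical,
    hf.mono fun x hx => ?_⟩
  have hx' : MvPolynomial.eval x p = 0 := by
    have := MvPolynomial.mem_zeroLocus_iff.1 hx p hpI
    rwa [MvPolynomial.aeval_eq_eval] at this
  obtain ⟨k, hk⟩ := UniqueFactorizationMonoid.exists_dvd_pow_iff_radical_dvd hp |>.2
    (dvd_refl (UniqueFactorizationMonoid.radical p))
  have h1 := map_dvd (MvPolynomial.eval x) hk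
  rw [map_pow, hx', zero_dvd_iff] at h1
  exact eq_zero_of_pow_eq_zero h1

theorem mainTheorem6 :
    (∀ f g : (Fin 3 → ℂ) → ℂ, IsAlgebroResurgent f → IsAlgebroResurgent g →
      IsAlgebroResurgent (thetaProduct f g)) ∧
    (∀ (R S : ℕ) (_ : 0 < R) (_ : 0 < S)
      (P : Fin R → MvPolynomial (Fin 3) ℂ) (Q : Fin S → MvPolynomial (Fin 3) ℂ),
      (∀ J, IsSimpleIn 2 (P J)) → (∀ K, IsSimpleIn 1 (Q K)) →
      (∀ J K, IsProperAlgebraicSubvariety (thetaAvoided (P J) (Q K))) ∧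
      IsProperAlgebraicSubvariety (⋂ J, ⋂ K, thetaAvoided (P J) (Q K)) ∧
      ∀ f g : (Fin 3 → ℂ) → ℂ,
        ContinuableAvoiding f (⋂ J, zeroSet (P J)) →
        ContinuableAvoiding g (⋂ K, zeroSet (Q K)) →
        ContinuableAvoiding (thetaProduct f g) (⋂ J, ⋂ K, thetaAvoided (P J) (Q K))) ∧
    (∀ (n : ℕ) (i j : Fin n) (F : (Fin n → ℂ) → ℂ), IsAlgebroResurgent F →
      IsAlgebroResurgent (hadamardOp i j F)) ∧
    (∀ (n : ℕ) (i j : Fin n) (P : MvPolynomial (Fin n) ℂ), P ≠ 0 →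
      (Squarefree P → IsProperAlgebraicSubvariety (hadamardAvoided i j P)) ∧
      ∀ F : (Fin n → ℂ) → ℂ, ContinuableAvoiding F (zeroSet P) →
        ContinuableAvoiding (hadamardOp i j F) (hadamardAvoided i j P)) := by
  refine ⟨fun f g hf hg => ?_, fun R S hR hS P Q hP hQ => ?_, fun n i j F hF => ?_,
    fun n i j P _ => ⟨fun hP => isProperAlgebraicSubvariety_hadamardAvoided hP i j,
      fun F hF => continuableAvoiding_hadamardOp hF⟩⟩
  · obtain ⟨P, hP, hfP⟩ := hf.exists_squarefree
    obtain ⟨Q, hQ, hgQ⟩ := hg.exists_squarefree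
    refine ⟨_, isProperAlgebraicSubvariety_iInter_thetaAvoided (ι := Unit × Unit)
      (P := fun _ => P) (Q := fun _ => Q) (fun _ => hP.isSimpleIn 2) (fun _ => hQ.isSimpleIn 1),
      continuableAvoiding_thetaProduct (ι := Unit) (κ := Unit) (P := fun _ => P)
        (Q := fun _ => Q) ?_ ?_⟩
    · rwa [iInter_const]
    · rwa [iInter_const]
  · have hne : Nonempty (Fin R × Fin S) := ⟨(⟨0, hR⟩, ⟨0, hS⟩)⟩
    have heq : ⋂ J, ⋂ K, thetaAvoided (P J) (Q K) =
        ⋂ α : Fin R × Fin S, thetaAvoided (P α.1) (Q α.2) := by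
      ext x
      simp only [mem_iInter, Prod.forall]
    rw [heq]
    refine ⟨fun J K => ?_, isProperAlgebraicSubvariety_iInter_thetaAvoided (fun α => hP α.1)
      fun α => hQ α.2, fun f g hf hg => continuableAvoiding_thetaProduct hf hg⟩
    have h := isProperAlgebraicSubvariety_iInter_thetaAvoided (ι := Unit) (P := fun _ => P J)
      (Q := fun _ => Q K) (fun _ => hP J) fun _ => hQ K
    rwa [iInter_const] at h
  · obtain ⟨P, hP, hFP⟩ := hF.exists_squarefree
    exact ⟨_, isProperAlgebraicSubvariety_hadamardAvoided hP i j,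
      continuableAvoiding_hadamardOp hFP⟩
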